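/- **Setting.** Let $d_X,d_Y\ge 1$, let $\mathcal X\subset\mathbb R^{d_X}$, $\mathcal Y\subset\mathbb R^{d_Y}$ be compact convex sets with diameters at most $D_{\mathcal X}$, $D_{\mathcal Y}$, and let $\xi\sim P$ be a random element. Let $T\ge1$ and let $F_1,\dots,F_T$ be an arbitrary sequence of jointly measurable functions $F_t(x,y,\xi)$ on $\mathbb R^{d_X}\times\mathbb R^{d_Y}$, integrable in $\xi$, and continuously differentiable in $x$ and in $y$. Put $f_t(x,y)=\mathbf E_\xi F_t(x,y,\xi)$. Suppose, for every $t\le T$: 1. on $\mathcal X\times\mathcal Y$, $F_t(\cdot,\cdot,\xi)$ is $\mu_X$-strongly convex in $x$ and $\mu_Y$-strongly concave in $y$, where $\mu_X,\mu_Y>0$; 2. almost surely, $F_t(\cdot,\cdot,\xi)$ is $L_X$-Lipschitz in $x$ and $L_Y$-Lipschitz in $y$ on $\mathcal X\times\mathcal Y$; 3. almost surely, $\nabla_xF_t$ is $L_{GX}$-Lipschitz in $x$ for each $y\in\mathcal Y$ and $\nabla_yF_t$ is $L_{GY}$-Lipschitz in $y$ for each $x\in\mathcal X$ (in (b) on $\mathcal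 X$, resp. $\mathcal Y$; in (a), where the function is queried outside the constraint sets, on $\mathbb R^{d_X}$, resp. $\mathbb R^{d_Y}$); 4. almost surely, on $\mathcal X\times\mathcal Y$, $\nabla_xF_t$ is $L_{XY}$-Lipschitz in $y$ and $\nabla_yF_t$ is $L_{YX}$-Lipschitz in $x$; 5. on $\mathcal X\times\mathcal Y$ the partial gradients of $f_t$ exist, $\mathbf E\nabla_{x}F_t=\nabla_{x}f_t$, $\mathbf E\nabla_{y}F_t=\nabla_{y}f_t$, $\mathbf E\|\nabla_{x}F_t-\nabla_{x}f_t\|^2\le\sigma^2$ and $\mathbf E\|\nabla_{y}F_t-\nabla_{y}f_t\|^2\le\sigma^2$, where $\sigma\ge0$. Let $\mathcal J_t=\frac1t\sum_{i=1}^tf_i$ and $(u^*_{t+1},v^*_{t+1})=\operatorname{argmin}_{x\in\mathcal X}\operatorname{argmax}_{y\in\mathcal Y}\mathcal J_t(x,y)$. Assume that for $1\le t\le T$ the point $(u^*_{t+1},v^*_{t+1})$ lies in the interior of $\mathcal X\times\mathcal Y$ and that $\operatorname{dist}(u^*_{t+1},\partial\mathcal X)\ge\delta_{\mathcal X}>0$,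 $\operatorname{dist}(v^*_{t+1},\partial\mathcal Y)\ge\delta_{\mathcal Y}>0$. With $\delta_\mu=\sqrt{\min\{\mu_X\delta_{\mathcal X}^2,\mu_Y\delta_{\mathcal Y}^2\}}$ assume $$C_0:=1-\frac{\sqrt2}{\delta_\mu}\max\Big\{\frac{D_{\mathcal X}L_{XY}}{\sqrt{\mu_Y}},\frac{D_{\mathcal Y}L_{YX}}{\sqrt{\mu_X}}\Big\}\ge0 .$$ **Algorithm (saddle-point Frank–Wolfe).** Start from any $z_1=(x_1,y_1)\in\mathcal X\times\mathcal Y$. In round $t=1,2,\dots$ form a gradient estimate $(\bar G^x_t,\bar G^y_t)$ at $z_t=(x_t,y_t)$, put $r_t=(\bar G_t^x,-\bar G_t^y)$, choose $s_t\in\operatorname{argmin}_{z\in\mathcal X\times\mathcal Y}\langle z,r_t\rangle$ by a measurable rule applied to $r_t$, and set $z_{t+1}=(1-\gamma_t)z_t+\gamma_ts_t$, with $\gamma_t=1/\sqrt t$. **Claim.** There is a constant $K$ depending only on $\mu_X,\mu_Y,L_X,L_Y,L_{GX},L_{GY},L_{XY},L_{YX},D_{\mathcal X},D_{\mathcal Y},\delta_{\mathcal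 X},\delta_{\mathcal Y}$ (not on $T$, $\sigma$, $d_X$, $d_Y$, the sets or the functions) such that the static saddle-point regret $$\mathfrak R_{SSP}=\mathbf E\Big|\sum_{t=1}^Tf_t(x_t,y_t)-\sum_{t=1}^Tf_t(u^*_{T+1},v^*_{T+1})\Big|$$ satisfies $\mathfrak R_{SSP}\le K(1+\sigma)T^{3/4}$ in each of the following two cases. (a) *Zeroth-order oracle*, with $$\bar G^x_t=\frac1{t\,m_t^X}\sum_{i=1}^t\sum_{j=1}^{m_t^X}\frac{F_i(x_t+\nu_Xu_{i,j,x},y_t,\xi_{i,j,x})-F_i(x_t,y_t,\xi_{i,j,x})}{\nu_X}u_{i,j,x},$$ $\bar G_t^y$ defined analogously in the $y$ variable, all samples (fresh in every round) independent, $\xi\sim P$, $u_{i,j,x}\sim N(0,I_{d_X})$, $u_{i,j,y}\sim N(0,I_{d_Y})$, and $m_t^X=2(d_X+5)t$, $m_t^Y=2(d_Y+5)t$, $\nu_X=\frac{\sqrt2}{(d_X+3)^{3/2}\sqrt t}$, $\nu_Y=\frac{\sqrt2}{(d_Y+3)^{3/2}\sqrt t}$. Moreover the total number of zeroth-order oracle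 calls over $T$ rounds, counted in mini-batch samples, $\sum_{t=1}^T(m_t^X+m_t^Y)$, is at most $K(d_X+d_Y)T^2$; so is, for every $k$, the number of noisy values of the single function $F_k$ that are used. The number of noisy values of all functions $F_1,\dots,F_T$ together is at most $K(d_X+d_Y)T^3$. (b) *First-order oracle*, with $\bar G^x_t=\frac1{t\,m_t}\sum_{i=1}^t\sum_{j=1}^{m_t}\nabla_xF_i(x_t,y_t,\xi_{i,j})$ and $\bar G^y_t=\frac1{t\,m_t}\sum_{i=1}^t\sum_{j=1}^{m_t}\nabla_yF_i(x_t,y_t,\xi_{i,j})$, independent fresh samples $\xi_{i,j}\sim P$, and $m_t=t$. -/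

import Mathlib

open MeasureTheory ProbabilityTheory Finset

noncomputable section

namespace OnlineSaddle

/-- The Euclidean space of dimension `d`. -/
abbrev E (d : ℕ) : Type := EuclideanSpace ℝ (Fin d)

/-- The problem constants: moduli of strong convexity / concavity, Lipschitz constants of the
functions, of the gradients and of the cross gradients, diameters, border distances. -/
structure Constants where
  muX : ℝ
  muY : ℝ
  LX : ℝ
  LY : ℝ
  LGX : ℝ
  LGY : ℝ
  LXY : ℝ
  LYX : ℝ
  DX : ℝ
  DY : ℝ
  deltaX : ℝ
  deltaY : ℝ

/-- `δ_μ = √(min {μ_X δ_X², μ_Y δ_Y²})`. -/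
def Constants.deltaMu (c : Constants) : ℝ :=
  Real.sqrt (min (c.muX * c.deltaX ^ 2) (c.muY * c.deltaY ^ 2))

/-- `C₀ = 1 - (√2 / δ_μ) max {D_X L_XY / √μ_Y, D_Y L_YX / √μ_X}`. -/
def Constants.C0 (c : Constants) : ℝ :=
  1 - Real.sqrt 2 / c.deltaMu *
    max (c.DX * c.LXY / Real.sqrt c.muY) (c.DY * c.LYX / Real.sqrt c.muX)

section Functions

variable {dX dY : ℕ} {Ξ : Type*}

/-- The partial gradient `∇ₓ F(x, y, ξ)`. -/
def gradX (F : E dX → E dY → Ξ → ℝ) (x : E dX) (y : E dY) (ξ : Ξ) : E dX :=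
  gradient (fun x' => F x' y ξ) x

/-- The partial gradient `∇_y F(x, y, ξ)`. -/
def gradY (F : E dX → E dY → Ξ → ℝ) (x : E dX) (y : E dY) (ξ : Ξ) : E dY :=
  gradient (fun y' => F x y' ξ) y

/-- `F` is continuously differentiable in `x` and in `y`, `μ_X`-strongly convex in `x ∈ 𝒳` for every
`y ∈ 𝒴`, and `μ_Y`-strongly concave in `y ∈ 𝒴` for every `x ∈ 𝒳`. -/
structure StronglyConvexConcave (muX muY : ℝ) (X : Set (E dX)) (Y : Set (E dY))
    (F : E dX → E dY → Ξ → ℝ) : Prop where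
  contDiff_x : ∀ y ξ, ContDiff ℝ 1 (fun x => F x y ξ)
  contDiff_y : ∀ x ξ, ContDiff ℝ 1 (fun y => F x y ξ)
  strongConvex : ∀ y ∈ Y, ∀ ξ, StrongConvexOn X muX (fun x => F x y ξ)
  strongConcave : ∀ x ∈ X, ∀ ξ, StrongConcaveOn Y muY (fun y => F x y ξ)

variable [MeasurableSpace Ξ]

/-- Almost surely, `F` is `L_X`-Lipschitz in `x` and `L_Y`-Lipschitz in `y` on `𝒳 × 𝒴`. -/
def LipschitzFunction (LX LY : ℝ) (X : Set (E dX)) (Y : Set (E dY)) (P : Measure Ξ)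
    (F : E dX → E dY → Ξ → ℝ) : Prop :=
  ∀ᵐ ξ ∂P,
    (∀ x₁ ∈ X, ∀ x₂ ∈ X, ∀ y ∈ Y, |F x₁ y ξ - F x₂ y ξ| ≤ LX * ‖x₁ - x₂‖) ∧
    (∀ x ∈ X, ∀ y₁ ∈ Y, ∀ y₂ ∈ Y, |F x y₁ ξ - F x y₂ ξ| ≤ LY * ‖y₁ - y₂‖)

/-- Almost surely, `∇ₓF(·, y, ξ)` is `L_GX`-Lipschitz on `A` for every `y ∈ 𝒴`, and
`∇_yF(x, ·, ξ)` is `L_GY`-Lipschitz on `B` for every `x ∈ 𝒳`.  Here `A ⊇ 𝒳` and `B ⊇ 𝒴` are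
the regions in which the oracle is queried. -/
def LipschitzGradient (LGX LGY : ℝ) (X A : Set (E dX)) (Y B : Set (E dY)) (P : Measure Ξ)
    (F : E dX → E dY → Ξ → ℝ) : Prop :=
  ∀ᵐ ξ ∂P,
    (∀ x₁ ∈ A, ∀ x₂ ∈ A, ∀ y ∈ Y, ‖gradX F x₁ y ξ - gradX F x₂ y ξ‖ ≤ LGX * ‖x₁ - x₂‖) ∧
    (∀ x ∈ X, ∀ y₁ ∈ B, ∀ y₂ ∈ B, ‖gradY F x y₁ ξ - gradY F x y₂ ξ‖ ≤ LGY * ‖y₁ - y₂‖)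

/-- Almost surely, `∇ₓF(x, ·, ξ)` is `L_XY`-Lipschitz and `∇_yF(·, y, ξ)` is `L_YX`-Lipschitz. -/
def LipschitzCrossGradient (LXY LYX : ℝ) (X : Set (E dX)) (Y : Set (E dY)) (P : Measure Ξ)
    (F : E dX → E dY → Ξ → ℝ) : Prop :=
  ∀ᵐ ξ ∂P,
    (∀ x ∈ X, ∀ y₁ ∈ Y, ∀ y₂ ∈ Y, ‖gradX F x y₁ ξ - gradX F x y₂ ξ‖ ≤ LXY * ‖y₁ - y₂‖) ∧
    (∀ x₁ ∈ X, ∀ x₂ ∈ X, ∀ y ∈ Y, ‖gradY F x₁ y ξ - gradY F x₂ y ξ‖ ≤ LYX * ‖x₁ - x₂‖)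

/-- `f(x, y) = 𝔼 F(x, y, ξ)`. -/
def mean (P : Measure Ξ) (F : E dX → E dY → Ξ → ℝ) (x : E dX) (y : E dY) : ℝ :=
  ∫ ξ, F x y ξ ∂P

/-- The stochastic oracle: noisy values have mean `f`, noisy partial gradients are unbiased for the
partial gradients of `f` (which exist) and have variance at most `σ²`. -/
structure StochasticOracle (σ : ℝ) (X : Set (E dX)) (Y : Set (E dY)) (P : Measure Ξ)
    (F : E dX → E dY → Ξ → ℝ) : Prop where
  measurable : Measurable (fun p : E dX × E dY × Ξ => F p.1 p.2.1 p.2.2)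
  integrable : ∀ x y, Integrable (F x y) P
  integrable_gradX : ∀ x ∈ X, ∀ y ∈ Y, Integrable (gradX F x y) P
  integrable_gradY : ∀ x ∈ X, ∀ y ∈ Y, Integrable (gradY F x y) P
  unbiased_x : ∀ x ∈ X, ∀ y ∈ Y,
    HasGradientAt (fun x' => mean P F x' y) (∫ ξ, gradX F x y ξ ∂P) x
  unbiased_y : ∀ x ∈ X, ∀ y ∈ Y,
    HasGradientAt (fun y' => mean P F x y') (∫ ξ, gradY F x y ξ ∂P) y
  variance_x : ∀ x ∈ X, ∀ y ∈ Y,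
    ∫⁻ ξ, ENNReal.ofReal (‖gradX F x y ξ - gradient (fun x' => mean P F x' y) x‖ ^ 2) ∂P
      ≤ ENNReal.ofReal (σ ^ 2)
  variance_y : ∀ x ∈ X, ∀ y ∈ Y,
    ∫⁻ ξ, ENNReal.ofReal (‖gradY F x y ξ - gradient (fun y' => mean P F x y') y‖ ^ 2) ∂P
      ≤ ENNReal.ofReal (σ ^ 2)

/-- The averaged function `𝒥_t(x, y) = (1/t) ∑_{i=1}^t 𝔼 F_i(x, y, ξ)`. -/
def averaged (P : Measure Ξ) (F : ℕ → E dX → E dY → Ξ → ℝ) (t : ℕ) (x : E dX) (y : E dY) : ℝ :=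
  (1 / (t : ℝ)) * ∑ i ∈ Icc 1 t, mean P (F i) x y

end Functions

/-- `(u, v) = argmin_{x ∈ 𝒳} argmax_{y ∈ 𝒴} J(x, y)`: `v` maximizes `J(u, ·)` over `𝒴`, and
`u` minimizes `x ↦ max_{y ∈ 𝒴} J(x, y)` over `𝒳`. -/
structure IsArgMinMax {α β : Type*} (X : Set α) (Y : Set β) (J : α → β → ℝ) (u : α) (v : β) :
    Prop where
  mem_x : u ∈ X
  mem_y : v ∈ Y
  argmax : ∀ y ∈ Y, J u y ≤ J u v
  argmin : ∀ x ∈ X, ∃ y ∈ Y, J u v ≤ J x y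

/-- The standing assumptions on the sets and on the functions `F_1, …, F_T`, except for the Lipschitz
condition on the gradients.  By `border`, the saddle points `(u, v)` of the averaged functions
`𝒥_1, …, 𝒥_T` are interior, at distance at least `δ_X`, `δ_Y` from `∂𝒳`, `∂𝒴`. -/
structure Setting {dX dY : ℕ} {Ξ : Type*} [MeasurableSpace Ξ] (c : Constants) (σ : ℝ)
    (X : Set (E dX)) (Y : Set (E dY)) (P : Measure Ξ) (F : ℕ → E dX → E dY → Ξ → ℝ) (T : ℕ) :
    Prop where
  compact_x : IsCompact X
  compact_y : IsCompact Y
  convex_x : Convex ℝ X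
  convex_y : Convex ℝ Y
  diam_x : ∀ x₁ ∈ X, ∀ x₂ ∈ X, ‖x₁ - x₂‖ ≤ c.DX
  diam_y : ∀ y₁ ∈ Y, ∀ y₂ ∈ Y, ‖y₁ - y₂‖ ≤ c.DY
  strong : ∀ t ∈ Icc 1 T, StronglyConvexConcave c.muX c.muY X Y (F t)
  lipschitz : ∀ t ∈ Icc 1 T, LipschitzFunction c.LX c.LY X Y P (F t)
  cross : ∀ t ∈ Icc 1 T, LipschitzCrossGradient c.LXY c.LYX X Y P (F t)
  oracle : ∀ t ∈ Icc 1 T, StochasticOracle σ X Y P (F t)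
  border : ∀ t ∈ Icc 1 T, ∀ u v, IsArgMinMax X Y (averaged P F t) u v →
    u ∈ interior X ∧ v ∈ interior Y ∧
      c.deltaX ≤ Metric.infDist u (frontier X) ∧ c.deltaY ≤ Metric.infDist v (frontier Y)

section Algorithm

variable {dX dY : ℕ} {Ξ Ω : Type*}

/-- The indices `(i, j)`, `1 ≤ i ≤ t`, `1 ≤ j ≤ m`, of the samples averaged in round `t`: the
`j`-th sample for the function `F_i`. -/
def batch (t m : ℕ) : Finset (ℕ × ℕ) := Icc 1 t ×ˢ Icc 1 m

/-- The random input of one sample in the zeroth-order setting. -/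
structure ZOSample (dX dY : ℕ) (Ξ Ω : Type*) where
  xiX : ℕ → ℕ → ℕ → Ω → Ξ
  uX : ℕ → ℕ → ℕ → Ω → E dX
  xiY : ℕ → ℕ → ℕ → Ω → Ξ
  uY : ℕ → ℕ → ℕ → Ω → E dY

/-- The zeroth-order gradient estimator `(Ḡ_t^x, Ḡ_t^y)` for the averaged function, with batch sizes
`mX`, `mY` and smoothing parameters `νX`, `νY`. -/
def zoEstimator (F : ℕ → E dX → E dY → Ξ → ℝ) (S : ZOSample dX dY Ξ Ω) (mX mY : ℕ → ℕ)
    (νX νY : ℕ → ℝ) (t : ℕ) (z : E dX × E dY) (ω : Ω) : E dX × E dY :=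
  ((1 / ((t : ℝ) * (mX t : ℝ))) • ∑ p ∈ batch t (mX t),
      ((F p.1 (z.1 + νX t • S.uX t p.1 p.2 ω) z.2 (S.xiX t p.1 p.2 ω)
        - F p.1 z.1 z.2 (S.xiX t p.1 p.2 ω)) / νX t) • S.uX t p.1 p.2 ω,
   (1 / ((t : ℝ) * (mY t : ℝ))) • ∑ p ∈ batch t (mY t),
      ((F p.1 z.1 (z.2 + νY t • S.uY t p.1 p.2 ω) (S.xiY t p.1 p.2 ω)
        - F p.1 z.1 z.2 (S.xiY t p.1 p.2 ω)) / νY t) • S.uY t p.1 p.2 ω)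

/-- The first-order gradient estimator `(Ḡ_t^x, Ḡ_t^y)` for the averaged function, with batch
size `m`. -/
def foEstimator (F : ℕ → E dX → E dY → Ξ → ℝ) (ξ : ℕ → ℕ → ℕ → Ω → Ξ) (m : ℕ → ℕ)
    (t : ℕ) (z : E dX × E dY) (ω : Ω) : E dX × E dY :=
  ((1 / ((t : ℝ) * (m t : ℝ))) • ∑ p ∈ batch t (m t), gradX (F p.1) z.1 z.2 (ξ t p.1 p.2 ω),
   (1 / ((t : ℝ) * (m t : ℝ))) • ∑ p ∈ batch t (m t), gradY (F p.1) z.1 z.2 (ξ t p.1 p.2 ω))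

/-- `lmo` is a linear minimization oracle over `𝒳 × 𝒴`: a measurable choice of
`lmo r ∈ argmin_{z ∈ 𝒳 × 𝒴} ⟨z, r⟩`. -/
structure IsLMO (X : Set (E dX)) (Y : Set (E dY)) (lmo : E dX × E dY → E dX × E dY) : Prop where
  measurable : Measurable lmo
  mem : ∀ r, lmo r ∈ X ×ˢ Y
  le : ∀ r, ∀ z ∈ X ×ˢ Y,
    inner ℝ (lmo r).1 r.1 + inner ℝ (lmo r).2 r.2 ≤ inner ℝ z.1 r.1 + inner ℝ z.2 r.2

/-- The saddle-point Frank-Wolfe iterates `z_t = (x_t, y_t)`, `t ≥ 1`, from the initial point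
`z_1 = z₁`: with `(Ḡ^x, Ḡ^y) = G t z_t`, `r_t = (Ḡ^x, -Ḡ^y)` and `s_t = lmo t r_t`, the update is
`z_{t+1} = (1 - γ_t) z_t + γ_t s_t`.  The index `0` is not used. -/
def fwIterate (γ : ℕ → ℝ) (lmo : ℕ → E dX × E dY → E dX × E dY)
    (G : ℕ → E dX × E dY → Ω → E dX × E dY) (z₁ : E dX × E dY) : ℕ → Ω → E dX × E dY
  | 0, _ => z₁
  | 1, _ => z₁
  | t + 2, ω =>
    let z := fwIterate γ lmo G z₁ (t + 1) ω
    let g := G (t + 1) z ω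
    (1 - γ (t + 1)) • z + γ (t + 1) • lmo (t + 1) (g.1, -g.2)

/-- `S t i j` are independent random variables with common law `κ`. -/
def IsIID {α : Type*} [MeasurableSpace α] [MeasurableSpace Ω] (S : ℕ → ℕ → ℕ → Ω → α)
    (κ : Measure α) (Q : Measure Ω) : Prop :=
  (∀ t i j, Measurable (S t i j)) ∧ (∀ t i j, Q.map (S t i j) = κ) ∧
    iIndepFun (fun q : ℕ × ℕ × ℕ => S q.1 q.2.1 q.2.2) Q

/-- All zeroth-order samples are independent, the `ξ`'s with law `P` and the `u`'s standard
Gaussian. -/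
def ZOSample.IsSampling [MeasurableSpace Ξ] [MeasurableSpace Ω] (S : ZOSample dX dY Ξ Ω)
    (P : Measure Ξ) (Q : Measure Ω) : Prop :=
  IsIID (fun t i j ω => ((S.xiX t i j ω, S.uX t i j ω), (S.xiY t i j ω, S.uY t i j ω)))
    ((P.prod (stdGaussian (E dX))).prod (P.prod (stdGaussian (E dY)))) Q

/-- The random variable inside the regret: `∑_{t ≤ T} f_t(x_t, y_t) - ∑_{t ≤ T} f_t(u, v)`. -/
def gap [MeasurableSpace Ξ] (P : Measure Ξ) (F : ℕ → E dX → E dY → Ξ → ℝ)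
    (z : ℕ → Ω → E dX × E dY) (T : ℕ) (u : E dX) (v : E dY) (ω : Ω) : ℝ :=
  ∑ t ∈ Icc 1 T, mean P (F t) (z t ω).1 (z t ω).2 - ∑ t ∈ Icc 1 T, mean P (F t) u v

/-- The static saddle-point regret `𝔼 |∑ f_t(x_t, y_t) - ∑ f_t(u, v)|`, where `(u, v)` is the saddle
point of the averaged function over all `T` rounds. -/
def regret [MeasurableSpace Ξ] [MeasurableSpace Ω] (P : Measure Ξ) (Q : Measure Ω)
    (F : ℕ → E dX → E dY → Ξ → ℝ) (z : ℕ → Ω → E dX × E dY) (T : ℕ) (u : E dX) (v : E dY) : ℝ :=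
  ∫ ω, |gap P F z T u v ω| ∂Q

end Algorithm

/-- Step size `γ_t = 1/√t`. -/
def stepSize (t : ℕ) : ℝ := 1 / Real.sqrt t

/-- Zeroth-order batch size `m_t = 2 (d + 5) t`. -/
def zoBatchSize (d t : ℕ) : ℕ := 2 * (d + 5) * t

/-- Smoothing parameter `ν = √2 / ((d + 3)^{3/2} √t)`. -/
def smoothing (d t : ℕ) : ℝ := Real.sqrt 2 / (((d : ℝ) + 3) ^ (3 / 2 : ℝ) * Real.sqrt t)

/-- The noisy function values used by the zeroth-order estimator in round `t`: `inl` / `inr` for the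
`x` / `y` block, a Boolean for the perturbed or the unperturbed point, and the sample
index `(i, j)`; the value is one of the function `F_i`. -/
def zoEvaluations (dX dY t : ℕ) : Finset ((Bool × ℕ × ℕ) ⊕ (Bool × ℕ × ℕ)) :=
  ((univ : Finset Bool) ×ˢ batch t (zoBatchSize dX t)).disjSum
    ((univ : Finset Bool) ×ˢ batch t (zoBatchSize dY t))

/-- The function index `i` of an evaluation. -/
def functionIndex : (Bool × ℕ × ℕ) ⊕ (Bool × ℕ × ℕ) → ℕ :=
  Sum.elim (fun q => q.2.1) (fun q => q.2.1)

/-- The number of zeroth-order oracle calls in `T` rounds, counted in mini-batch samples: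
`∑_{t ≤ T} (m_t^X + m_t^Y)`. -/
def zoCalls (dX dY T : ℕ) : ℕ := ∑ t ∈ Icc 1 T, (zoBatchSize dX t + zoBatchSize dY t)

/-- The number of noisy values of the single function `F_k` used in `T` rounds. -/
def zoCallsOf (dX dY T k : ℕ) : ℕ :=
  ∑ t ∈ Icc 1 T, #{e ∈ zoEvaluations dX dY t | functionIndex e = k}

/-- The number of noisy values of all the functions together used in `T` rounds. -/
def zoCallsAll (dX dY T : ℕ) : ℕ := ∑ t ∈ Icc 1 T, #(zoEvaluations dX dY t)

end OnlineSaddle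

end

noncomputable section

namespace OnlineSaddle

section

section OneFunction

variable {H : Type*} [NormedAddCommGroup H] [InnerProductSpace ℝ H] {S : Set H} {φ : H → ℝ} {m : ℝ}

/-- If `b (A - b B) ≤ b R` for all small positive `b`, then `A ≤ R`. -/
lemma le_of_forall_mul_sub_le {A B R : ℝ}
    (h : ∀ b : ℝ, 0 < b → b ≤ 1 → b * (A - b * B) ≤ b * R) : A ≤ R := by
  have hlim : Filter.Tendsto (fun b : ℝ => A - b * B) (nhdsWithin 0 (Set.Ioi 0)) (nhds (A - 0 * B)) :=
    ((continuous_const.sub (continuous_id.mul continuous_const)).tendsto 0).mono_left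
      nhdsWithin_le_nhds
  rw [zero_mul, sub_zero] at hlim
  refine le_of_tendsto hlim ?_
  filter_upwards [Ioc_mem_nhdsGT (zero_lt_one' ℝ)] with b hb
  exact le_of_mul_le_mul_left (h b hb.1 hb.2) hb.1

lemma StrongConvexOn.le_combo (h : StrongConvexOn S m φ) {x y : H} (hx : x ∈ S) (hy : y ∈ S)
    {b : ℝ} (hb : 0 ≤ b) (hb1 : b ≤ 1) :
    φ ((1 - b) • x + b • y) ≤ (1 - b) * φ x + b * φ y - (1 - b) * b * (m / 2 * ‖x - y‖ ^ 2) := by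
  have := h.2 hx hy (sub_nonneg.2 hb1) hb (by ring)
  simpa only [smul_eq_mul] using this

/-- Quadratic growth of a strongly convex function around its minimizer. -/
lemma growth_of_isMin (h : StrongConvexOn S m φ) {u x : H} (hu : u ∈ S) (hx : x ∈ S)
    (hmin : ∀ x ∈ S, φ u ≤ φ x) : φ u + m / 2 * ‖x - u‖ ^ 2 ≤ φ x := by
  have : φ u - φ x + m / 2 * ‖x - u‖ ^ 2 ≤ 0 := by
    refine le_of_forall_mul_sub_le (B := m / 2 * ‖x - u‖ ^ 2) fun b hb hb1 => ?_
    have h1 := StrongConvexOn.le_combo h hu hx hb.le hb1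
    have h2 := hmin _ (h.1 hu hx (sub_nonneg.2 hb1) hb.le (by ring))
    rw [norm_sub_rev u x] at h1
    nlinarith
  linarith

variable [CompleteSpace H]

lemma HasGradientAt.hasDerivAt_line {g x : H} (hg : HasGradientAt φ g x) (d : H) :
    HasDerivAt (fun b : ℝ => φ (x + b • d)) (inner ℝ g d) 0 := by
  have h1 : HasDerivAt (fun b : ℝ => x + b • d) d 0 := by
    simpa using ((hasDerivAt_id (0 : ℝ)).smul_const d).const_add x
  have h2 : HasFDerivAt φ (InnerProductSpace.toDual ℝ H g) (x + (0 : ℝ) • d) := by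
    simpa using hg.hasFDerivAt
  exact h2.comp_hasDerivAt (0 : ℝ) h1

/-- First-order lower bound for a strongly convex function. -/
lemma first_order_lower (h : StrongConvexOn S m φ) {u x g : H} (hx : x ∈ S) (hu : u ∈ S)
    (hg : HasGradientAt φ g x) : φ x + inner ℝ g (u - x) + m / 2 * ‖u - x‖ ^ 2 ≤ φ u := by
  have hd := (HasGradientAt.hasDerivAt_line hg (u - x)).tendsto_slope_zero_right
  have hlim : Filter.Tendsto (fun b : ℝ => φ u - φ x - (1 - b) * (m / 2 * ‖u - x‖ ^ 2))
      (nhdsWithin 0 (Set.Ioi 0)) (nhds (φ u - φ x - (1 - 0) * (m / 2 * ‖u - x‖ ^ 2))) := by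
    refine Filter.Tendsto.mono_left (Continuous.tendsto ?_ 0) nhdsWithin_le_nhds
    fun_prop
  have := le_of_tendsto_of_tendsto hd hlim ?_
  · linarith
  filter_upwards [Ioc_mem_nhdsGT (zero_lt_one' ℝ)] with b hb
  have h1 := StrongConvexOn.le_combo h hx hu hb.1.le hb.2
  have e : (1 - b) • x + b • u = x + b • (u - x) := by module
  rw [e] at h1
  simp only [smul_eq_mul, norm_sub_rev x u, zero_add, zero_smul, add_zero] at h1 ⊢
  rw [inv_mul_le_iff₀ hb.1]
  linarith

/-- Linearization error of a function with Lipschitz gradient. -/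
lemma abs_linearization_le {g : H → H} {L : ℝ} (hL : 0 ≤ L) (hS : Convex ℝ S)
    (hg : ∀ x ∈ S, HasGradientAt φ (g x) x)
    (hlip : ∀ x₁ ∈ S, ∀ x₂ ∈ S, ‖g x₁ - g x₂‖ ≤ L * ‖x₁ - x₂‖) {x y : H} (hx : x ∈ S) (hy : y ∈ S) :
    |φ y - φ x - inner ℝ (g x) (y - x)| ≤ L * ‖y - x‖ ^ 2 := by
  have hseg : segment ℝ x y ⊆ S := hS.segment_subset hx hy
  have := (convex_segment x y).norm_image_sub_le_of_norm_hasFDerivWithin_le'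
    (f := φ) (f' := fun z => InnerProductSpace.toDual ℝ H (g z))
    (φ := InnerProductSpace.toDual ℝ H (g x)) (C := L * ‖y - x‖)
    (fun z hz => (hg z (hseg hz)).hasFDerivAt.hasFDerivWithinAt) (fun z hz => ?_)
    (left_mem_segment ℝ x y) (right_mem_segment ℝ x y)
  · simpa [pow_two, mul_assoc] using this
  · rw [← map_sub, LinearIsometryEquiv.norm_map]
    refine (hlip z (hseg hz) x hx).trans (mul_le_mul_of_nonneg_left ?_ hL)
    obtain ⟨θ, ⟨h0, h1⟩, rfl⟩ := (segment_eq_image' ℝ x y) ▸ hz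
    simp only [add_sub_cancel_left, norm_smul, Real.norm_eq_abs, abs_of_nonneg h0]
    exact mul_le_of_le_one_left (norm_nonneg _) h1

end OneFunction

/-- A closed set contains the closed ball whose radius is a lower bound for the distance from the
center to the boundary. -/
lemma closedBall_subset_of_le_infDist {d : ℕ} {S : Set (E d)} (hS : IsClosed S) {u : E d} {δ : ℝ}
    (hδ : 0 < δ) (hu : u ∈ S) (h : δ ≤ Metric.infDist u (frontier S)) :
    Metric.closedBall u δ ⊆ S := by
  by_cases hne : S = Set.univ
  · simp [hne]
  obtain ⟨y, hy, hdist⟩ := exists_mem_frontier_infDist_compl_eq_dist hu hne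
  have h1 : δ ≤ Metric.infDist u Sᶜ := hdist ▸ h.trans (Metric.infDist_le_dist_of_mem hy)
  rw [← closure_ball u hδ.ne']
  exact closure_minimal ((Metric.ball_subset_ball h1).trans Metric.ball_infDist_compl_subset) hS

end

section

/-- The sign conditions on the constants. -/
structure Constants.Admissible (c : Constants) : Prop where
  muX : 0 < c.muX
  muY : 0 < c.muY
  deltaX : 0 < c.deltaX
  deltaY : 0 < c.deltaY
  C0 : 0 ≤ c.C0
  LX : 0 ≤ c.LX
  LY : 0 ≤ c.LY
  LGX : 0 ≤ c.LGX
  LGY : 0 ≤ c.LGY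
  LXY : 0 ≤ c.LXY
  LYX : 0 ≤ c.LYX
  DX : 0 ≤ c.DX
  DY : 0 ≤ c.DY

/-- Compact convex constraint sets with bounded diameters. -/
structure Domain {dX dY : ℕ} (c : Constants) (X : Set (E dX)) (Y : Set (E dY)) : Prop where
  compact_x : IsCompact X
  compact_y : IsCompact Y
  convex_x : Convex ℝ X
  convex_y : Convex ℝ Y
  diam_x : ∀ x₁ ∈ X, ∀ x₂ ∈ X, ‖x₁ - x₂‖ ≤ c.DX
  diam_y : ∀ y₁ ∈ Y, ∀ y₂ ∈ Y, ‖y₁ - y₂‖ ≤ c.DY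

/-- A Lipschitz, smooth, strongly convex-concave function with partial gradients `gx`, `gy`. -/
structure SmoothSaddle {dX dY : ℕ} (c : Constants) (X : Set (E dX)) (Y : Set (E dY))
    (f : E dX → E dY → ℝ) (gx : E dX → E dY → E dX) (gy : E dX → E dY → E dY) : Prop where
  convex : ∀ y ∈ Y, StrongConvexOn X c.muX (fun x => f x y)
  concave : ∀ x ∈ X, StrongConcaveOn Y c.muY (fun y => f x y)
  lip_x : ∀ x₁ ∈ X, ∀ x₂ ∈ X, ∀ y ∈ Y, |f x₁ y - f x₂ y| ≤ c.LX * ‖x₁ - x₂‖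
  lip_y : ∀ x ∈ X, ∀ y₁ ∈ Y, ∀ y₂ ∈ Y, |f x y₁ - f x y₂| ≤ c.LY * ‖y₁ - y₂‖
  grad_x : ∀ x ∈ X, ∀ y ∈ Y, HasGradientAt (fun x' => f x' y) (gx x y) x
  grad_y : ∀ x ∈ X, ∀ y ∈ Y, HasGradientAt (fun y' => f x y') (gy x y) y
  lip_gx : ∀ x₁ ∈ X, ∀ x₂ ∈ X, ∀ y ∈ Y, ‖gx x₁ y - gx x₂ y‖ ≤ c.LGX * ‖x₁ - x₂‖
  lip_gy : ∀ x ∈ X, ∀ y₁ ∈ Y, ∀ y₂ ∈ Y, ‖gy x y₁ - gy x y₂‖ ≤ c.LGY * ‖y₁ - y₂‖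
  cross_x : ∀ x ∈ X, ∀ y₁ ∈ Y, ∀ y₂ ∈ Y, ‖gx x y₁ - gx x y₂‖ ≤ c.LXY * ‖y₁ - y₂‖
  cross_y : ∀ x₁ ∈ X, ∀ x₂ ∈ X, ∀ y ∈ Y, ‖gy x₁ y - gy x₂ y‖ ≤ c.LYX * ‖x₁ - x₂‖

variable {dX dY : ℕ} {c : Constants} {X : Set (E dX)} {Y : Set (E dY)}
  {f : E dX → E dY → ℝ} {gx : E dX → E dY → E dX} {gy : E dX → E dY → E dY}

/-- `(u, v)` is a saddle point of `f` on `X × Y`. -/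
structure IsSaddle {α β : Type*} (X : Set α) (Y : Set β) (f : α → β → ℝ) (u : α) (v : β) :
    Prop where
  mem_x : u ∈ X
  mem_y : v ∈ Y
  le_x : ∀ x ∈ X, f u v ≤ f x v
  le_y : ∀ y ∈ Y, f u y ≤ f u v

lemma SmoothSaddle.convex_neg (h : SmoothSaddle c X Y f gx gy) {x : E dX} (hx : x ∈ X) :
    StrongConvexOn Y c.muY (fun y => -f x y) := (h.concave x hx).neg

/-- The norm of an average is at most a common bound of the norms. -/
lemma norm_average_le {H : Type*} [NormedAddCommGroup H] [NormedSpace ℝ H] {ι : Type*}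
    {s : Finset ι} {a : ι → H} {B t : ℝ} (ht : (s.card : ℝ) = t) (h0 : 0 < t)
    (h : ∀ i ∈ s, ‖a i‖ ≤ B) : ‖(1 / t) • ∑ i ∈ s, a i‖ ≤ B := by
  rw [norm_smul, Real.norm_eq_abs, abs_of_pos (by positivity), one_div, inv_mul_le_iff₀ h0]
  calc ‖∑ i ∈ s, a i‖ ≤ ∑ i ∈ s, ‖a i‖ := norm_sum_le _ _
    _ ≤ ∑ i ∈ s, B := Finset.sum_le_sum h
    _ = t * B := by rw [Finset.sum_const, nsmul_eq_mul, ht]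

lemma HasGradientAt.average {H : Type*} [NormedAddCommGroup H] [InnerProductSpace ℝ H]
    [CompleteSpace H] {ι : Type*} {s : Finset ι} {φ : ι → H → ℝ} {g : ι → H} {x : H} (k : ℝ)
    (h : ∀ i ∈ s, HasGradientAt (φ i) (g i) x) :
    HasGradientAt (fun z => k * ∑ i ∈ s, φ i z) (k • ∑ i ∈ s, g i) x := by
  have h1 := (HasFDerivAt.fun_sum fun i hi => (h i hi).hasFDerivAt).const_mul k
  have e : InnerProductSpace.toDual ℝ H (k • ∑ i ∈ s, g i)
      = k • ∑ i ∈ s, InnerProductSpace.toDual ℝ H (g i) := by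
    rw [map_smulₛₗ, map_sum]; rfl
  rw [hasGradientAt_iff_hasFDerivAt, e]
  exact h1

/-- The average of functions of the class belongs to the class. -/
lemma SmoothSaddle.average {t : ℕ} (ht : 1 ≤ t) (hX : Convex ℝ X) (hY : Convex ℝ Y)
    {f : ℕ → E dX → E dY → ℝ} {gx : ℕ → E dX → E dY → E dX} {gy : ℕ → E dX → E dY → E dY}
    (h : ∀ i ∈ Icc 1 t, SmoothSaddle c X Y (f i) (gx i) (gy i)) :
    SmoothSaddle c X Y (fun x y => (1 / (t : ℝ)) * ∑ i ∈ Icc 1 t, f i x y)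
      (fun x y => (1 / (t : ℝ)) • ∑ i ∈ Icc 1 t, gx i x y)
      (fun x y => (1 / (t : ℝ)) • ∑ i ∈ Icc 1 t, gy i x y) := by
  have h0 : (0 : ℝ) < t := by exact_mod_cast ht
  have hc : ((Icc 1 t).card : ℝ) = t := by simp
  have hone : ∀ r : ℝ, (1 / (t : ℝ)) * ∑ i ∈ Icc 1 t, r = r := fun r => by
    simp only [Finset.sum_const, nsmul_eq_mul, hc]; field_simp
  refine ⟨fun y hy => ⟨hX, fun x₁ h₁ x₂ h₂ a b ha hb hab => ?_⟩,
    fun x hx => ⟨hY, fun y₁ h₁ y₂ h₂ a b ha hb hab => ?_⟩, ?_, ?_, ?_, ?_, ?_, ?_, ?_, ?_⟩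
  · have := Finset.sum_le_sum fun i hi => ((h i hi).convex y hy).2 h₁ h₂ ha hb hab
    refine (mul_le_mul_of_nonneg_left this (by positivity : 0 ≤ 1 / (t : ℝ))).trans_eq ?_
    simp only [smul_eq_mul, Finset.sum_sub_distrib, Finset.sum_add_distrib, mul_sub, mul_add, hone]
    simp only [← Finset.mul_sum]
    ring
  · have := Finset.sum_le_sum fun i hi => ((h i hi).concave x hx).2 h₁ h₂ ha hb hab
    refine Eq.trans_le ?_ (mul_le_mul_of_nonneg_left this (by positivity : 0 ≤ 1 / (t : ℝ)))
    simp only [smul_eq_mul, Finset.sum_add_distrib, mul_add, hone]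
    simp only [← Finset.mul_sum]
    ring
  · intro x₁ h₁ x₂ h₂ y hy
    rw [← mul_sub, ← Finset.sum_sub_distrib]
    exact norm_average_le (H := ℝ) hc h0 fun i hi => (h i hi).lip_x x₁ h₁ x₂ h₂ y hy
  · intro x hx y₁ h₁ y₂ h₂
    rw [← mul_sub, ← Finset.sum_sub_distrib]
    exact norm_average_le (H := ℝ) hc h0 fun i hi => (h i hi).lip_y x hx y₁ h₁ y₂ h₂
  · exact fun x hx y hy => HasGradientAt.average _ fun i hi => (h i hi).grad_x x hx y hy
  · exact fun x hx y hy => HasGradientAt.average _ fun i hi => (h i hi).grad_y x hx y hy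
  · intro x₁ h₁ x₂ h₂ y hy
    rw [← smul_sub, ← Finset.sum_sub_distrib]
    exact norm_average_le hc h0 fun i hi => (h i hi).lip_gx x₁ h₁ x₂ h₂ y hy
  · intro x hx y₁ h₁ y₂ h₂
    rw [← smul_sub, ← Finset.sum_sub_distrib]
    exact norm_average_le hc h0 fun i hi => (h i hi).lip_gy x hx y₁ h₁ y₂ h₂
  · intro x hx y₁ h₁ y₂ h₂
    rw [← smul_sub, ← Finset.sum_sub_distrib]
    exact norm_average_le hc h0 fun i hi => (h i hi).cross_x x hx y₁ h₁ y₂ h₂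
  · intro x₁ h₁ x₂ h₂ y hy
    rw [← smul_sub, ← Finset.sum_sub_distrib]
    exact norm_average_le hc h0 fun i hi => (h i hi).cross_y x₁ h₁ x₂ h₂ y hy

lemma IsSaddle.growth_x (hs : SmoothSaddle c X Y f gx gy) {u x : E dX} {v : E dY}
    (h : IsSaddle X Y f u v) (hx : x ∈ X) : f u v + c.muX / 2 * ‖x - u‖ ^ 2 ≤ f x v :=
  growth_of_isMin (hs.convex v h.mem_y) h.mem_x hx h.le_x

lemma IsSaddle.growth_y (hs : SmoothSaddle c X Y f gx gy) {u : E dX} {v y : E dY}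
    (h : IsSaddle X Y f u v) (hy : y ∈ Y) : f u y + c.muY / 2 * ‖y - v‖ ^ 2 ≤ f u v := by
  have := growth_of_isMin (hs.convex_neg h.mem_x) h.mem_y hy fun y hy => neg_le_neg (h.le_y y hy)
  linarith

/-- The minimizer of `max_y f(·, y)` and its best response form a saddle point. -/
lemma IsArgMinMax.isSaddle (hc : c.Admissible) (hd : Domain c X Y)
    (hs : SmoothSaddle c X Y f gx gy) {u : E dX} {v : E dY} (h : IsArgMinMax X Y f u v) :
    IsSaddle X Y f u v := by
  refine ⟨h.mem_x, h.mem_y, fun x hx => ?_, h.argmax⟩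
  have key : ∀ b : ℝ, 0 < b → b ≤ 1 →
      f u v ≤ f x v + c.LY * Real.sqrt (b * (2 * (c.LX * c.DX) / c.muY)) := by
    intro b hb hb1
    have hxb := hd.convex_x h.mem_x hx (sub_nonneg.2 hb1) hb.le (by ring : 1 - b + b = 1)
    obtain ⟨y, hy, hle⟩ := h.argmin _ hxb
    have h1 := StrongConvexOn.le_combo (hs.convex y hy) h.mem_x hx hb.le hb1
    have h2 := growth_of_isMin (hs.convex_neg h.mem_x) h.mem_y hy
      fun y hy => neg_le_neg (h.argmax y hy)
    have h3 := (abs_le.1 (hs.lip_x _ hxb u h.mem_x y hy)).2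
    have e : (1 - b) • u + b • x - u = b • (x - u) := by module
    rw [e, norm_smul, Real.norm_eq_abs, abs_of_pos hb] at h3
    have h4 : c.LX * (b * ‖x - u‖) ≤ b * (c.LX * c.DX) := by
      have := mul_le_mul_of_nonneg_left (hd.diam_x x hx u h.mem_x) (mul_nonneg hc.LX hb.le)
      linarith
    have h5 : ‖y - v‖ ≤ Real.sqrt (b * (2 * (c.LX * c.DX) / c.muY)) := by
      apply Real.le_sqrt_of_sq_le
      have := hc.muY
      rw [← mul_div_assoc, le_div_iff₀ this]
      nlinarith
    have h6 := (abs_le.1 (hs.lip_y x hx y hy v h.mem_y)).2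
    have h7 := mul_le_mul_of_nonneg_left h5 hc.LY
    have h8 : b * f u v ≤ b * f x y := by
      have h9 : 0 ≤ (1 - b) * b * (c.muX / 2 * ‖u - x‖ ^ 2) := by
        have := hc.muX
        have := sub_nonneg.2 hb1
        positivity
      have := mul_le_mul_of_nonneg_left (h.argmax y hy) (sub_nonneg.2 hb1)
      linarith
    have := le_of_mul_le_mul_left h8 hb
    linarith
  have hlim : Filter.Tendsto
      (fun b : ℝ => f x v + c.LY * Real.sqrt (b * (2 * (c.LX * c.DX) / c.muY)))
      (nhdsWithin 0 (Set.Ioi 0))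
      (nhds (f x v + c.LY * Real.sqrt (0 * (2 * (c.LX * c.DX) / c.muY)))) := by
    refine Filter.Tendsto.mono_left (Continuous.tendsto ?_ 0) nhdsWithin_le_nhds
    fun_prop
  rw [zero_mul, Real.sqrt_zero, mul_zero, add_zero] at hlim
  refine ge_of_tendsto hlim ?_
  filter_upwards [Ioc_mem_nhdsGT (zero_lt_one' ℝ)] with b hb using key b hb.1 hb.2

lemma continuousOn_of_abs_sub_le {H : Type*} [SeminormedAddCommGroup H] {S : Set H} {φ : H → ℝ}
    {L : ℝ} (hL : 0 ≤ L) (h : ∀ x ∈ S, ∀ x' ∈ S, |φ x - φ x'| ≤ L * ‖x - x'‖) :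
    ContinuousOn φ S :=
  (LipschitzOnWith.of_dist_le_mul (K := L.toNNReal) fun x hx x' hx' => by
    rw [Real.dist_eq, dist_eq_norm, Real.coe_toNNReal _ hL]
    exact h x hx x' hx').continuousOn

/-- Existence of the min-max point. -/
lemma exists_isArgMinMax (hc : c.Admissible) (hd : Domain c X Y)
    (hs : SmoothSaddle c X Y f gx gy) (hX : X.Nonempty) (hY : Y.Nonempty) :
    ∃ u v, IsArgMinMax X Y f u v := by
  have hmax : ∀ x ∈ X, ∃ y ∈ Y, ∀ y' ∈ Y, f x y' ≤ f x y := fun x hx => by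
    obtain ⟨y, hy, h⟩ := hd.compact_y.exists_isMaxOn hY
      (continuousOn_of_abs_sub_le hc.LY (hs.lip_y x hx))
    exact ⟨y, hy, fun y' hy' => h hy'⟩
  choose! b hbY hb using hmax
  have hcont : ContinuousOn (fun x => f x (b x)) X := by
    have h1 : ∀ x ∈ X, ∀ x' ∈ X, f x (b x) - f x' (b x') ≤ c.LX * ‖x - x'‖ := fun x hx x' hx' => by
      have := (abs_le.1 (hs.lip_x x hx x' hx' (b x) (hbY x hx))).2
      have := hb x' hx' (b x) (hbY x hx)
      linarith
    refine continuousOn_of_abs_sub_le hc.LX fun x hx x' hx' => abs_le.2 ⟨?_, h1 x hx x' hx'⟩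
    have := h1 x' hx' x hx
    rw [norm_sub_rev] at this
    linarith
  obtain ⟨u, hu, hmin⟩ := hd.compact_x.exists_isMinOn hX hcont
  exact ⟨u, b u, hu, hbY u hu, hb u hu, fun x hx => ⟨b x, hbY x hx, hmin hx⟩⟩

/-- A saddle point moves by `O(1/n)` when the function is perturbed by an `O(1/n)`-Lipschitz
function. -/
lemma IsSaddle.drift {f' : E dX → E dY → ℝ} {gx' : E dX → E dY → E dX}
    {gy' : E dX → E dY → E dY} (hc : c.Admissible)
    (hs : SmoothSaddle c X Y f gx gy) (hs' : SmoothSaddle c X Y f' gx' gy')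
    {u u' : E dX} {v v' : E dY} (h : IsSaddle X Y f u v) (h' : IsSaddle X Y f' u' v') {r : ℝ}
    (hr : 0 ≤ r)
    (hx : ∀ y ∈ Y, |(f' u y - f u y) - (f' u' y - f u' y)| ≤ r * ‖u' - u‖)
    (hy : ∀ x ∈ X, |(f' x v - f x v) - (f' x v' - f x v')| ≤ r * ‖v' - v‖) :
    ‖u' - u‖ + ‖v' - v‖ ≤ 2 * r / min c.muX c.muY := by
  have hm : 0 < min c.muX c.muY := lt_min hc.muX hc.muY
  have h1 := h.growth_x hs h'.mem_x
  have h2 := h.growth_y hs h'.mem_y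
  have h3 := h'.growth_x hs' h.mem_x
  have h4 := h'.growth_y hs' h.mem_y
  rw [norm_sub_rev] at h3 h4
  have h5 := abs_le.1 (hx v' h'.mem_y)
  have h6 := abs_le.1 (hy u' h'.mem_x)
  have h7 : min c.muX c.muY * ‖u' - u‖ ^ 2 ≤ c.muX * ‖u' - u‖ ^ 2 := by gcongr; exact min_le_left _ _
  have h8 : min c.muX c.muY * ‖v' - v‖ ^ 2 ≤ c.muY * ‖v' - v‖ ^ 2 := by gcongr; exact min_le_right _ _
  set p := ‖u' - u‖
  set q := ‖v' - v‖
  set m := min c.muX c.muY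
  have hp : 0 ≤ p := norm_nonneg _
  have hq : 0 ≤ q := norm_nonneg _
  have h9 : m * (p ^ 2 + q ^ 2) ≤ r * (p + q) := by linarith [h5.1, h5.2, h6.1, h6.2]
  rw [le_div_iff₀ hm]
  rcases (add_nonneg hp hq).eq_or_lt with h0 | h0
  · rw [← h0]; linarith
  · refine le_of_mul_le_mul_left ?_ h0
    nlinarith [mul_nonneg hm.le (sq_nonneg (p - q))]

end

section

variable {dX dY : ℕ} {c : Constants} {X : Set (E dX)} {Y : Set (E dY)}

lemma Constants.Admissible.deltaMu_pos (hc : c.Admissible) : 0 < c.deltaMu :=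
  Real.sqrt_pos.2 (lt_min (mul_pos hc.muX (pow_pos hc.deltaX 2)) (mul_pos hc.muY (pow_pos hc.deltaY 2)))

lemma Constants.Admissible.deltaMu_le_x (hc : c.Admissible) :
    c.deltaMu ≤ Real.sqrt c.muX * c.deltaX := by
  refine (Real.sqrt_le_sqrt (min_le_left _ _)).trans_eq ?_
  rw [Real.sqrt_mul hc.muX.le, Real.sqrt_sq hc.deltaX.le]

lemma Constants.Admissible.deltaMu_le_y (hc : c.Admissible) :
    c.deltaMu ≤ Real.sqrt c.muY * c.deltaY := by
  refine (Real.sqrt_le_sqrt (min_le_right _ _)).trans_eq ?_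
  rw [Real.sqrt_mul hc.muY.le, Real.sqrt_sq hc.deltaY.le]

/-- The coupling between the two blocks is absorbed by the Frank-Wolfe progress from the interior of
the constraint sets. -/
lemma Constants.Admissible.coupling_le (hc : c.Admissible) {A B p q hx hy : ℝ} (hA : 0 ≤ A)
    (hB : 0 ≤ B) (hp : 0 ≤ p) (hq : 0 ≤ q) (h1 : c.muX / 2 * p ^ 2 ≤ hx)
    (h2 : c.muY / 2 * q ^ 2 ≤ hy) (h3 : hx + hy ≤ A ^ 2 / (2 * c.muX) + B ^ 2 / (2 * c.muY)) :
    c.DX * c.LXY * q + c.DY * c.LYX * p ≤ c.deltaX * A + c.deltaY * B := by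
  have hsx := Real.sqrt_pos.2 hc.muX
  have hsy := Real.sqrt_pos.2 hc.muY
  have hδ := hc.deltaMu_pos
  set M := max (c.DX * c.LXY / Real.sqrt c.muY) (c.DY * c.LYX / Real.sqrt c.muX) with hM
  have hM0 : 0 ≤ M := le_max_of_le_left (div_nonneg (mul_nonneg hc.DX hc.LXY) hsy.le)
  have hMδ : Real.sqrt 2 * M ≤ c.deltaMu := by
    have := hc.C0
    rw [Constants.C0, ← hM, sub_nonneg, div_mul_eq_mul_div, div_le_one hδ] at this
    exact this
  have ha : c.DX * c.LXY * q ≤ M * (Real.sqrt c.muY * q) := by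
    rw [← mul_assoc]
    exact mul_le_mul_of_nonneg_right ((div_le_iff₀ hsy).1 (le_max_left _ _)) hq
  have hb : c.DY * c.LYX * p ≤ M * (Real.sqrt c.muX * p) := by
    rw [← mul_assoc]
    exact mul_le_mul_of_nonneg_right ((div_le_iff₀ hsx).1 (le_max_right _ _)) hp
  set α := A / Real.sqrt c.muX with hα
  set β := B / Real.sqrt c.muY with hβ
  have hα0 : 0 ≤ α := div_nonneg hA hsx.le
  have hβ0 : 0 ≤ β := div_nonneg hB hsy.le
  have hα1 : c.deltaMu * α ≤ c.deltaX * A := by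
    rw [hα, ← mul_div_assoc, div_le_iff₀ hsx]
    have := mul_le_mul_of_nonneg_right hc.deltaMu_le_x hA
    linarith
  have hβ1 : c.deltaMu * β ≤ c.deltaY * B := by
    rw [hβ, ← mul_div_assoc, div_le_iff₀ hsy]
    have := mul_le_mul_of_nonneg_right hc.deltaMu_le_y hB
    linarith
  set P := Real.sqrt c.muX * p with hP
  set Q := Real.sqrt c.muY * q with hQ
  have hP2 : P ^ 2 = c.muX * p ^ 2 := by rw [hP, mul_pow, Real.sq_sqrt hc.muX.le]
  have hQ2 : Q ^ 2 = c.muY * q ^ 2 := by rw [hQ, mul_pow, Real.sq_sqrt hc.muY.le]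
  have hα2 : α ^ 2 = 2 * (A ^ 2 / (2 * c.muX)) := by
    rw [hα, div_pow, Real.sq_sqrt hc.muX.le]; have := hc.muX; field_simp
  have hβ2 : β ^ 2 = 2 * (B ^ 2 / (2 * c.muY)) := by
    rw [hβ, div_pow, Real.sq_sqrt hc.muY.le]; have := hc.muY; field_simp
  have hsum : P ^ 2 + Q ^ 2 ≤ α ^ 2 + β ^ 2 := by linarith
  have hPQ : P + Q ≤ Real.sqrt 2 * (α + β) := by
    refine le_of_sq_le_sq ?_ (by positivity)
    rw [mul_pow, Real.sq_sqrt (by norm_num)]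
    nlinarith [sq_nonneg (P - Q), mul_nonneg hα0 hβ0]
  have hαβ := mul_le_mul_of_nonneg_left hPQ hM0
  have := mul_le_mul_of_nonneg_right hMδ (add_nonneg hα0 hβ0)
  linarith

/-- The point of the closed ball that minimizes a linear functional. -/
lemma exists_mem_closedBall_inner_eq {d : ℕ} (u a : E d) {δ : ℝ} (hδ : 0 ≤ δ) :
    ∃ q ∈ Metric.closedBall u δ, inner ℝ a q = inner ℝ a u - δ * ‖a‖ := by
  by_cases h : a = 0
  · exact ⟨u, Metric.mem_closedBall_self hδ, by simp [h]⟩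
  have h0 : ‖a‖ ≠ 0 := norm_ne_zero_iff.2 h
  refine ⟨u - (δ / ‖a‖) • a, ?_, ?_⟩
  · rw [mem_closedBall_iff_norm, sub_sub_cancel_left, norm_neg, norm_smul, norm_div, norm_norm,
      Real.norm_eq_abs, abs_of_nonneg hδ, div_mul_cancel₀ _ h0]
  · rw [inner_sub_right, inner_smul_right, real_inner_self_eq_norm_sq]
    field_simp

/-- For a strongly convex function, the suboptimality is at most the squared gradient norm. -/
lemma sub_le_sq_div {A B p m : ℝ} (hm : 0 < m) (h : A ≤ B * p - m / 2 * p ^ 2) :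
    A ≤ B ^ 2 / (2 * m) := by
  rw [le_div_iff₀ (by positivity)]
  nlinarith [sq_nonneg (B - m * p)]

section Step

variable {f : E dX → E dY → ℝ} {gx : E dX → E dY → E dX} {gy : E dX → E dY → E dY}

/-- One Frank-Wolfe step contracts the duality gap at the saddle point, up to the error of the
gradient estimate. -/
lemma SmoothSaddle.frankWolfe_step (hc : c.Admissible) (hd : Domain c X Y)
    (hs : SmoothSaddle c X Y f gx gy) {u : E dX} {v : E dY} (h : IsSaddle X Y f u v)
    (hbx : Metric.closedBall u c.deltaX ⊆ X) (hby : Metric.closedBall v c.deltaY ⊆ Y)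
    {x a sx : E dX} {y b sy : E dY} (hx : x ∈ X) (hy : y ∈ Y) (hsx : sx ∈ X) (hsy : sy ∈ Y)
    (hmin : ∀ q₁ ∈ X, ∀ q₂ ∈ Y, inner ℝ a sx - inner ℝ b sy ≤ inner ℝ a q₁ - inner ℝ b q₂)
    {γ : ℝ} (h0 : 0 ≤ γ) (h1 : γ ≤ 1) :
    f ((1 - γ) • x + γ • sx) v - f u ((1 - γ) • y + γ • sy) ≤
      (1 - γ) * (f x v - f u y) + γ * (c.DX * ‖a - gx x y‖ + c.DY * ‖b - gy x y‖)
        + γ ^ 2 * (c.LGX * c.DX ^ 2 + c.LGY * c.DY ^ 2) := by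
  have hv := h.mem_y
  have hu := h.mem_x
  have hx' : (1 - γ) • x + γ • sx ∈ X := hd.convex_x hx hsx (sub_nonneg.2 h1) h0 (by ring)
  have hy' : (1 - γ) • y + γ • sy ∈ Y := hd.convex_y hy hsy (sub_nonneg.2 h1) h0 (by ring)
  have ex : (1 - γ) • x + γ • sx - x = γ • (sx - x) := by module
  have ey : (1 - γ) • y + γ • sy - y = γ • (sy - y) := by module
  -- smoothness
  have hdx := (abs_le.1 (abs_linearization_le hc.LGX hd.convex_x
    (fun x hx => hs.grad_x x hx v hv) (fun x₁ h₁ x₂ h₂ => hs.lip_gx x₁ h₁ x₂ h₂ v hv) hx hx')).2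
  have hdy := (abs_le.1 (abs_linearization_le hc.LGY hd.convex_y
    (fun y hy => hs.grad_y u hu y hy) (fun y₁ h₁ y₂ h₂ => hs.lip_gy u hu y₁ h₁ y₂ h₂) hy hy')).1
  rw [ex, inner_smul_right, norm_smul, Real.norm_eq_abs, abs_of_nonneg h0, mul_pow] at hdx
  rw [ey, inner_smul_right, norm_smul, Real.norm_eq_abs, abs_of_nonneg h0, mul_pow] at hdy
  have hnx : ‖sx - x‖ ^ 2 ≤ c.DX ^ 2 :=
    pow_le_pow_left₀ (norm_nonneg _) (hd.diam_x sx hsx x hx) 2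
  have hny : ‖sy - y‖ ^ 2 ≤ c.DY ^ 2 :=
    pow_le_pow_left₀ (norm_nonneg _) (hd.diam_y sy hsy y hy) 2
  have hnx' := mul_le_mul_of_nonneg_left hnx (mul_nonneg hc.LGX (sq_nonneg γ))
  have hny' := mul_le_mul_of_nonneg_left hny (mul_nonneg hc.LGY (sq_nonneg γ))
  -- coupling
  have hcx : inner ℝ (gx x v - gx x y) (sx - x) ≤ c.DX * c.LXY * ‖y - v‖ := by
    refine (real_inner_le_norm _ _).trans ?_
    have := mul_le_mul (hs.cross_x x hx v hv y hy) (hd.diam_x sx hsx x hx) (norm_nonneg _)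
      (mul_nonneg hc.LXY (norm_nonneg _))
    rw [norm_sub_rev v y] at this
    linarith
  have hcy : -inner ℝ (gy u y - gy x y) (sy - y) ≤ c.DY * c.LYX * ‖x - u‖ := by
    rw [← inner_neg_left, neg_sub]
    refine (real_inner_le_norm _ _).trans ?_
    have := mul_le_mul (hs.cross_y x hx u hu y hy) (hd.diam_y sy hsy y hy) (norm_nonneg _)
      (mul_nonneg hc.LYX (norm_nonneg _))
    linarith
  -- optimality of the linear minimization step
  obtain ⟨q₁, hq₁, hq₁'⟩ := exists_mem_closedBall_inner_eq u (gx x y) hc.deltaX.le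
  obtain ⟨q₂, hq₂, hq₂'⟩ := exists_mem_closedBall_inner_eq v (-gy x y) hc.deltaY.le
  rw [inner_neg_left, inner_neg_left, norm_neg] at hq₂'
  have hq := hmin q₁ (hbx hq₁) q₂ (hby hq₂)
  have hex : inner ℝ (a - gx x y) (q₁ - sx) ≤ c.DX * ‖a - gx x y‖ := by
    rw [mul_comm]
    exact (real_inner_le_norm _ _).trans (mul_le_mul_of_nonneg_left
      (hd.diam_x q₁ (hbx hq₁) sx hsx) (norm_nonneg _))
  have hey : inner ℝ (b - gy x y) (sy - q₂) ≤ c.DY * ‖b - gy x y‖ := by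
    rw [mul_comm]
    exact (real_inner_le_norm _ _).trans (mul_le_mul_of_nonneg_left
      (hd.diam_y sy hsy q₂ (hby hq₂)) (norm_nonneg _))
  -- strong convexity
  have hfx := first_order_lower (hs.convex y hy) hx hu (hs.grad_x x hx y hy)
  have hfy := first_order_lower (hs.convex_neg hx) hy hv (g := -gy x y) (by
    have := (hs.grad_y x hx y hy).hasFDerivAt.neg
    rw [hasGradientAt_iff_hasFDerivAt, map_neg]
    exact this)
  have hgx := h.growth_x hs hx
  have hgy := h.growth_y hs hy
  have hA : f x y - f u y ≤ ‖gx x y‖ * ‖u - x‖ - c.muX / 2 * ‖u - x‖ ^ 2 := by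
    have := neg_le_of_abs_le (abs_real_inner_le_norm (gx x y) (u - x))
    linarith
  have hB : f x v - f x y ≤ ‖gy x y‖ * ‖v - y‖ - c.muY / 2 * ‖v - y‖ ^ 2 := by
    have := real_inner_le_norm (gy x y) (v - y)
    rw [inner_neg_left] at hfy
    linarith
  have hcoup := hc.coupling_le (A := ‖gx x y‖) (B := ‖gy x y‖) (p := ‖x - u‖) (q := ‖y - v‖)
    (hx := f x v - f u v) (hy := f u v - f u y) (norm_nonneg _) (norm_nonneg _) (norm_nonneg _)
    (norm_nonneg _) (by linarith) (by linarith)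
    (by have := sub_le_sq_div hc.muX hA; have := sub_le_sq_div hc.muY hB; linarith)
  have hsqx : 0 ≤ c.muX / 2 * ‖u - x‖ ^ 2 := by have := hc.muX; positivity
  have hsqy : 0 ≤ c.muY / 2 * ‖v - y‖ ^ 2 := by have := hc.muY; positivity
  have hmain : inner ℝ (gx x v) (sx - x) - inner ℝ (gy u y) (sy - y) ≤
      -(f x v - f u y) + (c.DX * ‖a - gx x y‖ + c.DY * ‖b - gy x y‖) := by
    simp only [inner_sub_left, inner_sub_right, inner_neg_left] at *
    linarith
  have := mul_le_mul_of_nonneg_left hmain h0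
  linarith

end Step

end

section

variable {dX dY : ℕ} {c : Constants} {X : Set (E dX)} {Y : Set (E dY)}

/-- The average of the first `t` members of a family of vector-valued maps. -/
def avg {α β V : Type*} [AddCommGroup V] [Module ℝ V] (f : ℕ → α → β → V) (t : ℕ) (x : α) (y : β) :
    V :=
  (1 / (t : ℝ)) • ∑ i ∈ Icc 1 t, f i x y

lemma sum_eq_mul_avg {α β : Type*} (f : ℕ → α → β → ℝ) (t : ℕ) (x : α) (y : β) :
    ∑ i ∈ Icc 1 t, f i x y = t * avg f t x y := by
  rcases Nat.eq_zero_or_pos t with rfl | ht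
  · simp
  · have : (t : ℝ) ≠ 0 := by positivity
    rw [avg, smul_eq_mul]
    field_simp

lemma avg_succ_sub {α β : Type*} (f : ℕ → α → β → ℝ) (t : ℕ) (x : α) (y : β) :
    avg f (t + 1) x y - avg f t x y = (f (t + 1) x y - avg f t x y) / ((t : ℝ) + 1) := by
  have h1 := sum_eq_mul_avg f t x y
  have h2 := sum_eq_mul_avg f (t + 1) x y
  rw [Finset.sum_Icc_succ_top (by omega), h1] at h2
  push_cast at h2
  have : (t : ℝ) + 1 ≠ 0 := by positivity
  field_simp
  linarith

/-- The first `T` functions are smooth saddle functions and `(u t, v t)` are saddle points of their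
averages, at distance `δ_X`, `δ_Y` from the boundary. -/
structure Leader (c : Constants) (X : Set (E dX)) (Y : Set (E dY)) (f : ℕ → E dX → E dY → ℝ)
    (gx : ℕ → E dX → E dY → E dX) (gy : ℕ → E dX → E dY → E dY) (T : ℕ) (u : ℕ → E dX)
    (v : ℕ → E dY) : Prop where
  admissible : c.Admissible
  domain : Domain c X Y
  smooth : ∀ t ∈ Icc 1 T, SmoothSaddle c X Y (f t) (gx t) (gy t)
  saddle : ∀ t ∈ Icc 1 T, IsSaddle X Y (avg f t) (u t) (v t)
  ball_x : ∀ t ∈ Icc 1 T, Metric.closedBall (u t) c.deltaX ⊆ X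
  ball_y : ∀ t ∈ Icc 1 T, Metric.closedBall (v t) c.deltaY ⊆ Y

/-- The drift constant: consecutive saddle points are at distance at most `c.drift / (t + 1)`. -/
def Constants.drift (c : Constants) : ℝ := 4 * (c.LX + c.LY) / min c.muX c.muY

lemma Constants.Admissible.drift_nonneg (hc : c.Admissible) : 0 ≤ c.drift := by
  have := lt_min hc.muX hc.muY
  have := hc.LX
  have := hc.LY
  unfold Constants.drift
  positivity

namespace Leader

variable {f : ℕ → E dX → E dY → ℝ} {gx : ℕ → E dX → E dY → E dX} {gy : ℕ → E dX → E dY → E dY}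
  {T : ℕ} {u : ℕ → E dX} {v : ℕ → E dY}

lemma smooth_avg (h : Leader c X Y f gx gy T u v) {t : ℕ} (ht : t ∈ Icc 1 T) :
    SmoothSaddle c X Y (avg f t) (avg gx t) (avg gy t) := by
  rw [mem_Icc] at ht
  exact SmoothSaddle.average ht.1 h.domain.convex_x h.domain.convex_y
    fun i hi => h.smooth i (mem_Icc.2 ⟨(mem_Icc.1 hi).1, (mem_Icc.1 hi).2.trans ht.2⟩)

lemma increment_x (h : Leader c X Y f gx gy T u v) {t : ℕ} (ht : 1 ≤ t) (htT : t + 1 ≤ T)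
    {x x' : E dX} {y : E dY} (hx : x ∈ X) (hx' : x' ∈ X) (hy : y ∈ Y) :
    |(avg f (t + 1) x y - avg f t x y) - (avg f (t + 1) x' y - avg f t x' y)| ≤
      2 * c.LX / ((t : ℝ) + 1) * ‖x - x'‖ := by
  have h1 := (h.smooth (t + 1) (mem_Icc.2 ⟨by omega, htT⟩)).lip_x x hx x' hx' y hy
  have h2 := (h.smooth_avg (mem_Icc.2 ⟨ht, by omega⟩)).lip_x x hx x' hx' y hy
  rw [avg_succ_sub, avg_succ_sub, ← sub_div, abs_div,
    abs_of_pos (by positivity : (0 : ℝ) < (t : ℝ) + 1), div_mul_eq_mul_div]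
  gcongr
  rw [abs_le] at *
  constructor <;> linarith [h1.1, h1.2, h2.1, h2.2]

lemma increment_y (h : Leader c X Y f gx gy T u v) {t : ℕ} (ht : 1 ≤ t) (htT : t + 1 ≤ T)
    {x : E dX} {y y' : E dY} (hx : x ∈ X) (hy : y ∈ Y) (hy' : y' ∈ Y) :
    |(avg f (t + 1) x y - avg f t x y) - (avg f (t + 1) x y' - avg f t x y')| ≤
      2 * c.LY / ((t : ℝ) + 1) * ‖y - y'‖ := by
  have h1 := (h.smooth (t + 1) (mem_Icc.2 ⟨by omega, htT⟩)).lip_y x hx y hy y' hy'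
  have h2 := (h.smooth_avg (mem_Icc.2 ⟨ht, by omega⟩)).lip_y x hx y hy y' hy'
  rw [avg_succ_sub, avg_succ_sub, ← sub_div, abs_div,
    abs_of_pos (by positivity : (0 : ℝ) < (t : ℝ) + 1), div_mul_eq_mul_div]
  gcongr
  rw [abs_le] at *
  constructor <;> linarith [h1.1, h1.2, h2.1, h2.2]

/-- Consecutive leaders are close. -/
lemma drift_le (h : Leader c X Y f gx gy T u v) {t : ℕ} (ht : 1 ≤ t) (htT : t + 1 ≤ T) :
    ‖u (t + 1) - u t‖ + ‖v (t + 1) - v t‖ ≤ c.drift / ((t : ℝ) + 1) := by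
  have hc := h.admissible
  have m0 : t ∈ Icc 1 T := mem_Icc.2 ⟨ht, by omega⟩
  have m1 : t + 1 ∈ Icc 1 T := mem_Icc.2 ⟨by omega, htT⟩
  have hs := h.saddle t m0
  have hs' := h.saddle (t + 1) m1
  have hLX := hc.LX
  have hLY := hc.LY
  have := IsSaddle.drift hc (h.smooth_avg m0) (h.smooth_avg m1) hs hs'
    (r := 2 * (c.LX + c.LY) / ((t : ℝ) + 1)) (by positivity)
    (fun y hy => by
      rw [norm_sub_rev]
      refine (h.increment_x ht htT hs.mem_x hs'.mem_x hy).trans ?_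
      gcongr
      linarith)
    (fun x hx => by
      rw [norm_sub_rev]
      refine (h.increment_y ht htT hx hs.mem_y hs'.mem_y).trans ?_
      gcongr
      linarith)
  refine this.trans_eq ?_
  rw [Constants.drift]
  ring

/-- Following the saddle points of the averages costs little compared to the last one. -/
lemma follow_le (h : Leader c X Y f gx gy T u v) (n : ℕ) (hn : n ≤ T) :
    |∑ t ∈ Icc 1 n, f t (u t) (v t) - ∑ t ∈ Icc 1 n, f t (u n) (v n)| ≤
      ∑ t ∈ Icc 1 n, (c.LX + c.LY) * c.drift / (t : ℝ) := by
  have hc := h.admissible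
  have hLX := hc.LX
  have hLY := hc.LY
  have hK := hc.drift_nonneg
  induction n with
  | zero => simp
  | succ n ih =>
    have ih := ih (by omega)
    rw [Finset.sum_Icc_succ_top (by omega), Finset.sum_Icc_succ_top (by omega),
      Finset.sum_Icc_succ_top (by omega)]
    rcases Nat.eq_zero_or_pos n with rfl | hn0
    · simp only [zero_add, zero_lt_one, Icc_eq_empty_of_lt, sum_empty,
        sub_self, abs_zero]
      positivity
    have m0 : n ∈ Icc 1 T := mem_Icc.2 ⟨hn0, by omega⟩
    have m1 : n + 1 ∈ Icc 1 T := mem_Icc.2 ⟨by omega, hn⟩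
    have hs := h.saddle n m0
    have hs' := h.saddle (n + 1) m1
    have hd := h.drift_le hn0 hn
    have hn' : (0 : ℝ) ≤ n := by positivity
    have key : ∀ x y, (n : ℝ) * avg f n x y = ((n : ℝ) + 1) * avg f (n + 1) x y - f (n + 1) x y := by
      intro x y
      have h1 := sum_eq_mul_avg f (n + 1) x y
      rw [Finset.sum_Icc_succ_top (by omega), sum_eq_mul_avg] at h1
      push_cast at h1
      linarith
    have l1 := mul_le_mul_of_nonneg_left (hs.le_x _ hs'.mem_x) hn'
    have l2 := mul_le_mul_of_nonneg_left (hs.le_y _ hs'.mem_y) hn'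
    have l3 := mul_le_mul_of_nonneg_left (hs'.le_x _ hs.mem_x) (by linarith : 0 ≤ (n : ℝ) + 1)
    have l4 := mul_le_mul_of_nonneg_left (hs'.le_y _ hs.mem_y) (by linarith : 0 ≤ (n : ℝ) + 1)
    have k1 := key (u n) (v (n + 1))
    have k2 := key (u (n + 1)) (v n)
    have k3 := key (u (n + 1)) (v (n + 1))
    have b1 := (abs_le.1 ((h.smooth _ m1).lip_x _ hs'.mem_x _ hs.mem_x _ hs'.mem_y)).1
    have b2 := (abs_le.1 ((h.smooth _ m1).lip_y _ hs'.mem_x _ hs'.mem_y _ hs.mem_y)).2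
    have e1 : c.LX * ‖u (n + 1) - u n‖ ≤ (c.LX + c.LY) * (c.drift / ((n : ℝ) + 1)) := by
      refine mul_le_mul (by linarith) ?_ (norm_nonneg _) (by linarith)
      linarith [norm_nonneg (v (n + 1) - v n)]
    have e2 : c.LY * ‖v (n + 1) - v n‖ ≤ (c.LX + c.LY) * (c.drift / ((n : ℝ) + 1)) := by
      refine mul_le_mul (by linarith) ?_ (norm_nonneg _) (by linarith)
      linarith [norm_nonneg (u (n + 1) - u n)]
    rw [sum_eq_mul_avg f n (u n)] at ih
    rw [sum_eq_mul_avg f n (u (n + 1))]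
    push_cast
    rw [mul_div_assoc _ c.drift]
    rw [abs_le] at ih ⊢
    constructor <;> linarith [ih.1, ih.2]

/-- The duality gap of `(x, y)` for the average function. -/
def dualityGap (f : ℕ → E dX → E dY → ℝ) (u : ℕ → E dX) (v : ℕ → E dY) (t : ℕ) (z : E dX × E dY) : ℝ :=
  avg f t z.1 (v t) - avg f t (u t) z.2

lemma dualityGap_ge (h : Leader c X Y f gx gy T u v) {t : ℕ} (ht : t ∈ Icc 1 T) {z : E dX × E dY}
    (hz : z ∈ X ×ˢ Y) :
    c.muX / 2 * ‖z.1 - u t‖ ^ 2 + c.muY / 2 * ‖z.2 - v t‖ ^ 2 ≤ dualityGap f u v t z := by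
  have h1 := (h.saddle t ht).growth_x (h.smooth_avg ht) hz.1
  have h2 := (h.saddle t ht).growth_y (h.smooth_avg ht) hz.2
  unfold dualityGap
  linarith

lemma dualityGap_nonneg (h : Leader c X Y f gx gy T u v) {t : ℕ} (ht : t ∈ Icc 1 T)
    {z : E dX × E dY} (hz : z ∈ X ×ˢ Y) : 0 ≤ dualityGap f u v t z := by
  have hX := h.admissible.muX
  have hY := h.admissible.muY
  exact le_trans (by positivity) (h.dualityGap_ge ht hz)

lemma dualityGap_le (h : Leader c X Y f gx gy T u v) {t : ℕ} (ht : t ∈ Icc 1 T) {z : E dX × E dY}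
    (hz : z ∈ X ×ˢ Y) : dualityGap f u v t z ≤ c.LX * c.DX + c.LY * c.DY := by
  have hs := h.saddle t ht
  have h1 := (abs_le.1 ((h.smooth_avg ht).lip_x _ hz.1 _ hs.mem_x _ hs.mem_y)).2
  have h2 := (abs_le.1 ((h.smooth_avg ht).lip_y _ hs.mem_x _ hs.mem_y _ hz.2)).2
  have h3 := mul_le_mul_of_nonneg_left (h.domain.diam_x _ hz.1 _ hs.mem_x) h.admissible.LX
  have h4 := mul_le_mul_of_nonneg_left (h.domain.diam_y _ hs.mem_y _ hz.2) h.admissible.LY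
  unfold dualityGap
  linarith

/-- Passing to the next average function changes the duality gap by `O(1/t)`. -/
lemma dualityGap_succ_le (h : Leader c X Y f gx gy T u v) {t : ℕ} (ht : 1 ≤ t) (htT : t + 1 ≤ T)
    {z : E dX × E dY} (hz : z ∈ X ×ˢ Y) :
    dualityGap f u v (t + 1) z ≤ dualityGap f u v t z
      + (2 * (c.LX + c.LY) * c.drift + 2 * (c.LX * c.DX + c.LY * c.DY)) / ((t : ℝ) + 1) := by
  have hc := h.admissible
  have hLX := hc.LX
  have hLY := hc.LY
  have m0 : t ∈ Icc 1 T := mem_Icc.2 ⟨ht, by omega⟩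
  have m1 : t + 1 ∈ Icc 1 T := mem_Icc.2 ⟨by omega, htT⟩
  have hs := h.saddle t m0
  have hs' := h.saddle (t + 1) m1
  have hd := h.drift_le ht htT
  have b1 := (abs_le.1 ((h.smooth_avg m1).lip_x _ hs.mem_x _ hs'.mem_x _ hz.2)).2
  have b2 := (abs_le.1 ((h.smooth_avg m1).lip_y _ hz.1 _ hs'.mem_y _ hs.mem_y)).2
  rw [norm_sub_rev] at b1
  have e1 : c.LX * ‖u (t + 1) - u t‖ ≤ (c.LX + c.LY) * (c.drift / ((t : ℝ) + 1)) := by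
    refine mul_le_mul (by linarith) ?_ (norm_nonneg _) (by linarith)
    linarith [norm_nonneg (v (t + 1) - v t)]
  have e2 : c.LY * ‖v (t + 1) - v t‖ ≤ (c.LX + c.LY) * (c.drift / ((t : ℝ) + 1)) := by
    refine mul_le_mul (by linarith) ?_ (norm_nonneg _) (by linarith)
    linarith [norm_nonneg (u (t + 1) - u t)]
  have i1 := (abs_le.1 (h.increment_x ht htT hz.1 hs.mem_x hs.mem_y)).2
  have i2 := (abs_le.1 (h.increment_y ht htT hs.mem_x hs.mem_y hz.2)).2
  have i3 := mul_le_mul_of_nonneg_left (h.domain.diam_x _ hz.1 _ hs.mem_x)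
    (by positivity : 0 ≤ 2 * c.LX / ((t : ℝ) + 1))
  have i4 := mul_le_mul_of_nonneg_left (h.domain.diam_y _ hs.mem_y _ hz.2)
    (by positivity : 0 ≤ 2 * c.LY / ((t : ℝ) + 1))
  have e : (2 * (c.LX + c.LY) * c.drift + 2 * (c.LX * c.DX + c.LY * c.DY)) / ((t : ℝ) + 1)
      = 2 * ((c.LX + c.LY) * (c.drift / ((t : ℝ) + 1))) + 2 * c.LX / ((t : ℝ) + 1) * c.DX
        + 2 * c.LY / ((t : ℝ) + 1) * c.DY := by ring
  rw [e]
  unfold dualityGap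
  linarith

/-- The factor between the square root of the duality gap and the error in the values. -/
def _root_.OnlineSaddle.Constants.valueFactor (c : Constants) : ℝ :=
  c.LX * Real.sqrt (2 / c.muX) + c.LY * Real.sqrt (2 / c.muY)

lemma abs_value_sub_le (h : Leader c X Y f gx gy T u v) {t : ℕ} (ht : t ∈ Icc 1 T)
    {z : E dX × E dY} (hz : z ∈ X ×ˢ Y) :
    |f t z.1 z.2 - f t (u t) (v t)| ≤ c.valueFactor * Real.sqrt (dualityGap f u v t z) := by
  have hs := h.saddle t ht
  have hmX := h.admissible.muX
  have hmY := h.admissible.muY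
  have hg := h.dualityGap_ge ht hz
  have hx : ‖z.1 - u t‖ ≤ Real.sqrt (2 / c.muX) * Real.sqrt (dualityGap f u v t z) := by
    rw [← Real.sqrt_mul (by positivity)]
    apply Real.le_sqrt_of_sq_le
    rw [div_mul_eq_mul_div, le_div_iff₀ hmX]
    have : 0 ≤ c.muY / 2 * ‖z.2 - v t‖ ^ 2 := by positivity
    linarith
  have hy : ‖z.2 - v t‖ ≤ Real.sqrt (2 / c.muY) * Real.sqrt (dualityGap f u v t z) := by
    rw [← Real.sqrt_mul (by positivity)]
    apply Real.le_sqrt_of_sq_le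
    rw [div_mul_eq_mul_div, le_div_iff₀ hmY]
    have : 0 ≤ c.muX / 2 * ‖z.1 - u t‖ ^ 2 := by positivity
    linarith
  have h1 := (h.smooth t ht).lip_x _ hz.1 _ hs.mem_x _ hz.2
  have h2 := (h.smooth t ht).lip_y _ hs.mem_x _ hz.2 _ hs.mem_y
  have h3 := mul_le_mul_of_nonneg_left hx h.admissible.LX
  have h4 := mul_le_mul_of_nonneg_left hy h.admissible.LY
  unfold Constants.valueFactor
  have := abs_sub_le (f t z.1 z.2) (f t (u t) z.2) (f t (u t) (v t))
  linarith

/-- Pathwise bound of the regret in terms of the duality gaps. -/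
lemma abs_regret_le (h : Leader c X Y f gx gy T u v) {z : ℕ → E dX × E dY}
    (hz : ∀ t, z t ∈ X ×ˢ Y) :
    |∑ t ∈ Icc 1 T, f t (z t).1 (z t).2 - ∑ t ∈ Icc 1 T, f t (u T) (v T)| ≤
      ∑ t ∈ Icc 1 T, (c.valueFactor * Real.sqrt (dualityGap f u v t (z t))
        + (c.LX + c.LY) * c.drift / (t : ℝ)) := by
  rw [Finset.sum_add_distrib]
  refine (abs_sub_le _ (∑ t ∈ Icc 1 T, f t (u t) (v t)) _).trans (add_le_add ?_ (h.follow_le T le_rfl))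
  rw [← Finset.sum_sub_distrib]
  exact (Finset.abs_sum_le_sum_abs _ _).trans
    (Finset.sum_le_sum fun t ht => h.abs_value_sub_le ht (hz t))

/-- The constant of the recursion for the duality gaps. -/
def _root_.OnlineSaddle.Constants.recursion (c : Constants) : ℝ :=
  c.LGX * c.DX ^ 2 + c.LGY * c.DY ^ 2
    + (2 * (c.LX + c.LY) * c.drift + 2 * (c.LX * c.DX + c.LY * c.DY))

/-- The recursion for the duality gaps along the Frank-Wolfe iterates. -/
lemma dualityGap_step (h : Leader c X Y f gx gy T u v) {t : ℕ} (ht : 1 ≤ t) (htT : t + 1 ≤ T)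
    {z s g : E dX × E dY} (hz : z ∈ X ×ˢ Y) (hs : s ∈ X ×ˢ Y)
    (hmin : ∀ q ∈ X ×ˢ Y, inner ℝ s.1 g.1 + inner ℝ s.2 (-g.2) ≤
      inner ℝ q.1 g.1 + inner ℝ q.2 (-g.2)) :
    dualityGap f u v (t + 1) ((1 - stepSize t) • z + stepSize t • s) ≤
      (1 - 1 / Real.sqrt t) * dualityGap f u v t z
        + 1 / Real.sqrt t * (c.DX * ‖g.1 - avg gx t z.1 z.2‖ + c.DY * ‖g.2 - avg gy t z.1 z.2‖)
        + c.recursion / t := by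
  have hc := h.admissible
  have m0 : t ∈ Icc 1 T := mem_Icc.2 ⟨ht, by omega⟩
  have ht1 : (1 : ℝ) ≤ t := by exact_mod_cast ht
  have hsq : 1 ≤ Real.sqrt t := Real.one_le_sqrt.2 ht1
  have hγ0 : 0 ≤ stepSize t := by unfold stepSize; positivity
  have hγ1 : stepSize t ≤ 1 := by
    unfold stepSize
    rw [div_le_one (by linarith)]
    exact hsq
  have hstep := (h.smooth_avg m0).frankWolfe_step hc h.domain (h.saddle t m0) (h.ball_x t m0)
    (h.ball_y t m0) (a := g.1) (b := g.2) hz.1 hz.2 hs.1 hs.2 (fun q₁ h₁ q₂ h₂ => by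
      have := hmin (q₁, q₂) ⟨h₁, h₂⟩
      simp only [inner_neg_right] at this
      rw [real_inner_comm s.1, real_inner_comm s.2, real_inner_comm q₁, real_inner_comm q₂]
      linarith) hγ0 hγ1
  have hz' : (1 - stepSize t) • z + stepSize t • s ∈ X ×ˢ Y :=
    (h.domain.convex_x.prod h.domain.convex_y) hz hs (sub_nonneg.2 hγ1) hγ0 (by ring)
  have hnext := h.dualityGap_succ_le ht htT hz'
  have e2 : stepSize t ^ 2 = 1 / (t : ℝ) := by
    rw [stepSize, div_pow, Real.sq_sqrt (by linarith), one_pow]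
  have e3 : (2 * (c.LX + c.LY) * c.drift + 2 * (c.LX * c.DX + c.LY * c.DY)) / ((t : ℝ) + 1) ≤
      (2 * (c.LX + c.LY) * c.drift + 2 * (c.LX * c.DX + c.LY * c.DY)) / (t : ℝ) := by
    have := hc.drift_nonneg
    have := hc.LX
    have := hc.LY
    have := hc.DX
    have := hc.DY
    gcongr
    linarith
  rw [e2] at hstep
  have e4 : c.recursion / (t : ℝ) = 1 / (t : ℝ) * (c.LGX * c.DX ^ 2 + c.LGY * c.DY ^ 2)
      + (2 * (c.LX + c.LY) * c.drift + 2 * (c.LX * c.DX + c.LY * c.DY)) / (t : ℝ) := by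
    rw [Constants.recursion]; ring
  rw [e4]
  refine hnext.trans ?_
  refine (add_le_add hstep e3).trans_eq ?_
  unfold dualityGap stepSize
  ring

end Leader

end

section

variable {dX dY : ℕ} {c : Constants} {X : Set (E dX)} {Y : Set (E dY)}

/-- A recursion with contraction factor `1 - 1/√t` and error `O(1/t)` decays like `1/√t`. -/
lemma le_div_sqrt_of_recursion {H : ℕ → ℝ} {C : ℝ} {T : ℕ} (hC : 0 ≤ C) (h1 : H 1 ≤ C)
    (h : ∀ t, 1 ≤ t → t + 1 ≤ T → H (t + 1) ≤ (1 - 1 / Real.sqrt t) * H t + C / t) (t : ℕ)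
    (ht : 1 ≤ t) (htT : t ≤ T) : H t ≤ 2 * C / Real.sqrt t := by
  induction t, ht using Nat.le_induction with
  | base => simp; linarith
  | succ t ht ih =>
    have ih := ih (by omega)
    have ht1 : (1 : ℝ) ≤ t := by exact_mod_cast ht
    have ht0 : (0 : ℝ) ≤ t := by linarith
    have hs : 1 ≤ Real.sqrt t := Real.one_le_sqrt.2 ht1
    have hs' : Real.sqrt t ≤ Real.sqrt ((t + 1 : ℕ) : ℝ) := Real.sqrt_le_sqrt (by push_cast; linarith)
    have h2 : 0 ≤ 1 - 1 / Real.sqrt t := by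
      rw [sub_nonneg, div_le_one (by linarith)]; exact hs
    refine (h t ht htT).trans ((add_le_add_left (mul_le_mul_of_nonneg_left ih h2) _).trans ?_)
    set s := Real.sqrt t with hsdef
    set r := Real.sqrt ((t + 1 : ℕ) : ℝ) with hrdef
    have hst : (t : ℝ) = s ^ 2 := (Real.sq_sqrt ht0).symm
    have hrt : r ^ 2 = s ^ 2 + 1 := by
      rw [hrdef, Real.sq_sqrt (by positivity), ← hst]; push_cast; ring
    have hs0 : 0 < s := by linarith
    have hr0 : 0 < r := by linarith
    have hrs : r ≤ s + 1 / 2 := by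
      nlinarith
    rw [hst]
    have e : (1 - 1 / s) * (2 * C / s) + C / s ^ 2 = C * ((2 * s - 1) / s ^ 2) := by
      field_simp; ring
    rw [e, mul_comm 2 C, mul_div_assoc]
    refine mul_le_mul_of_nonneg_left ?_ hC
    rw [div_le_div_iff₀ (by positivity) hr0]
    nlinarith

lemma sum_rpow_neg_le (n : ℕ) :
    ∑ t ∈ Icc 1 n, (t : ℝ) ^ (-(1 / 4) : ℝ) ≤ 2 * (n : ℝ) ^ (3 / 4 : ℝ) := by
  induction n with
  | zero => simp
  | succ n ih =>
    rw [Finset.sum_Icc_succ_top (by omega)]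
    have hn : (0 : ℝ) < ((n + 1 : ℕ) : ℝ) := by positivity
    have hn0 : (0 : ℝ) ≤ n := by positivity
    have h1 := Real.geom_mean_le_arith_mean2_weighted (w₁ := 3 / 4) (w₂ := 1 / 4) (by norm_num)
      (by norm_num) hn0 hn.le (by norm_num)
    have h2 : (((n + 1 : ℕ) : ℝ)) ^ (3 / 4 : ℝ) * (((n + 1 : ℕ) : ℝ)) ^ (1 / 4 : ℝ)
        = ((n + 1 : ℕ) : ℝ) := by
      rw [← Real.rpow_add hn]; norm_num
    have h3 : (((n + 1 : ℕ) : ℝ)) ^ (-(1 / 4) : ℝ) * (((n + 1 : ℕ) : ℝ)) ^ (1 / 4 : ℝ) = 1 := by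
      rw [← Real.rpow_add hn]; norm_num
    have h4 : 0 < (((n + 1 : ℕ) : ℝ)) ^ (1 / 4 : ℝ) := by positivity
    refine (add_le_add_left ih _).trans (le_of_mul_le_mul_right ?_ h4)
    rw [add_mul, h3, mul_assoc, mul_assoc, h2]
    push_cast at *
    linarith

/-- The constant in the regret bound, when the expected errors of the gradient estimates in round `t`
are at most `B / √t`. -/
def Constants.regretBound (c : Constants) (B : ℝ) : ℝ :=
  2 * (c.valueFactor * Real.sqrt (2 * (c.recursion + (c.DX + c.DY) * B
    + (c.LX * c.DX + c.LY * c.DY) + 1)) + (c.LX + c.LY) * c.drift)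

lemma Constants.Admissible.recursion_nonneg (hc : c.Admissible) : 0 ≤ c.recursion := by
  have := hc.drift_nonneg
  have := hc.LX
  have := hc.LY
  have := hc.LGX
  have := hc.LGY
  have := hc.DX
  have := hc.DY
  unfold Constants.recursion
  positivity

lemma Constants.Admissible.valueFactor_nonneg (hc : c.Admissible) : 0 ≤ c.valueFactor := by
  have := hc.LX
  have := hc.LY
  unfold Constants.valueFactor
  positivity

lemma Constants.Admissible.regretBound_nonneg (hc : c.Admissible) (B : ℝ) :
    0 ≤ c.regretBound B := by
  have := hc.drift_nonneg
  have := hc.valueFactor_nonneg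
  have := hc.LX
  have := hc.LY
  unfold Constants.regretBound
  positivity

lemma measurable_avg {V : Type*} [NormedAddCommGroup V] [NormedSpace ℝ V] [MeasurableSpace V]
    [BorelSpace V] [SecondCountableTopology V] {f : ℕ → E dX → E dY → V} {t : ℕ}
    (h : ∀ i ∈ Icc 1 t, Measurable (fun z : E dX × E dY => f i z.1 z.2)) :
    Measurable (fun z : E dX × E dY => avg f t z.1 z.2) := by
  unfold avg
  exact (Finset.measurable_sum _ h).const_smul _

/-- Expected regret of Frank-Wolfe iterates with gradient errors of order `1/√t`. -/
lemma Leader.expected_regret_le {f : ℕ → E dX → E dY → ℝ} {gx : ℕ → E dX → E dY → E dX}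
    {gy : ℕ → E dX → E dY → E dY} {T : ℕ} {u : ℕ → E dX} {v : ℕ → E dY}
    (h : Leader c X Y f gx gy T u v)
    (hf : ∀ i ∈ Icc 1 T, Measurable (fun z : E dX × E dY => f i z.1 z.2))
    {Ω : Type*} [MeasurableSpace Ω] {Q : Measure Ω} [IsProbabilityMeasure Q]
    {z s g : ℕ → Ω → E dX × E dY} (hzm : ∀ t ∈ Icc 1 T, Measurable (z t))
    (hz : ∀ t ω, z t ω ∈ X ×ˢ Y) (hs : ∀ t ω, s t ω ∈ X ×ˢ Y)
    (hmin : ∀ t ω, ∀ q ∈ X ×ˢ Y, inner ℝ (s t ω).1 (g t ω).1 + inner ℝ (s t ω).2 (-(g t ω).2) ≤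
      inner ℝ q.1 (g t ω).1 + inner ℝ q.2 (-(g t ω).2))
    (hstep : ∀ t ω, 1 ≤ t → z (t + 1) ω = (1 - stepSize t) • z t ω + stepSize t • s t ω)
    {B : ℝ} (hB : 0 ≤ B)
    (hex : ∀ t ∈ Icc 1 T, Integrable (fun ω => ‖(g t ω).1 - avg gx t (z t ω).1 (z t ω).2‖) Q ∧
      ∫ ω, ‖(g t ω).1 - avg gx t (z t ω).1 (z t ω).2‖ ∂Q ≤ B / Real.sqrt t)
    (hey : ∀ t ∈ Icc 1 T, Integrable (fun ω => ‖(g t ω).2 - avg gy t (z t ω).1 (z t ω).2‖) Q ∧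
      ∫ ω, ‖(g t ω).2 - avg gy t (z t ω).1 (z t ω).2‖ ∂Q ≤ B / Real.sqrt t) :
    Integrable (fun ω => ∑ t ∈ Icc 1 T, f t (z t ω).1 (z t ω).2 - ∑ t ∈ Icc 1 T, f t (u T) (v T)) Q ∧
    ∫ ω, |∑ t ∈ Icc 1 T, f t (z t ω).1 (z t ω).2 - ∑ t ∈ Icc 1 T, f t (u T) (v T)| ∂Q ≤
      c.regretBound B * (T : ℝ) ^ (3 / 4 : ℝ) := by
  have hc := h.admissible
  set R := c.LX * c.DX + c.LY * c.DY with hR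
  have hR0 : 0 ≤ R := add_nonneg (mul_nonneg hc.LX hc.DX) (mul_nonneg hc.LY hc.DY)
  set C := c.recursion + (c.DX + c.DY) * B + R + 1 with hCdef
  have hDB : 0 ≤ (c.DX + c.DY) * B := mul_nonneg (add_nonneg hc.DX hc.DY) hB
  have hC : 0 < C := by have := hc.recursion_nonneg; linarith
  set η : ℕ → Ω → ℝ := fun t ω => Leader.dualityGap f u v t (z t ω) with hη
  have hηm : ∀ t ∈ Icc 1 T, Measurable (η t) := by
    intro t ht
    have ha : Measurable (fun z : E dX × E dY => avg f t z.1 z.2) := measurable_avg fun i hi =>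
      hf i (mem_Icc.2 ⟨(mem_Icc.1 hi).1, (mem_Icc.1 hi).2.trans (mem_Icc.1 ht).2⟩)
    have h1 : Measurable (fun ω => ((z t ω).1, v t)) := (hzm t ht).fst.prodMk measurable_const
    have h2 : Measurable (fun ω => (u t, (z t ω).2)) := measurable_const.prodMk (hzm t ht).snd
    exact (ha.comp h1).sub (ha.comp h2)
  have hη0 : ∀ t ∈ Icc 1 T, ∀ ω, 0 ≤ η t ω := fun t ht ω => h.dualityGap_nonneg ht (hz t ω)
  have hηR : ∀ t ∈ Icc 1 T, ∀ ω, η t ω ≤ R := fun t ht ω => h.dualityGap_le ht (hz t ω)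
  have hηi : ∀ t ∈ Icc 1 T, Integrable (η t) Q := fun t ht =>
    Integrable.of_bound (hηm t ht).aestronglyMeasurable R (Filter.Eventually.of_forall fun ω => by
      rw [Real.norm_eq_abs, abs_of_nonneg (hη0 t ht ω)]; exact hηR t ht ω)
  have hηs : ∀ t ∈ Icc 1 T, Integrable (fun ω => Real.sqrt (η t ω)) Q := fun t ht =>
    Integrable.of_bound (hηm t ht).sqrt.aestronglyMeasurable (Real.sqrt R)
      (Filter.Eventually.of_forall fun ω => by
        rw [Real.norm_eq_abs, abs_of_nonneg (Real.sqrt_nonneg _)]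
        exact Real.sqrt_le_sqrt (hηR t ht ω))
  have hrec : ∀ t, 1 ≤ t → t ≤ T → ∫ ω, η t ω ∂Q ≤ 2 * C / Real.sqrt t := by
    intro t ht htT
    refine le_div_sqrt_of_recursion (H := fun t => ∫ ω, η t ω ∂Q) (T := T) hC.le ?_ ?_ t ht htT
    · have m1 : 1 ∈ Icc 1 T := mem_Icc.2 ⟨le_rfl, ht.trans htT⟩
      refine (integral_mono (hηi 1 m1) (integrable_const R) (hηR 1 m1)).trans ?_
      have := hc.recursion_nonneg
      simp only [integral_const, probReal_univ, one_smul]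
      linarith
    · intro t ht htT
      have m0 : t ∈ Icc 1 T := mem_Icc.2 ⟨ht, by omega⟩
      have m1 : t + 1 ∈ Icc 1 T := mem_Icc.2 ⟨by omega, htT⟩
      obtain ⟨ix, bx⟩ := hex t m0
      obtain ⟨iy, bY⟩ := hey t m0
      have hp : ∀ ω, η (t + 1) ω ≤ (1 - 1 / Real.sqrt t) * η t ω
          + 1 / Real.sqrt t * (c.DX * ‖(g t ω).1 - avg gx t (z t ω).1 (z t ω).2‖
            + c.DY * ‖(g t ω).2 - avg gy t (z t ω).1 (z t ω).2‖) + c.recursion / t := fun ω => by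
        simp only [hη]
        rw [hstep t ω ht]
        exact h.dualityGap_step ht htT (hz t ω) (hs t ω) (hmin t ω)
      have i1 := (hηi t m0).const_mul (1 - 1 / Real.sqrt t)
      have i2 := ((ix.const_mul c.DX).add (iy.const_mul c.DY)).const_mul (1 / Real.sqrt t)
      refine (integral_mono (hηi _ m1) ((i1.add i2).add (integrable_const _)) hp).trans ?_
      have e1 := integral_add (i1.add i2) (integrable_const (μ := Q) (c.recursion / t))
      have e2 := integral_add i1 i2
      have e3 := integral_add (ix.const_mul c.DX) (iy.const_mul c.DY)
      simp only [Pi.add_apply] at e1 e2 e3 ⊢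
      rw [e1, e2, integral_const_mul, integral_const_mul, e3, integral_const_mul,
        integral_const_mul]
      simp only [integral_const, probReal_univ, one_smul]
      have ht0 : (0 : ℝ) < t := by exact_mod_cast ht
      have hs0 : 0 < Real.sqrt t := Real.sqrt_pos.2 ht0
      have hx := mul_le_mul_of_nonneg_left bx hc.DX
      have hy := mul_le_mul_of_nonneg_left bY hc.DY
      have := mul_le_mul_of_nonneg_left (add_le_add hx hy) (by positivity : 0 ≤ 1 / Real.sqrt t)
      have e4 : 1 / Real.sqrt t * (c.DX * (B / Real.sqrt t) + c.DY * (B / Real.sqrt t))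
          = (c.DX + c.DY) * B / t := by
        have e : (c.DX + c.DY) * B / t = (c.DX + c.DY) * B / (Real.sqrt t * Real.sqrt t) := by
          rw [Real.mul_self_sqrt ht0.le]
        rw [e]
        field_simp
      have e5 : C / t = c.recursion / t + (c.DX + c.DY) * B / t + (R + 1) / t := by
        rw [hCdef]; ring
      have : 0 ≤ (R + 1) / (t : ℝ) := by positivity
      linarith
  set κ := Real.sqrt (2 * C) with hκ
  have hκ0 : 0 < κ := Real.sqrt_pos.2 (by linarith)
  have hsq : ∀ t ∈ Icc 1 T, ∫ ω, Real.sqrt (η t ω) ∂Q ≤ κ * (t : ℝ) ^ (-(1 / 4) : ℝ) := by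
    intro t ht
    have ht' := mem_Icc.1 ht
    have ht0 : (0 : ℝ) < t := by exact_mod_cast ht'.1
    set r := κ * (t : ℝ) ^ (-(1 / 4) : ℝ) with hr
    have hr0 : 0 < r := by positivity
    have hr2 : r ^ 2 = 2 * C / Real.sqrt t := by
      rw [hr, mul_pow, hκ, Real.sq_sqrt (by linarith), ← Real.rpow_natCast, ← Real.rpow_mul ht0.le,
        Real.sqrt_eq_rpow, div_eq_mul_inv (2 * C), ← Real.rpow_neg ht0.le]
      norm_num
    have hp : ∀ ω, Real.sqrt (η t ω) ≤ 1 / (2 * r) * η t ω + r / 2 := by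
      intro ω
      have h1 := Real.sq_sqrt (hη0 t ht ω)
      have e : 1 / (2 * r) * η t ω + r / 2 = (η t ω + r ^ 2) / (2 * r) := by field_simp
      rw [e, le_div_iff₀ (by positivity)]
      nlinarith [sq_nonneg (Real.sqrt (η t ω) - r)]
    have i1 := (hηi t ht).const_mul (1 / (2 * r))
    refine (integral_mono (hηs t ht) (i1.add (integrable_const _)) hp).trans ?_
    have e1 := integral_add i1 (integrable_const (μ := Q) (r / 2))
    simp only [Pi.add_apply] at e1 ⊢
    rw [e1, integral_const_mul]
    simp only [integral_const, probReal_univ, one_smul]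
    have h2 := mul_le_mul_of_nonneg_left ((hrec t ht'.1 ht'.2).trans_eq hr2.symm)
      (by positivity : 0 ≤ 1 / (2 * r))
    have e2 : 1 / (2 * r) * r ^ 2 = r / 2 := by field_simp
    linarith
  have hpath : ∀ ω, |∑ t ∈ Icc 1 T, f t (z t ω).1 (z t ω).2 - ∑ t ∈ Icc 1 T, f t (u T) (v T)| ≤
      ∑ t ∈ Icc 1 T, (c.valueFactor * Real.sqrt (η t ω) + (c.LX + c.LY) * c.drift / (t : ℝ)) :=
    fun ω => h.abs_regret_le fun t => hz t ω
  have hbi : ∀ t ∈ Icc 1 T, Integrable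
      (fun ω => c.valueFactor * Real.sqrt (η t ω) + (c.LX + c.LY) * c.drift / (t : ℝ)) Q :=
    fun t ht => ((hηs t ht).const_mul _).add (integrable_const _)
  have hm : Measurable (fun ω => ∑ t ∈ Icc 1 T, f t (z t ω).1 (z t ω).2
      - ∑ t ∈ Icc 1 T, f t (u T) (v T)) :=
    (Finset.measurable_sum _ fun t ht => (hf t ht).comp (hzm t ht)).sub_const _
  have hint := (integrable_finsetSum _ hbi).mono' hm.aestronglyMeasurable
    (Filter.Eventually.of_forall hpath)
  refine ⟨hint, (integral_mono hint.abs (integrable_finsetSum _ hbi) hpath).trans ?_⟩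
  rw [integral_finsetSum _ hbi]
  have hterm : ∀ t ∈ Icc 1 T,
      ∫ ω, (c.valueFactor * Real.sqrt (η t ω) + (c.LX + c.LY) * c.drift / (t : ℝ)) ∂Q ≤
        (c.valueFactor * κ + (c.LX + c.LY) * c.drift) * (t : ℝ) ^ (-(1 / 4) : ℝ) := by
    intro t ht
    have ht1 : (1 : ℝ) ≤ t := by exact_mod_cast (mem_Icc.1 ht).1
    rw [integral_add ((hηs t ht).const_mul _) (integrable_const _), integral_const_mul]
    simp only [integral_const, probReal_univ, one_smul]
    have h1 := mul_le_mul_of_nonneg_left (hsq t ht) hc.valueFactor_nonneg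
    have h2 : (t : ℝ)⁻¹ ≤ (t : ℝ) ^ (-(1 / 4) : ℝ) := by
      rw [← Real.rpow_neg_one]
      exact Real.rpow_le_rpow_of_exponent_le ht1 (by norm_num)
    have h3 := mul_le_mul_of_nonneg_left h2
      (mul_nonneg (add_nonneg hc.LX hc.LY) hc.drift_nonneg)
    rw [div_eq_mul_inv]
    linarith
  refine (Finset.sum_le_sum hterm).trans ?_
  rw [← Finset.mul_sum]
  have hK : 0 ≤ c.valueFactor * κ + (c.LX + c.LY) * c.drift :=
    add_nonneg (mul_nonneg hc.valueFactor_nonneg hκ0.le)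
      (mul_nonneg (add_nonneg hc.LX hc.LY) hc.drift_nonneg)
  refine (mul_le_mul_of_nonneg_left (sum_rpow_neg_le T) hK).trans_eq ?_
  unfold Constants.regretBound
  ring

end

section

lemma measurable_euclidean {α : Type*} [MeasurableSpace α] {d : ℕ} {g : α → E d}
    (h : ∀ i, Measurable fun a => g a i) : Measurable g := by
  have : g = fun a => WithLp.toLp 2 (fun i => g a i) := rfl
  rw [this]
  exact (WithLp.measurable_toLp 2 _).comp (measurable_pi_lambda _ h)

/-- Joint measurability of a parametric gradient. -/
lemma measurable_gradient_param {α : Type*} [MeasurableSpace α] {d : ℕ} {φ : α → E d → ℝ}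
    (hm : Measurable fun p : E d × α => φ p.2 p.1) (hd : ∀ a, Differentiable ℝ (φ a)) :
    Measurable fun p : E d × α => gradient (φ p.2) p.1 := by
  refine measurable_euclidean fun i => ?_
  have hlim : ∀ p : E d × α, Filter.Tendsto (fun n : ℕ => ((n : ℝ) + 1) *
      (φ p.2 (p.1 + ((n : ℝ) + 1)⁻¹ • EuclideanSpace.single i 1) - φ p.2 p.1)) Filter.atTop
      (nhds (gradient (φ p.2) p.1 i)) := by
    intro p
    have h1 := (HasGradientAt.hasDerivAt_line ((hd p.2) p.1).hasGradientAt
      (EuclideanSpace.single i (1 : ℝ))).tendsto_slope_zero_right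
    have h2 : Filter.Tendsto (fun n : ℕ => ((n : ℝ) + 1)⁻¹) Filter.atTop
        (nhdsWithin 0 (Set.Ioi 0)) := by
      refine tendsto_nhdsWithin_iff.2 ⟨?_, Filter.Eventually.of_forall fun n => ?_⟩
      · simpa [one_div] using tendsto_one_div_add_atTop_nhds_zero_nat (𝕜 := ℝ)
      · exact Set.mem_Ioi.2 (by positivity)
    have h3 := h1.comp h2
    have e : inner ℝ (gradient (φ p.2) p.1) (EuclideanSpace.single i (1 : ℝ))
        = gradient (φ p.2) p.1 i := by
      rw [EuclideanSpace.inner_single_right]; simp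
    rw [e] at h3
    refine h3.congr fun n => ?_
    simp
  refine measurable_of_tendsto_metrizable (fun n => ?_) (tendsto_pi_nhds.2 hlim)
  have : Measurable fun p : E d × α =>
      (p.1 + ((n : ℝ) + 1)⁻¹ • (EuclideanSpace.single i 1 : E d), p.2) := by fun_prop
  exact ((hm.comp this).sub hm).const_mul _

/-- A Lipschitz bound on a convex set with interior points bounds the gradient on the set. -/
lemma norm_gradient_le {d : ℕ} {φ : E d → ℝ} {S : Set (E d)} {L : ℝ} (hL : 0 ≤ L)
    (hφ : ContDiff ℝ 1 φ) (hS : Convex ℝ S) (hne : (interior S).Nonempty)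
    (hlip : ∀ x₁ ∈ S, ∀ x₂ ∈ S, |φ x₁ - φ x₂| ≤ L * ‖x₁ - x₂‖) {x : E d} (hx : x ∈ S) :
    ‖gradient φ x‖ ≤ L := by
  have hg : ∀ x, ‖gradient φ x‖ = ‖fderiv ℝ φ x‖ := fun x => by
    rw [gradient, LinearIsometryEquiv.norm_map]
  have hint : ∀ x ∈ interior S, ‖fderiv ℝ φ x‖ ≤ L := by
    intro x hx
    refine norm_fderiv_le_of_lip' ℝ hL ?_
    filter_upwards [mem_interior_iff_mem_nhds.1 hx] with y hy
    exact hlip y hy x (interior_subset hx)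
  have hcl : IsClosed {x | ‖fderiv ℝ φ x‖ ≤ L} :=
    isClosed_le (hφ.continuous_fderiv one_ne_zero).norm continuous_const
  have : x ∈ closure (interior S) := by
    rw [hS.closure_interior_eq_closure_of_nonempty_interior hne]; exact subset_closure hx
  rw [hg]
  exact closure_minimal hint hcl this

variable {dX dY : ℕ} {Ξ : Type*} [MeasurableSpace Ξ] {c : Constants} {σ : ℝ} {X A : Set (E dX)}
  {Y B : Set (E dY)} {P : Measure Ξ} [IsProbabilityMeasure P]

lemma measurable_mean {F : E dX → E dY → Ξ → ℝ}
    (h : Measurable (fun p : E dX × E dY × Ξ => F p.1 p.2.1 p.2.2)) :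
    Measurable fun z : E dX × E dY => mean P F z.1 z.2 := by
  have h1 : Measurable fun p : (E dX × E dY) × Ξ => F p.1.1 p.1.2 p.2 :=
    h.comp (by fun_prop : Measurable fun p : (E dX × E dY) × Ξ => (p.1.1, p.1.2, p.2))
  exact (h1.stronglyMeasurable.integral_prod_right' (ν := P)).measurable

lemma measurable_gradX {F : E dX → E dY → Ξ → ℝ}
    (h : Measurable (fun p : E dX × E dY × Ξ => F p.1 p.2.1 p.2.2))
    (hd : ∀ y ξ, ContDiff ℝ 1 fun x => F x y ξ) :
    Measurable fun p : (E dX × E dY) × Ξ => gradX F p.1.1 p.1.2 p.2 := by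
  have h1 := measurable_gradient_param (φ := fun a : E dY × Ξ => fun x => F x a.1 a.2) h
    fun a => (hd a.1 a.2).differentiable one_ne_zero
  exact h1.comp (by fun_prop : Measurable fun p : (E dX × E dY) × Ξ => (p.1.1, p.1.2, p.2))

lemma measurable_gradY {F : E dX → E dY → Ξ → ℝ}
    (h : Measurable (fun p : E dX × E dY × Ξ => F p.1 p.2.1 p.2.2))
    (hd : ∀ x ξ, ContDiff ℝ 1 fun y => F x y ξ) :
    Measurable fun p : (E dX × E dY) × Ξ => gradY F p.1.1 p.1.2 p.2 := by
  have h1 := measurable_gradient_param (φ := fun a : E dX × Ξ => fun y => F a.1 y a.2)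
    (h.comp (by fun_prop : Measurable fun p : E dY × E dX × Ξ => (p.2.1, p.1, p.2.2)))
    fun a => (hd a.1 a.2).differentiable one_ne_zero
  exact h1.comp (by fun_prop : Measurable fun p : (E dX × E dY) × Ξ => (p.1.2, p.1.1, p.2))

/-- The mean of the partial gradient in `x`. -/
def meanGradX (P : Measure Ξ) (F : E dX → E dY → Ξ → ℝ) (x : E dX) (y : E dY) : E dX :=
  ∫ ξ, gradX F x y ξ ∂P

/-- The mean of the partial gradient in `y`. -/
def meanGradY (P : Measure Ξ) (F : E dX → E dY → Ξ → ℝ) (x : E dX) (y : E dY) : E dY :=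
  ∫ ξ, gradY F x y ξ ∂P

lemma norm_integral_sub_le {V : Type*} [NormedAddCommGroup V] [NormedSpace ℝ V] {a b : Ξ → V}
    {r : ℝ} (ha : Integrable a P) (hb : Integrable b P) (h : ∀ᵐ ξ ∂P, ‖a ξ - b ξ‖ ≤ r) :
    ‖∫ ξ, a ξ ∂P - ∫ ξ, b ξ ∂P‖ ≤ r := by
  rw [← integral_sub ha hb]
  simpa using norm_integral_le_of_norm_le_const h

/-- The mean of a stochastic function is a smooth saddle function. -/
lemma smoothSaddle_mean {F : E dX → E dY → Ξ → ℝ} (hX : Convex ℝ X) (hY : Convex ℝ Y) (hA : X ⊆ A)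
    (hB : Y ⊆ B) (hs : StronglyConvexConcave c.muX c.muY X Y F)
    (hl : LipschitzFunction c.LX c.LY X Y P F) (hc : LipschitzCrossGradient c.LXY c.LYX X Y P F)
    (ho : StochasticOracle σ X Y P F) (hg : LipschitzGradient c.LGX c.LGY X A Y B P F) :
    SmoothSaddle c X Y (mean P F) (meanGradX P F) (meanGradY P F) where
  convex y hy := by
    refine ⟨hX, fun x₁ h₁ x₂ h₂ a b ha hb hab => ?_⟩
    have i1 := (ho.integrable x₁ y).const_mul a
    have i2 := (ho.integrable x₂ y).const_mul b
    have := integral_mono (ho.integrable (a • x₁ + b • x₂) y)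
      ((i1.add i2).sub (integrable_const (a * b * (c.muX / 2 * ‖x₁ - x₂‖ ^ 2))))
      (fun ξ => (hs.strongConvex y hy ξ).2 h₁ h₂ ha hb hab)
    refine this.trans_eq ?_
    rw [integral_sub' (i1.add i2) (integrable_const _), integral_add' i1 i2, integral_const_mul,
      integral_const_mul]
    simp [mean]
  concave x hx := by
    refine ⟨hY, fun y₁ h₁ y₂ h₂ a b ha hb hab => ?_⟩
    have i1 := (ho.integrable x y₁).const_mul a
    have i2 := (ho.integrable x y₂).const_mul b
    have := integral_mono
      ((i1.add i2).add (integrable_const (a * b * (c.muY / 2 * ‖y₁ - y₂‖ ^ 2))))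
      (ho.integrable x (a • y₁ + b • y₂)) (fun ξ => (hs.strongConcave x hx ξ).2 h₁ h₂ ha hb hab)
    refine Eq.trans_le ?_ this
    rw [integral_add' (i1.add i2) (integrable_const _), integral_add' i1 i2, integral_const_mul,
      integral_const_mul]
    simp [mean]
  lip_x x₁ h₁ x₂ h₂ y hy := norm_integral_sub_le (V := ℝ) (ho.integrable x₁ y) (ho.integrable x₂ y)
    (hl.mono fun ξ h => h.1 x₁ h₁ x₂ h₂ y hy)
  lip_y x hx y₁ h₁ y₂ h₂ := norm_integral_sub_le (V := ℝ) (ho.integrable x y₁) (ho.integrable x y₂)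
    (hl.mono fun ξ h => h.2 x hx y₁ h₁ y₂ h₂)
  grad_x := ho.unbiased_x
  grad_y := ho.unbiased_y
  lip_gx x₁ h₁ x₂ h₂ y hy := norm_integral_sub_le (ho.integrable_gradX x₁ h₁ y hy)
    (ho.integrable_gradX x₂ h₂ y hy) (hg.mono fun ξ h => h.1 x₁ (hA h₁) x₂ (hA h₂) y hy)
  lip_gy x hx y₁ h₁ y₂ h₂ := norm_integral_sub_le (ho.integrable_gradY x hx y₁ h₁)
    (ho.integrable_gradY x hx y₂ h₂) (hg.mono fun ξ h => h.2 x hx y₁ (hB h₁) y₂ (hB h₂))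
  cross_x x hx y₁ h₁ y₂ h₂ := norm_integral_sub_le (ho.integrable_gradX x hx y₁ h₁)
    (ho.integrable_gradX x hx y₂ h₂) (hc.mono fun ξ h => h.1 x hx y₁ h₁ y₂ h₂)
  cross_y x₁ h₁ x₂ h₂ y hy := norm_integral_sub_le (ho.integrable_gradY x₁ h₁ y hy)
    (ho.integrable_gradY x₂ h₂ y hy) (hc.mono fun ξ h => h.2 x₁ h₁ x₂ h₂ y hy)

end

section

section Concentration

variable {Ω : Type*} [MeasurableSpace Ω] {Q : Measure Ω} [IsProbabilityMeasure Q] {d : ℕ}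

/-- The second moment of a sum of centered pairwise independent vectors. -/
lemma integral_norm_sq_sum_sub_le {ι : Type*} {s : Finset ι} {Z : ι → Ω → E d}
    (hZ : ∀ k ∈ s, MemLp (Z k) 2 Q)
    (hind : Set.Pairwise (s : Set ι) fun j k => IndepFun (Z j) (Z k) Q) :
    ∫ ω, ‖∑ k ∈ s, (Z k ω - ∫ ω', Z k ω' ∂Q)‖ ^ 2 ∂Q ≤ ∑ k ∈ s, ∫ ω, ‖Z k ω‖ ^ 2 ∂Q := by
  have hc : ∀ k ∈ s, ∀ i, MemLp (fun ω => Z k ω i) 2 Q := fun k hk i =>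
    (EuclideanSpace.proj (𝕜 := ℝ) i).comp_memLp' (hZ k hk)
  have hi : ∀ k ∈ s, ∀ i, (∫ ω, Z k ω ∂Q) i = ∫ ω, Z k ω i ∂Q := fun k hk i =>
    ((EuclideanSpace.proj (𝕜 := ℝ) i).integral_comp_comm ((hZ k hk).integrable one_le_two)).symm
  have hsum : ∀ i, MemLp (∑ k ∈ s, fun ω => Z k ω i) 2 Q := fun i =>
    memLp_finsetSum' s fun k hk => hc k hk i
  have hcoord : ∀ i, ∀ ω, (∑ k ∈ s, (Z k ω - ∫ ω', Z k ω' ∂Q)) i =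
      (∑ k ∈ s, fun ω => Z k ω i) ω - Q[∑ k ∈ s, fun ω => Z k ω i] := fun i ω => by
    simp only [Finset.sum_apply]
    rw [integral_finsetSum _ fun k hk => (hc k hk i).integrable one_le_two,
      ← Finset.sum_sub_distrib, WithLp.ofLp_sum, Finset.sum_apply]
    refine Finset.sum_congr rfl fun k hk => ?_
    rw [← hi k hk i]
    rfl
  have hvar : ∀ i, ∫ ω, ((∑ k ∈ s, (Z k ω - ∫ ω', Z k ω' ∂Q)) i) ^ 2 ∂Q =
      ∑ k ∈ s, Var[fun ω => Z k ω i; Q] := fun i => by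
    simp only [hcoord i]
    rw [← variance_eq_integral (hsum i).aemeasurable]
    exact IndepFun.variance_sum (fun k hk => hc k hk i) fun j hj k hk hjk =>
      (hind hj hk hjk).comp (EuclideanSpace.proj (𝕜 := ℝ) i).continuous.measurable
        (EuclideanSpace.proj (𝕜 := ℝ) i).continuous.measurable
  have hint : ∀ i, Integrable (fun ω => ((∑ k ∈ s, (Z k ω - ∫ ω', Z k ω' ∂Q)) i) ^ 2) Q :=
    fun i => by
      simp only [hcoord i]
      exact ((hsum i).sub (memLp_const _)).integrable_sq
  simp only [EuclideanSpace.real_norm_sq_eq]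
  rw [integral_finsetSum _ fun i _ => hint i]
  have : ∀ k ∈ s, ∫ ω, ∑ i, Z k ω i ^ 2 ∂Q = ∑ i, ∫ ω, Z k ω i ^ 2 ∂Q := fun k hk =>
    integral_finsetSum _ fun i _ => (hc k hk i).integrable_sq
  rw [Finset.sum_congr rfl this, Finset.sum_comm]
  refine Finset.sum_le_sum fun i _ => ?_
  rw [hvar i]
  exact Finset.sum_le_sum fun k hk => variance_le_expectation_sq (hc k hk i).aestronglyMeasurable

lemma integral_norm_le_sqrt {Z : Ω → E d} (hZ : MemLp Z 2 Q) :
    ∫ ω, ‖Z ω‖ ∂Q ≤ Real.sqrt (∫ ω, ‖Z ω‖ ^ 2 ∂Q) := by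
  apply Real.le_sqrt_of_sq_le
  have h1 := variance_eq_sub hZ.norm
  have h2 := variance_nonneg (fun ω => ‖Z ω‖) Q
  simp only [Pi.pow_apply] at h1
  linarith

/-- Mean error of the average of independent biased estimates. -/
lemma integral_norm_average_sub_le {ι : Type*} {s : Finset ι} {Z : ι → Ω → E d} {a : ι → E d}
    {b V N : ℝ} (hN : (s.card : ℝ) = N) (hN0 : 0 < N) (hZ : ∀ k ∈ s, MemLp (Z k) 2 Q)
    (hind : Set.Pairwise (s : Set ι) fun j k => IndepFun (Z j) (Z k) Q)
    (hV : ∀ k ∈ s, ∫ ω, ‖Z k ω‖ ^ 2 ∂Q ≤ V) (hb : ∀ k ∈ s, ‖∫ ω, Z k ω ∂Q - a k‖ ≤ b) :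
    Integrable (fun ω => ‖(1 / N) • ∑ k ∈ s, Z k ω - (1 / N) • ∑ k ∈ s, a k‖) Q ∧
    ∫ ω, ‖(1 / N) • ∑ k ∈ s, Z k ω - (1 / N) • ∑ k ∈ s, a k‖ ∂Q ≤ b + Real.sqrt (V / N) := by
  have hsum : MemLp (fun ω => ∑ k ∈ s, (Z k ω - ∫ ω', Z k ω' ∂Q)) 2 Q :=
    memLp_finsetSum s fun k hk => (hZ k hk).sub (memLp_const _)
  have hbias : ‖(1 / N) • ∑ k ∈ s, (∫ ω, Z k ω ∂Q - a k)‖ ≤ b := norm_average_le hN hN0 hb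
  have hpt : ∀ ω, ‖(1 / N) • ∑ k ∈ s, Z k ω - (1 / N) • ∑ k ∈ s, a k‖ ≤
      b + 1 / N * ‖∑ k ∈ s, (Z k ω - ∫ ω', Z k ω' ∂Q)‖ := by
    intro ω
    have e : (1 / N) • ∑ k ∈ s, Z k ω - (1 / N) • ∑ k ∈ s, a k =
        (1 / N) • ∑ k ∈ s, (∫ ω, Z k ω ∂Q - a k)
          + (1 / N) • ∑ k ∈ s, (Z k ω - ∫ ω', Z k ω' ∂Q) := by
      simp only [Finset.sum_sub_distrib]
      module
    rw [e]
    refine (norm_add_le _ _).trans (add_le_add hbias ?_)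
    rw [norm_smul, Real.norm_eq_abs, abs_of_pos (by positivity)]
  have hint2 := (integrable_const b).add ((hsum.integrable one_le_two).norm.const_mul (1 / N))
  have hmeas : AEStronglyMeasurable
      (fun ω => ‖(1 / N) • ∑ k ∈ s, Z k ω - (1 / N) • ∑ k ∈ s, a k‖) Q :=
    (((memLp_finsetSum s hZ).const_smul (1 / N)).sub (memLp_const _)).aestronglyMeasurable.norm
  have hint := hint2.mono' hmeas (Filter.Eventually.of_forall fun ω => by
    rw [norm_norm]; exact hpt ω)
  refine ⟨hint, (integral_mono hint hint2 hpt).trans ?_⟩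
  rw [integral_add' (integrable_const b) ((hsum.integrable one_le_two).norm.const_mul (1 / N)),
    integral_const_mul]
  simp only [integral_const, probReal_univ, one_smul]
  refine add_le_add le_rfl ?_
  have h1 := integral_norm_le_sqrt hsum
  have h2 := (integral_norm_sq_sum_sub_le hZ hind).trans (Finset.sum_le_sum hV)
  rw [Finset.sum_const, nsmul_eq_mul, hN] at h2
  have h3 := mul_le_mul_of_nonneg_left (h1.trans (Real.sqrt_le_sqrt h2))
    (by positivity : 0 ≤ 1 / N)
  refine h3.trans_eq ?_
  have e : V / N = (1 / N) ^ 2 * (N * V) := by field_simp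
  rw [e, Real.sqrt_mul (by positivity : 0 ≤ (1 / N) ^ 2) (N * V), Real.sqrt_sq (by positivity)]

/-- Conditioning on an independent variable: a bound on the expectation for frozen values of the
first variable is a bound on the expectation. -/
lemma integral_le_of_indepFun {α β : Type*} [MeasurableSpace α] [MeasurableSpace β]
    {z : Ω → α} {W : Ω → β} (hz : Measurable z) (hW : Measurable W) (hind : IndepFun z W Q)
    {Φ : α × β → ℝ} (hΦ : Measurable Φ) (h0 : ∀ p, 0 ≤ Φ p) {b : ℝ} (hb : 0 ≤ b) {S : Set α}
    (hS : ∀ ω, z ω ∈ S)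
    (h : ∀ a ∈ S, Integrable (fun ω => Φ (a, W ω)) Q ∧ ∫ ω, Φ (a, W ω) ∂Q ≤ b) :
    Integrable (fun ω => Φ (z ω, W ω)) Q ∧ ∫ ω, Φ (z ω, W ω) ∂Q ≤ b := by
  have hm : Measurable fun p => ENNReal.ofReal (Φ p) := hΦ.ennreal_ofReal
  have hle : ∫⁻ ω, ENNReal.ofReal (Φ (z ω, W ω)) ∂Q ≤ ENNReal.ofReal b := by
    have e := lintegral_map (μ := Q) hm (hz.prodMk hW)
    rw [← e, (indepFun_iff_map_prod_eq_prod_map_map hz.aemeasurable hW.aemeasurable).1 hind,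
      lintegral_prod _ hm.aemeasurable, lintegral_map (by fun_prop) hz]
    calc _ ≤ ∫⁻ _, ENNReal.ofReal b ∂Q := by
          refine lintegral_mono fun ω => ?_
          rw [lintegral_map (by fun_prop) hW]
          obtain ⟨h1, h2⟩ := h (z ω) (hS ω)
          rw [← ofReal_integral_eq_lintegral_ofReal h1
            (Filter.Eventually.of_forall fun ω' => h0 _)]
          exact ENNReal.ofReal_le_ofReal h2
      _ = ENNReal.ofReal b := by simp
  have hmeas : Measurable fun ω => Φ (z ω, W ω) := hΦ.comp (hz.prodMk hW)
  have hint : Integrable (fun ω => Φ (z ω, W ω)) Q := by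
    refine ⟨hmeas.aestronglyMeasurable, ?_⟩
    rw [hasFiniteIntegral_iff_ofReal (Filter.Eventually.of_forall fun ω => h0 _)]
    exact hle.trans_lt ENNReal.ofReal_lt_top
  refine ⟨hint, ?_⟩
  rw [← ENNReal.ofReal_le_ofReal_iff hb,
    ofReal_integral_eq_lintegral_ofReal hint (Filter.Eventually.of_forall fun ω => h0 _)]
  exact hle

end Concentration

section Sampling

variable {dX dY d : ℕ} {α : Type*}

/-- The average of a stochastic map over the batch of round `t`. -/
def sampleMean {ζ : Type*} (h : ℕ → ζ → α → E d) (t m : ℕ) (z : ζ) (w : ℕ → ℕ → α) : E d :=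
  (1 / ((t : ℝ) * (m : ℝ))) • ∑ p ∈ batch t m, h p.1 z (w p.1 p.2)

lemma avg_eq_batch (g : ℕ → E dX → E dY → E d) {t m : ℕ} (hm : 0 < m) (x : E dX)
    (y : E dY) : avg g t x y = (1 / ((t : ℝ) * (m : ℝ))) • ∑ p ∈ batch t m, g p.1 x y := by
  have : (m : ℝ) ≠ 0 := by positivity
  rw [avg, batch, Finset.sum_product]
  simp only [Finset.sum_const, Nat.card_Icc, add_tsub_cancel_right]
  rw [← Finset.smul_sum, ← Nat.cast_smul_eq_nsmul ℝ, smul_smul]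
  congr 1
  by_cases ht : (t : ℝ) = 0
  · simp [ht]
  · field_simp

variable [MeasurableSpace α]

/-- In round `t`, the stochastic maps `h i` estimate the maps `g i`, `i ≤ t`, on the set `S` with bias
at most `b` and second moment at most `V`. -/
structure BiasedOracle (κ : Measure α) (S : Set (E dX × E dY)) (t : ℕ)
    (h : ℕ → E dX × E dY → α → E d) (g : ℕ → E dX → E dY → E d) (b V : ℝ) : Prop where
  measurable : ∀ i ∈ Icc 1 t, Measurable fun p : (E dX × E dY) × α => h i p.1 p.2
  measurable_target : ∀ i ∈ Icc 1 t, Measurable fun z : E dX × E dY => g i z.1 z.2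
  memLp : ∀ i ∈ Icc 1 t, ∀ z ∈ S, MemLp (h i z) 2 κ
  second_moment : ∀ i ∈ Icc 1 t, ∀ z ∈ S, ∫ w, ‖h i z w‖ ^ 2 ∂κ ≤ V
  bias : ∀ i ∈ Icc 1 t, ∀ z ∈ S, ‖∫ w, h i z w ∂κ - g i z.1 z.2‖ ≤ b

lemma measurable_sampleMean {ζ : Type*} [MeasurableSpace ζ] {h : ℕ → ζ → α → E d} {t m : ℕ}
    (hm : ∀ i ∈ Icc 1 t, Measurable fun p : ζ × α => h i p.1 p.2) :
    Measurable fun p : ζ × (ℕ → ℕ → α) => sampleMean h t m p.1 p.2 := by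
  have h0 : Measurable fun p : ζ × (ℕ → ℕ → α) =>
      ∑ q ∈ batch t m, h q.1 p.1 (p.2 q.1 q.2) := by
    refine Finset.measurable_sum _ fun q hq => ?_
    have h1 : Measurable fun p : ζ × (ℕ → ℕ → α) => (p.1, p.2 q.1 q.2) :=
      measurable_fst.prodMk
        ((measurable_pi_apply q.2).comp ((measurable_pi_apply q.1).comp measurable_snd))
    exact (hm q.1 (Finset.mem_product.1 hq).1).comp h1
  have h2 := h0.const_smul (1 / ((t : ℝ) * (m : ℝ)))
  exact h2

lemma measurable_samples {Ω : Type*} {mΩ : MeasurableSpace Ω} {W : ℕ → ℕ → Ω → α}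
    (h : ∀ i j, Measurable (W i j)) : Measurable fun ω i j => W i j ω :=
  measurable_pi_lambda _ fun i => measurable_pi_lambda _ fun j => h i j

variable {Ω : Type*} [MeasurableSpace Ω] {Q : Measure Ω} [IsProbabilityMeasure Q]

/-- Mean error of the batch average at a point that is independent of the samples of the round. -/
lemma BiasedOracle.integral_error_le {κ : Measure α} {S : Set (E dX × E dY)} {t m : ℕ}
    {h : ℕ → E dX × E dY → α → E d} {g : ℕ → E dX → E dY → E d} {b V : ℝ}
    (ho : BiasedOracle κ S t h g b V) (ht : 0 < t) (hm : 0 < m) {W : ℕ → ℕ → ℕ → Ω → α}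
    (hW : IsIID W κ Q) {z : Ω → E dX × E dY} (hz : Measurable z) (hzS : ∀ ω, z ω ∈ S)
    (hind : IndepFun z (fun ω i j => W t i j ω) Q) :
    Integrable (fun ω => ‖sampleMean h t m (z ω) (fun i j => W t i j ω)
      - avg g t (z ω).1 (z ω).2‖) Q ∧
    ∫ ω, ‖sampleMean h t m (z ω) (fun i j => W t i j ω) - avg g t (z ω).1 (z ω).2‖ ∂Q ≤
      b + Real.sqrt (V / (t * m)) := by
  obtain ⟨hWm, hWκ, hWi⟩ := hW
  have hWm' : Measurable fun ω i j => W t i j ω := measurable_samples (hWm t)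
  have hpt : ∀ a ∈ S, Integrable (fun ω => ‖sampleMean h t m a (fun i j => W t i j ω)
      - avg g t a.1 a.2‖) Q ∧
      ∫ ω, ‖sampleMean h t m a (fun i j => W t i j ω) - avg g t a.1 a.2‖ ∂Q ≤
        b + Real.sqrt (V / (t * m)) := by
    intro a ha
    have hmem : ∀ p ∈ batch t m, p.1 ∈ Icc 1 t := fun p hp => (Finset.mem_product.1 hp).1
    have hma : ∀ p ∈ batch t m, Measurable (h p.1 a) := fun p hp =>
      (ho.measurable p.1 (hmem p hp)).comp measurable_prodMk_left
    have hmp : ∀ p : ℕ × ℕ, MeasurePreserving (W t p.1 p.2) Q κ := fun p =>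
      ⟨hWm t p.1 p.2, hWκ t p.1 p.2⟩
    simp only [avg_eq_batch g hm]
    refine integral_norm_average_sub_le (s := batch t m)
      (Z := fun p ω => h p.1 a (W t p.1 p.2 ω)) (a := fun p => g p.1 a.1 a.2) ?_ ?_ ?_ ?_ ?_ ?_
    · simp [batch]
    · positivity
    · exact fun p hp => (ho.memLp p.1 (hmem p hp) a ha).comp_measurePreserving (hmp p)
    · intro p hp q hq hpq
      refine (hWi.indepFun (i := (t, p)) (j := (t, q)) ?_).comp (hma p hp) (hma q hq)
      simpa using hpq
    · intro p hp
      have := (hma p hp).norm.pow_const 2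
      have e : ∫ ω, ‖h p.1 a (W t p.1 p.2 ω)‖ ^ 2 ∂Q = ∫ w, ‖h p.1 a w‖ ^ 2 ∂κ := by
        rw [← (hmp p).map_eq,
          integral_map (hmp p).measurable.aemeasurable this.aestronglyMeasurable]
      rw [e]
      exact ho.second_moment p.1 (hmem p hp) a ha
    · intro p hp
      have e : ∫ ω, h p.1 a (W t p.1 p.2 ω) ∂Q = ∫ w, h p.1 a w ∂κ := by
        rw [← (hmp p).map_eq,
          integral_map (hmp p).measurable.aemeasurable (hma p hp).aestronglyMeasurable]
      rw [e]
      exact ho.bias p.1 (hmem p hp) a ha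
  have hΦ : Measurable fun p : (E dX × E dY) × (ℕ → ℕ → α) =>
      ‖sampleMean h t m p.1 p.2 - avg g t p.1.1 p.1.2‖ :=
    ((measurable_sampleMean ho.measurable).sub
      ((measurable_avg ho.measurable_target).comp measurable_fst)).norm
  obtain ⟨ω₀⟩ : Nonempty Ω := nonempty_of_isProbabilityMeasure Q
  have hb0 : 0 ≤ b + Real.sqrt (V / (t * m)) :=
    (integral_nonneg fun ω => norm_nonneg _).trans (hpt (z ω₀) (hzS ω₀)).2
  exact integral_le_of_indepFun hz hWm' hind hΦ (fun p => norm_nonneg _) hb0 hzS hpt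

end Sampling

section Iterates

variable {dX dY : ℕ} {X : Set (E dX)} {Y : Set (E dY)} {Ω α : Type*}

lemma fwIterate_succ {γ : ℕ → ℝ} {lmo : ℕ → E dX × E dY → E dX × E dY}
    {G : ℕ → E dX × E dY → Ω → E dX × E dY} {z₁ : E dX × E dY} {t : ℕ} (ht : 1 ≤ t) (ω : Ω) :
    fwIterate γ lmo G z₁ (t + 1) ω = (1 - γ t) • fwIterate γ lmo G z₁ t ω + γ t •
      lmo t ((G t (fwIterate γ lmo G z₁ t ω) ω).1, -(G t (fwIterate γ lmo G z₁ t ω) ω).2) := by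
  obtain ⟨t, rfl⟩ : ∃ k, t = k + 1 := ⟨t - 1, by omega⟩
  rfl

lemma fwIterate_mem {lmo : ℕ → E dX × E dY → E dX × E dY}
    {G : ℕ → E dX × E dY → Ω → E dX × E dY} {z₁ : E dX × E dY} (hX : Convex ℝ X) (hY : Convex ℝ Y)
    (hl : ∀ t, IsLMO X Y (lmo t)) (hz : z₁ ∈ X ×ˢ Y) (t : ℕ) (ω : Ω) :
    fwIterate stepSize lmo G z₁ t ω ∈ X ×ˢ Y := by
  induction t with
  | zero => exact hz
  | succ t ih =>
    rcases Nat.eq_zero_or_pos t with rfl | ht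
    · exact hz
    rw [fwIterate_succ ht]
    have hs : 1 ≤ Real.sqrt t := Real.one_le_sqrt.2 (by exact_mod_cast ht)
    have h1 : stepSize t ≤ 1 := by
      unfold stepSize
      rw [div_le_one (by linarith)]
      exact hs
    exact (hX.prod hY) ih ((hl t).mem _) (sub_nonneg.2 h1) (by unfold stepSize; positivity)
      (by ring)

/-- The iterate `z_t` is a measurable function of the samples of the rounds before `t`, for any
σ-algebra that makes these measurable. -/
lemma measurable_fwIterate [MeasurableSpace α] {mΩ : MeasurableSpace Ω} {γ : ℕ → ℝ}
    {lmo : ℕ → E dX × E dY → E dX × E dY} (hl : ∀ t, IsLMO X Y (lmo t))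
    {Γ : ℕ → (E dX × E dY) × (ℕ → ℕ → α) → E dX × E dY} {W : ℕ → ℕ → ℕ → Ω → α} {z₁ : E dX × E dY}
    (T : ℕ) (hΓ : ∀ t ∈ Icc 1 T, Measurable (Γ t)) (t : ℕ) (ht : t ≤ T)
    (hW : ∀ s < t, ∀ i j, Measurable (W s i j)) :
    Measurable (fwIterate γ lmo (fun t z ω => Γ t (z, fun i j => W t i j ω)) z₁ t) := by
  induction t with
  | zero => exact measurable_const
  | succ t ih =>
    rcases Nat.eq_zero_or_pos t with rfl | ht0
    · exact measurable_const
    have ih := ih (by omega) fun s hs => hW s (by omega)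
    have hW' : Measurable fun ω i j => W t i j ω := measurable_samples (hW t (by omega))
    have hG := (hΓ t (mem_Icc.2 ⟨ht0, by omega⟩)).comp (ih.prodMk hW')
    have := (ih.const_smul (1 - γ t)).add
      (((hl t).measurable.comp (hG.fst.prodMk hG.snd.neg)).const_smul (γ t))
    rw [show fwIterate γ lmo (fun t z ω => Γ t (z, fun i j => W t i j ω)) z₁ (t + 1) = _ from
      funext fun ω => fwIterate_succ ht0 ω]
    exact this

/-- The iterate `z_t` is independent of the samples of round `t`. -/
lemma indepFun_fwIterate [MeasurableSpace α] [MeasurableSpace Ω] {Q : Measure Ω}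
    {κ : Measure α} {γ : ℕ → ℝ}
    {lmo : ℕ → E dX × E dY → E dX × E dY} (hl : ∀ t, IsLMO X Y (lmo t))
    {Γ : ℕ → (E dX × E dY) × (ℕ → ℕ → α) → E dX × E dY} {W : ℕ → ℕ → ℕ → Ω → α} {z₁ : E dX × E dY}
    (T : ℕ) (hΓ : ∀ t ∈ Icc 1 T, Measurable (Γ t)) (hW : IsIID W κ Q) (t : ℕ) (ht : t ≤ T) :
    IndepFun (fwIterate γ lmo (fun t z ω => Γ t (z, fun i j => W t i j ω)) z₁ t)
      (fun ω i j => W t i j ω) Q := by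
  obtain ⟨hWm, -, hWi⟩ := hW
  set 𝓕 : ℕ × ℕ × ℕ → MeasurableSpace Ω := fun q =>
    MeasurableSpace.comap (W q.1 q.2.1 q.2.2) inferInstance with h𝓕
  have hle : ∀ q, 𝓕 q ≤ ‹MeasurableSpace Ω› := fun q => (hWm _ _ _).comap_le
  have hind := indep_iSup_of_disjoint (μ := Q) hle hWi
    (S := {q | q.1 < t}) (T := {q | q.1 = t}) (Set.disjoint_left.2 fun q h1 h2 => by
      simp only [Set.mem_ofPred_eq] at h1 h2; omega)
  rw [IndepFun_iff_Indep]
  refine indep_of_indep_of_le_left (indep_of_indep_of_le_right hind ?_) ?_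
  · refine Measurable.comap_le (m₁ := ⨆ q ∈ {q : ℕ × ℕ × ℕ | q.1 = t}, 𝓕 q) ?_
    refine measurable_samples fun i j => ?_
    exact measurable_iff_comap_le.2 (le_iSup₂_of_le (t, i, j) rfl le_rfl)
  · refine Measurable.comap_le (m₁ := ⨆ q ∈ {q : ℕ × ℕ × ℕ | q.1 < t}, 𝓕 q) ?_
    refine measurable_fwIterate hl T hΓ t ht fun s hs i j => ?_
    exact measurable_iff_comap_le.2 (le_iSup₂_of_le (s, i, j) hs le_rfl)

end Iterates

end

section

/-- The moments of the standard normal distribution. -/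
def normalMoment (k : ℕ) : ℝ := ∫ x, x ^ k ∂(gaussianReal 0 1)

lemma normalMoment_nonneg {k : ℕ} (hk : Even k) : 0 ≤ normalMoment k :=
  integral_nonneg fun _ => hk.pow_nonneg _

section Moments

variable {d : ℕ}

lemma integrable_norm_pow_stdGaussian (k : ℕ) :
    Integrable (fun u : E d => ‖u‖ ^ k) (stdGaussian (E d)) :=
  (IsGaussian.memLp_id (stdGaussian (E d)) k (by simp)).integrable_norm_pow'

lemma integral_inner_pow_stdGaussian (a : E d) (k : ℕ) :
    ∫ u, (inner ℝ a u) ^ k ∂(stdGaussian (E d)) = ‖a‖ ^ k * normalMoment k := by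
  have h1 := IsGaussian.map_eq_gaussianReal (μ := stdGaussian (E d)) (innerSL ℝ a)
  rw [integral_strongDual_stdGaussian, variance_dual_stdGaussian, innerSL_apply_norm] at h1
  have h2 := gaussianReal_map_const_mul (μ := 0) (v := 1) ‖a‖
  have h3 : NNReal.mk (‖a‖ ^ 2) (sq_nonneg _) * 1 = (‖a‖ ^ 2).toNNReal := by
    rw [mul_one, Real.toNNReal_of_nonneg (sq_nonneg _)]
  rw [mul_zero, h3, ← h1] at h2
  have e1 : ∫ u, (inner ℝ a u) ^ k ∂(stdGaussian (E d)) =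
      ∫ x, x ^ k ∂((stdGaussian (E d)).map (innerSL ℝ a)) := by
    rw [integral_map (by fun_prop) (by fun_prop)]
    rfl
  rw [e1, ← h2, integral_map (by fun_prop) (by fun_prop), normalMoment, ← integral_const_mul]
  simp only [mul_pow]

lemma integrable_inner_pow_stdGaussian (a : E d) (k : ℕ) :
    Integrable (fun u => (inner ℝ a u) ^ k) (stdGaussian (E d)) := by
  refine ((integrable_norm_pow_stdGaussian k).const_mul (‖a‖ ^ k)).mono' (by fun_prop)
    (Filter.Eventually.of_forall fun u => ?_)
  rw [norm_pow, ← mul_pow]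
  exact pow_le_pow_left₀ (norm_nonneg _) (norm_inner_le_norm a u) k

lemma integral_inner_smul_stdGaussian (a : E d) :
    ∫ u, (inner ℝ a u) • u ∂(stdGaussian (E d)) = a := by
  have hint : Integrable (fun u : E d => (inner ℝ a u) • u) (stdGaussian (E d)) := by
    refine ((integrable_norm_pow_stdGaussian 2).const_mul ‖a‖).mono' (by fun_prop)
      (Filter.Eventually.of_forall fun u => ?_)
    rw [norm_smul, pow_two, ← mul_assoc]
    exact mul_le_mul_of_nonneg_right (norm_inner_le_norm a u) (norm_nonneg _)
  refine ext_inner_left ℝ fun b => ?_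
  rw [← integral_inner hint]
  have h1 := congrArg (fun L => L a b) (covarianceBilin_stdGaussian (E := E d))
  change _ = inner ℝ a b at h1
  have hm : ∀ x : E d, MemLp (fun u : E d => inner ℝ x u) 2 (stdGaussian (E d)) := fun x =>
    (innerSL ℝ x).comp_memLp' (IsGaussian.memLp_two_id)
  have h0 : ∀ x : E d, ∫ u, inner ℝ x u ∂(stdGaussian (E d)) = 0 := fun x =>
    integral_strongDual_stdGaussian (innerSL ℝ x)
  rw [covarianceBilin_apply_eq_cov IsGaussian.memLp_two_id, covariance_eq_sub (hm a) (hm b)] at h1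
  rw [h0 a, zero_mul, sub_zero, real_inner_comm b a] at h1
  rw [← h1]
  refine integral_congr_ae (Filter.Eventually.of_forall fun u => ?_)
  simp [inner_smul_right]

lemma inner_single_one (u : E d) (i : Fin d) : inner ℝ (EuclideanSpace.single i (1 : ℝ)) u = u i := by
  simp [EuclideanSpace.inner_single_left]

lemma norm_pow_le_sum (u : E d) (k : ℕ) :
    ‖u‖ ^ (2 * (k + 1)) ≤ (d : ℝ) ^ k *
      ∑ i, (inner ℝ (EuclideanSpace.single i (1 : ℝ)) u) ^ (2 * (k + 1)) := by
  rcases Nat.eq_zero_or_pos d with rfl | hd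
  · have : u = 0 := Subsingleton.elim _ _
    simp [this]
  have := pow_sum_div_card_le_sum_pow (s := univ) (f := fun i => (u i) ^ 2) (n := k)
    fun i _ => sq_nonneg _
  rw [div_le_iff₀ (by simp; positivity)] at this
  simp only [inner_single_one]
  rw [pow_mul, EuclideanSpace.real_norm_sq_eq, mul_comm]
  simpa [pow_mul] using this

lemma integral_norm_pow_stdGaussian_le (k : ℕ) :
    ∫ u, ‖u‖ ^ (2 * (k + 1)) ∂(stdGaussian (E d)) ≤
      (d : ℝ) ^ (k + 1) * normalMoment (2 * (k + 1)) := by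
  refine (integral_mono (integrable_norm_pow_stdGaussian _)
    ((integrable_finsetSum univ fun i _ => integrable_inner_pow_stdGaussian
      (EuclideanSpace.single i (1 : ℝ)) (2 * (k + 1))).const_mul ((d : ℝ) ^ k))
    fun u => norm_pow_le_sum u k).trans_eq ?_
  rw [integral_const_mul, integral_finsetSum _ fun i _ => integrable_inner_pow_stdGaussian _ _]
  simp only [integral_inner_pow_stdGaussian]
  simp
  ring

lemma integral_norm_cube_stdGaussian_le :
    ∫ u, ‖u‖ ^ 3 ∂(stdGaussian (E d)) ≤ (1 + normalMoment 4) * (d * Real.sqrt d) := by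
  rcases Nat.eq_zero_or_pos d with rfl | hd
  · have : ∀ u : E 0, ‖u‖ = 0 := fun u => by rw [Subsingleton.elim u 0, norm_zero]
    simp [this]
  have hd0 : (0 : ℝ) < d := by exact_mod_cast hd
  set s := Real.sqrt d with hs
  have hs0 : 0 < s := Real.sqrt_pos.2 hd0
  have hs2 : (d : ℝ) = s ^ 2 := (Real.sq_sqrt hd0.le).symm
  have hpt : ∀ u : E d, ‖u‖ ^ 3 ≤ s ^ 3 + 1 / s * ‖u‖ ^ 4 := fun u => by
    have h0 := norm_nonneg u
    rcases le_total ‖u‖ s with h | h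
    · have : 0 ≤ 1 / s * ‖u‖ ^ 4 := by positivity
      have := pow_le_pow_left₀ h0 h 3
      linarith
    · have e : ‖u‖ ^ 3 = 1 / s * (s * ‖u‖ ^ 3) := by field_simp
      have : s * ‖u‖ ^ 3 ≤ ‖u‖ ^ 4 := by
        rw [pow_succ' _ 3]
        exact mul_le_mul_of_nonneg_right h (by positivity)
      have h3 := mul_le_mul_of_nonneg_left this (by positivity : 0 ≤ 1 / s)
      have : 0 ≤ s ^ 3 := by positivity
      linarith
  have i4 := (integrable_norm_pow_stdGaussian (d := d) 4).const_mul (1 / s)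
  refine (integral_mono (integrable_norm_pow_stdGaussian 3) ((integrable_const _).add i4)
    hpt).trans ?_
  rw [integral_add' (integrable_const _) i4, integral_const_mul]
  simp only [integral_const, probReal_univ, one_smul]
  have h4 := mul_le_mul_of_nonneg_left (integral_norm_pow_stdGaussian_le (d := d) 1)
    (by positivity : 0 ≤ 1 / s)
  simp only [Nat.reduceAdd, Nat.reduceMul] at h4
  have e : 1 / s * ((d : ℝ) ^ 2 * normalMoment 4) = s ^ 3 * normalMoment 4 := by
    rw [hs2]; field_simp
  rw [e] at h4
  rw [hs2]
  linarith

lemma integral_inner_sq_mul_norm_sq_le (a : E d) :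
    ∫ u, (inner ℝ a u) ^ 2 * ‖u‖ ^ 2 ∂(stdGaussian (E d)) ≤ d * ‖a‖ ^ 2 * normalMoment 4 := by
  by_cases ha : a = 0
  · simp [ha]
  have ha0 : 0 < ‖a‖ ^ 2 := by have := norm_pos_iff.2 ha; positivity
  have hb : ∀ u : E d, (inner ℝ a u) ^ 2 * ‖u‖ ^ 2 ≤
      ∑ i, (1 / (2 * ‖a‖ ^ 2) * (inner ℝ a u) ^ 4
        + ‖a‖ ^ 2 / 2 * (inner ℝ (EuclideanSpace.single i (1 : ℝ)) u) ^ 4) := fun u => by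
    rw [EuclideanSpace.real_norm_sq_eq, Finset.mul_sum]
    refine Finset.sum_le_sum fun i _ => ?_
    rw [inner_single_one]
    have e : 1 / (2 * ‖a‖ ^ 2) * (inner ℝ a u) ^ 4 + ‖a‖ ^ 2 / 2 * (u i) ^ 4
        - (inner ℝ a u) ^ 2 * (u i) ^ 2
        = ((inner ℝ a u) ^ 2 - ‖a‖ ^ 2 * (u i) ^ 2) ^ 2 / (2 * ‖a‖ ^ 2) := by
      field_simp; ring
    have : 0 ≤ ((inner ℝ a u) ^ 2 - ‖a‖ ^ 2 * (u i) ^ 2) ^ 2 / (2 * ‖a‖ ^ 2) := by positivity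
    linarith
  have hi : Integrable (fun u : E d => (inner ℝ a u) ^ 2 * ‖u‖ ^ 2) (stdGaussian (E d)) := by
    refine ((integrable_norm_pow_stdGaussian 4).const_mul (‖a‖ ^ 2)).mono' (by fun_prop)
      (Filter.Eventually.of_forall fun u => ?_)
    rw [norm_mul, norm_pow, norm_pow, norm_norm]
    have := pow_le_pow_left₀ (norm_nonneg _) (norm_inner_le_norm (𝕜 := ℝ) a u) 2
    have := mul_le_mul_of_nonneg_right this (sq_nonneg ‖u‖)
    refine this.trans_eq ?_
    ring
  have hs : ∀ i ∈ (univ : Finset (Fin d)), Integrable (fun u => 1 / (2 * ‖a‖ ^ 2) * (inner ℝ a u) ^ 4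
      + ‖a‖ ^ 2 / 2 * (inner ℝ (EuclideanSpace.single i (1 : ℝ)) u) ^ 4) (stdGaussian (E d)) :=
    fun i _ => ((integrable_inner_pow_stdGaussian a 4).const_mul _).add
      ((integrable_inner_pow_stdGaussian _ 4).const_mul _)
  refine (integral_mono hi (integrable_finsetSum _ hs) hb).trans_eq ?_
  rw [integral_finsetSum _ hs]
  have : ∀ i ∈ (univ : Finset (Fin d)), ∫ u, (1 / (2 * ‖a‖ ^ 2) * (inner ℝ a u) ^ 4
      + ‖a‖ ^ 2 / 2 * (inner ℝ (EuclideanSpace.single i (1 : ℝ)) u) ^ 4) ∂(stdGaussian (E d))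
      = ‖a‖ ^ 2 * normalMoment 4 := fun i _ => by
    rw [integral_add ((integrable_inner_pow_stdGaussian a 4).const_mul _)
      ((integrable_inner_pow_stdGaussian _ 4).const_mul _), integral_const_mul, integral_const_mul,
      integral_inner_pow_stdGaussian, integral_inner_pow_stdGaussian]
    simp only [PiLp.norm_single, norm_one, one_pow, one_mul]
    field_simp
    ring
  rw [Finset.sum_congr rfl this]
  simp
  ring

end Moments

end

section

section GaussianSmoothing

variable {d : ℕ} {Ξ : Type*}

/-- The two-point gradient estimate. -/
def twoPoint (φ : E d → Ξ → ℝ) (ν : ℝ) (x : E d) (w : Ξ × E d) : E d :=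
  ((φ (x + ν • w.2) w.1 - φ x w.1) / ν) • w.2

variable {φ : E d → Ξ → ℝ} {ν L LG : ℝ} {x : E d}

/-- The remainder of the two-point estimate after linearization. -/
lemma norm_twoPoint_sub_le (hν : 0 < ν) (hLG : 0 ≤ LG) {ξ : Ξ}
    (hd : Differentiable ℝ fun x => φ x ξ)
    (hlip : ∀ x₁ x₂, ‖gradient (fun x => φ x ξ) x₁ - gradient (fun x => φ x ξ) x₂‖
      ≤ LG * ‖x₁ - x₂‖) (u : E d) :
    ‖twoPoint φ ν x (ξ, u) - (inner ℝ (gradient (fun x => φ x ξ) x) u) • u‖ ≤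
      LG * ν * ‖u‖ ^ 3 := by
  have h1 := abs_linearization_le hLG convex_univ (fun x _ => (hd x).hasGradientAt)
    (fun x₁ _ x₂ _ => hlip x₁ x₂) (Set.mem_univ x) (Set.mem_univ (x + ν • u))
  rw [add_sub_cancel_left, inner_smul_right, norm_smul, Real.norm_eq_abs, abs_of_pos hν] at h1
  have e : twoPoint φ ν x (ξ, u) - (inner ℝ (gradient (fun x => φ x ξ) x) u) • u =
      ((φ (x + ν • u) ξ - φ x ξ - ν * inner ℝ (gradient (fun x => φ x ξ) x) u) / ν) • u := by
    rw [twoPoint, ← sub_smul]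
    congr 1
    field_simp
  rw [e, norm_smul, Real.norm_eq_abs, abs_div, abs_of_pos hν]
  have h2 := mul_le_mul_of_nonneg_right ((div_le_div_iff_of_pos_right hν).2 h1) (norm_nonneg u)
  refine h2.trans_eq ?_
  field_simp

variable [MeasurableSpace Ξ] {P : Measure Ξ} [IsProbabilityMeasure P]

/-- Second moment and bias of the two-point estimate with Gaussian directions. -/
lemma twoPoint_moments (hν : 0 < ν) (hLG : 0 ≤ LG)
    (hm : Measurable fun p : E d × Ξ => φ p.1 p.2) (hd : ∀ ξ, Differentiable ℝ fun x => φ x ξ)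
    (hlip : ∀ᵐ ξ ∂P, ∀ x₁ x₂, ‖gradient (fun x => φ x ξ) x₁ - gradient (fun x => φ x ξ) x₂‖
      ≤ LG * ‖x₁ - x₂‖)
    (hbd : ∀ᵐ ξ ∂P, ‖gradient (fun x => φ x ξ) x‖ ≤ L) :
    MemLp (twoPoint φ ν x) 2 (P.prod (stdGaussian (E d))) ∧
    ∫ w, ‖twoPoint φ ν x w‖ ^ 2 ∂(P.prod (stdGaussian (E d))) ≤
      2 * d * L ^ 2 * normalMoment 4 + 2 * LG ^ 2 * ν ^ 2 * (d ^ 3 * normalMoment 6) ∧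
    ‖∫ w, twoPoint φ ν x w ∂(P.prod (stdGaussian (E d)))
      - ∫ ξ, gradient (fun x => φ x ξ) x ∂P‖ ≤
      LG * ν * ((1 + normalMoment 4) * (d * Real.sqrt d)) := by
  set κ := P.prod (stdGaussian (E d)) with hκ
  set a : Ξ → E d := fun ξ => gradient (fun x => φ x ξ) x with ha
  have ham : Measurable a := (measurable_gradient_param (φ := fun ξ x => φ x ξ) hm hd).comp
    measurable_prodMk_left
  have hTm : Measurable (twoPoint φ ν x) := by
    have h1 : Measurable fun w : Ξ × E d => (x + ν • w.2, w.1) := by fun_prop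
    have h2 : Measurable fun w : Ξ × E d => (x, w.1) := by fun_prop
    exact (((hm.comp h1).sub (hm.comp h2)).div_const ν).smul measurable_snd
  have hlip' : ∀ᵐ w ∂κ, ∀ x₁ x₂, ‖gradient (fun x => φ x w.1) x₁
      - gradient (fun x => φ x w.1) x₂‖ ≤ LG * ‖x₁ - x₂‖ :=
    Measure.quasiMeasurePreserving_fst.ae hlip
  have hbd' : ∀ᵐ w ∂κ, ‖a w.1‖ ≤ L := Measure.quasiMeasurePreserving_fst.ae hbd
  have hrem : ∀ᵐ w ∂κ, ‖twoPoint φ ν x w - (inner ℝ (a w.1) w.2) • w.2‖ ≤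
      LG * ν * ‖w.2‖ ^ 3 := hlip'.mono fun w h => norm_twoPoint_sub_le hν hLG (hd w.1) h w.2
  have hpow : ∀ k, Integrable (fun w : Ξ × E d => ‖w.2‖ ^ k) κ := fun k =>
    (integrable_norm_pow_stdGaussian k).comp_snd P
  have hpowint : ∀ k, ∫ w, ‖w.2‖ ^ k ∂κ = ∫ u, ‖u‖ ^ k ∂(stdGaussian (E d)) := fun k => by
    rw [hκ, integral_fun_snd (μ := P) (ν := stdGaussian (E d)) (fun u : E d => ‖u‖ ^ k)]
    simp
  have hlin : Measurable fun w : Ξ × E d => inner ℝ (a w.1) w.2 :=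
    (ham.comp measurable_fst).inner measurable_snd
  have hlinle : ∀ᵐ w ∂κ, (inner ℝ (a w.1) w.2) ^ 2 ≤ L ^ 2 * ‖w.2‖ ^ 2 := by
    filter_upwards [hbd'] with w hw
    rw [← sq_abs, ← mul_pow]
    exact pow_le_pow_left₀ (abs_nonneg _) ((abs_real_inner_le_norm _ _).trans
      (mul_le_mul_of_nonneg_right hw (norm_nonneg _))) 2
  have hsq : ∀ᵐ w ∂κ, ‖twoPoint φ ν x w‖ ^ 2 ≤
      2 * ((inner ℝ (a w.1) w.2) ^ 2 * ‖w.2‖ ^ 2) + 2 * LG ^ 2 * ν ^ 2 * ‖w.2‖ ^ 6 := by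
    filter_upwards [hrem] with w hw
    have h1 := norm_le_norm_add_norm_sub' (twoPoint φ ν x w) ((inner ℝ (a w.1) w.2) • w.2)
    rw [norm_smul, Real.norm_eq_abs] at h1
    have h2 := pow_le_pow_left₀ (norm_nonneg _) (h1.trans (add_le_add le_rfl hw)) 2
    refine h2.trans ((add_sq_le).trans_eq ?_)
    rw [mul_pow, sq_abs]
    ring
  have hcross : Integrable (fun w : Ξ × E d => (inner ℝ (a w.1) w.2) ^ 2 * ‖w.2‖ ^ 2) κ := by
    refine ((hpow 4).const_mul (L ^ 2)).mono'
      ((hlin.pow_const 2).mul (by fun_prop)).aestronglyMeasurable ?_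
    filter_upwards [hlinle] with w hw
    rw [norm_mul, norm_pow, norm_pow, norm_norm, Real.norm_eq_abs, sq_abs]
    refine (mul_le_mul_of_nonneg_right hw (sq_nonneg _)).trans_eq ?_
    ring
  have hdom := (hcross.const_mul 2).add ((hpow 6).const_mul (2 * LG ^ 2 * ν ^ 2))
  have hsqi : Integrable (fun w => ‖twoPoint φ ν x w‖ ^ 2) κ := by
    refine hdom.mono' (hTm.norm.pow_const 2).aestronglyMeasurable ?_
    filter_upwards [hsq] with w hw
    rw [norm_pow, norm_norm]
    exact hw
  have hmem : MemLp (twoPoint φ ν x) 2 κ :=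
    (memLp_two_iff_integrable_sq_norm hTm.aestronglyMeasurable).2 hsqi
  refine ⟨hmem, ?_, ?_⟩
  · refine (integral_mono_ae hsqi hdom hsq).trans ?_
    rw [integral_add' (hcross.const_mul 2) ((hpow 6).const_mul _), integral_const_mul,
      integral_const_mul, hpowint]
    have h6 := integral_norm_pow_stdGaussian_le (d := d) 2
    simp only [Nat.reduceAdd, Nat.reduceMul] at h6
    have h6' := mul_le_mul_of_nonneg_left h6 (by positivity : 0 ≤ 2 * LG ^ 2 * ν ^ 2)
    have h4 : ∫ w, (inner ℝ (a w.1) w.2) ^ 2 * ‖w.2‖ ^ 2 ∂κ ≤ d * L ^ 2 * normalMoment 4 := by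
      rw [hκ, integral_prod _ hcross]
      have hle : ∀ᵐ ξ ∂P, ∫ u, (inner ℝ (a ξ) u) ^ 2 * ‖u‖ ^ 2 ∂(stdGaussian (E d)) ≤
          d * L ^ 2 * normalMoment 4 := by
        filter_upwards [hbd] with ξ hξ
        refine (integral_inner_sq_mul_norm_sq_le (a ξ)).trans ?_
        have := normalMoment_nonneg (k := 4) (by decide)
        gcongr
      refine (integral_mono_ae hcross.integral_prod_left (integrable_const _) hle).trans_eq ?_
      simp
    linarith
  · have hli : Integrable (fun w : Ξ × E d => (inner ℝ (a w.1) w.2) • w.2) κ := by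
      refine ((hpow 2).const_mul L).mono' (hlin.smul measurable_snd).aestronglyMeasurable ?_
      filter_upwards [hbd'] with w hw
      rw [norm_smul, pow_two, ← mul_assoc]
      exact mul_le_mul_of_nonneg_right ((abs_real_inner_le_norm _ _).trans
        (mul_le_mul_of_nonneg_right hw (norm_nonneg _))) (norm_nonneg _)
    have e : ∫ w, (inner ℝ (a w.1) w.2) • w.2 ∂κ = ∫ ξ, a ξ ∂P := by
      rw [hκ, integral_prod _ hli]
      simp only [integral_inner_smul_stdGaussian]
    rw [← e, ← integral_sub (hmem.integrable one_le_two) hli]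
    refine (norm_integral_le_of_norm_le ((hpow 3).const_mul (LG * ν)) hrem).trans ?_
    rw [integral_const_mul, hpowint]
    exact mul_le_mul_of_nonneg_left integral_norm_cube_stdGaussian_le (by positivity)

end GaussianSmoothing

lemma smoothing_pos (d t : ℕ) (ht : 1 ≤ t) : 0 < smoothing d t := by
  have : (0 : ℝ) < t := by exact_mod_cast ht
  unfold smoothing
  positivity

lemma smoothing_mul_le (d t : ℕ) (ht : 1 ≤ t) :
    smoothing d t * (d * Real.sqrt d) ≤ Real.sqrt 2 / Real.sqrt t := by
  have ht0 : 0 < Real.sqrt t := Real.sqrt_pos.2 (by exact_mod_cast ht)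
  have hd : (0 : ℝ) ≤ d := by positivity
  have h1 : (d : ℝ) * Real.sqrt d ≤ ((d : ℝ) + 3) ^ (3 / 2 : ℝ) := by
    have e : ((d : ℝ) + 3) ^ (3 / 2 : ℝ) = ((d : ℝ) + 3) * Real.sqrt ((d : ℝ) + 3) := by
      rw [Real.sqrt_eq_rpow, ← Real.rpow_one_add' (by positivity) (by norm_num)]
      norm_num
    rw [e]
    exact mul_le_mul (by linarith) (Real.sqrt_le_sqrt (by linarith)) (Real.sqrt_nonneg _)
      (by linarith)
  have h2 : (0 : ℝ) < ((d : ℝ) + 3) ^ (3 / 2 : ℝ) := by positivity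
  have e : smoothing d t = Real.sqrt 2 / Real.sqrt t / ((d : ℝ) + 3) ^ (3 / 2 : ℝ) := by
    unfold smoothing; field_simp
  rw [e, div_mul_eq_mul_div, div_le_iff₀ h2]
  exact mul_le_mul_of_nonneg_left h1 (by positivity)

lemma smoothing_sq_mul_le (d t : ℕ) (ht : 1 ≤ t) : smoothing d t ^ 2 * (d : ℝ) ^ 3 ≤ 2 := by
  have h := pow_le_pow_left₀ (mul_nonneg (smoothing_pos d t ht).le (by positivity))
    (smoothing_mul_le d t ht) 2
  have ht1 : (1 : ℝ) ≤ t := by exact_mod_cast ht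
  have hd : (0 : ℝ) ≤ d := by positivity
  rw [mul_pow, mul_pow, Real.sq_sqrt hd, div_pow, Real.sq_sqrt (by norm_num),
    Real.sq_sqrt (by linarith), ← pow_succ] at h
  exact h.trans (div_le_self (by norm_num) ht1)

/-- The constant in the mean error of the zeroth-order estimator. -/
def zoErrorConst (L LG : ℝ) : ℝ :=
  LG * (Real.sqrt 2 * (1 + normalMoment 4))
    + Real.sqrt (L ^ 2 * normalMoment 4 + LG ^ 2 * normalMoment 6)

lemma zoErrorConst_nonneg {L LG : ℝ} (hLG : 0 ≤ LG) : 0 ≤ zoErrorConst L LG := by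
  have := normalMoment_nonneg (k := 4) (by decide)
  unfold zoErrorConst
  positivity

/-- The mean error of the zeroth-order estimator is `O(1/√t)`, uniformly in the dimension. -/
lemma zo_error_le {L LG : ℝ} (hLG : 0 ≤ LG) (d t : ℕ) (ht : 1 ≤ t) :
    LG * smoothing d t * ((1 + normalMoment 4) * (d * Real.sqrt d))
      + Real.sqrt ((2 * d * L ^ 2 * normalMoment 4
        + 2 * LG ^ 2 * smoothing d t ^ 2 * (d ^ 3 * normalMoment 6)) / (t * zoBatchSize d t)) ≤
      zoErrorConst L LG / Real.sqrt t := by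
  have hM4 := normalMoment_nonneg (k := 4) (by decide)
  have hM6 := normalMoment_nonneg (k := 6) (by decide)
  have ht1 : (1 : ℝ) ≤ t := by exact_mod_cast ht
  have ht0 : (0 : ℝ) < t := by linarith
  have hd : (0 : ℝ) ≤ d := by positivity
  have hst : 0 < Real.sqrt t := Real.sqrt_pos.2 ht0
  have e0 : zoErrorConst L LG / Real.sqrt t = LG * (Real.sqrt 2 * (1 + normalMoment 4)) / Real.sqrt t
      + Real.sqrt (L ^ 2 * normalMoment 4 + LG ^ 2 * normalMoment 6) / Real.sqrt t := by
    rw [zoErrorConst, add_div]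
  rw [e0]
  refine add_le_add ?_ ?_
  · have h1 := mul_le_mul_of_nonneg_left (smoothing_mul_le d t ht)
      (mul_nonneg hLG (by linarith : 0 ≤ 1 + normalMoment 4))
    have e : LG * (Real.sqrt 2 * (1 + normalMoment 4)) / Real.sqrt t
        = LG * (1 + normalMoment 4) * (Real.sqrt 2 / Real.sqrt t) := by ring
    rw [e]
    refine le_trans (le_of_eq ?_) h1
    ring
  · rw [← Real.sqrt_div (by positivity)]
    apply Real.sqrt_le_sqrt
    have h2 : 2 * d * L ^ 2 * normalMoment 4
        + 2 * LG ^ 2 * smoothing d t ^ 2 * (d ^ 3 * normalMoment 6) ≤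
        2 * ((d : ℝ) + 5) * (L ^ 2 * normalMoment 4 + LG ^ 2 * normalMoment 6) := by
      have h3 := mul_le_mul_of_nonneg_left (smoothing_sq_mul_le d t ht)
        (by positivity : 0 ≤ 2 * LG ^ 2 * normalMoment 6)
      have h4 : 0 ≤ L ^ 2 * normalMoment 4 := by positivity
      have h5 : 0 ≤ (d : ℝ) * (LG ^ 2 * normalMoment 6) := by positivity
      have h6 : 0 ≤ LG ^ 2 * normalMoment 6 := by positivity
      linarith
    have hz : ((zoBatchSize d t : ℕ) : ℝ) = 2 * ((d : ℝ) + 5) * t := by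
      unfold zoBatchSize; push_cast; ring
    rw [hz]
    refine (div_le_div_of_nonneg_right h2 (by positivity)).trans ?_
    have e : 2 * ((d : ℝ) + 5) * (L ^ 2 * normalMoment 4 + LG ^ 2 * normalMoment 6)
        / (t * (2 * ((d : ℝ) + 5) * t)) =
        (L ^ 2 * normalMoment 4 + LG ^ 2 * normalMoment 6) / t / t := by field_simp
    rw [e]
    exact div_le_self (by positivity) ht1

end

section

variable {dX dY : ℕ} {Ξ Ω α : Type*} [MeasurableSpace Ξ] [MeasurableSpace Ω] [MeasurableSpace α]
  {c : Constants} {σ : ℝ} {X A : Set (E dX)} {Y B : Set (E dY)} {P : Measure Ξ}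
  {Q : Measure Ω} {F : ℕ → E dX → E dY → Ξ → ℝ} {T : ℕ}

/-- Regret of the Frank-Wolfe iterates whose gradient estimates are batch averages with mean error
`O(1/√t)`. -/
lemma Leader.regret_le [IsProbabilityMeasure Q] {gx : ℕ → E dX → E dY → E dX}
    {gy : ℕ → E dX → E dY → E dY} {u : ℕ → E dX} {v : ℕ → E dY}
    (h : Leader c X Y (fun i => mean P (F i)) gx gy T u v)
    (hf : ∀ i ∈ Icc 1 T, Measurable fun z : E dX × E dY => mean P (F i) z.1 z.2)
    {lmo : ℕ → E dX × E dY → E dX × E dY} (hl : ∀ t, IsLMO X Y (lmo t)) {z₁ : E dX × E dY}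
    (hz₁ : z₁ ∈ X ×ˢ Y) {W : ℕ → ℕ → ℕ → Ω → α} {κ : Measure α} (hW : IsIID W κ Q)
    {hx : ℕ → ℕ → E dX × E dY → α → E dX} {hy : ℕ → ℕ → E dX × E dY → α → E dY}
    {mX mY : ℕ → ℕ} {bX VX bY VY : ℕ → ℝ} {K : ℝ} (hK : 0 ≤ K)
    (hox : ∀ t ∈ Icc 1 T, BiasedOracle κ (X ×ˢ Y) t (hx t) gx (bX t) (VX t))
    (hoy : ∀ t ∈ Icc 1 T, BiasedOracle κ (X ×ˢ Y) t (hy t) gy (bY t) (VY t))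
    (hmX : ∀ t ∈ Icc 1 T, 0 < mX t) (hmY : ∀ t ∈ Icc 1 T, 0 < mY t)
    (hbX : ∀ t ∈ Icc 1 T, bX t + Real.sqrt (VX t / (t * mX t)) ≤ K / Real.sqrt t)
    (hbY : ∀ t ∈ Icc 1 T, bY t + Real.sqrt (VY t / (t * mY t)) ≤ K / Real.sqrt t)
    {z : ℕ → Ω → E dX × E dY}
    (hzdef : z = fwIterate stepSize lmo (fun t z ω =>
      (sampleMean (hx t) t (mX t) z (fun i j => W t i j ω),
        sampleMean (hy t) t (mY t) z (fun i j => W t i j ω))) z₁) :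
    Integrable (gap P F z T (u T) (v T)) Q ∧
      regret P Q F z T (u T) (v T) ≤ c.regretBound K * (T : ℝ) ^ (3 / 4 : ℝ) := by
  set Γ : ℕ → (E dX × E dY) × (ℕ → ℕ → α) → E dX × E dY := fun t p =>
    (sampleMean (hx t) t (mX t) p.1 p.2, sampleMean (hy t) t (mY t) p.1 p.2) with hΓdef
  have hzΓ : z = fwIterate stepSize lmo (fun t z ω => Γ t (z, fun i j => W t i j ω)) z₁ := hzdef
  have hΓ : ∀ t ∈ Icc 1 T, Measurable (Γ t) := fun t ht =>
    (measurable_sampleMean (hox t ht).measurable).prodMk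
      (measurable_sampleMean (hoy t ht).measurable)
  have hzm : ∀ t ∈ Icc 1 T, Measurable (z t) := fun t ht => by
    rw [hzΓ]
    exact measurable_fwIterate hl T hΓ t (mem_Icc.1 ht).2 fun s _ i j => hW.1 s i j
  have hzX : ∀ t ω, z t ω ∈ X ×ˢ Y := fun t ω => by
    rw [hzΓ]
    exact fwIterate_mem h.domain.convex_x h.domain.convex_y hl hz₁ t ω
  have hind : ∀ t ∈ Icc 1 T, IndepFun (z t) (fun ω i j => W t i j ω) Q := fun t ht => by
    rw [hzΓ]
    exact indepFun_fwIterate hl T hΓ hW t (mem_Icc.1 ht).2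
  refine h.expected_regret_le hf (z := z)
    (g := fun t ω => Γ t (z t ω, fun i j => W t i j ω))
    (s := fun t ω => lmo t ((Γ t (z t ω, fun i j => W t i j ω)).1,
      -(Γ t (z t ω, fun i j => W t i j ω)).2)) hzm hzX (fun t ω => (hl t).mem _)
    (fun t ω q hq => (hl t).le _ q hq) (fun t ω ht => ?_) hK (fun t ht => ?_) (fun t ht => ?_)
  · rw [hzΓ]
    exact fwIterate_succ ht ω
  · obtain ⟨h1, h2⟩ := (hox t ht).integral_error_le (mem_Icc.1 ht).1 (hmX t ht) hW (hzm t ht)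
      (hzX t) (hind t ht)
    exact ⟨h1, h2.trans (hbX t ht)⟩
  · obtain ⟨h1, h2⟩ := (hoy t ht).integral_error_le (mem_Icc.1 ht).1 (hmY t ht) hW (hzm t ht)
      (hzX t) (hind t ht)
    exact ⟨h1, h2.trans (hbY t ht)⟩

lemma BiasedOracle.comp {β : Type*} [MeasurableSpace β] {d : ℕ} {κ : Measure α} {κ' : Measure β}
    {S : Set (E dX × E dY)} {t : ℕ} {h : ℕ → E dX × E dY → α → E d} {g : ℕ → E dX → E dY → E d}
    {b V : ℝ} (ho : BiasedOracle κ S t h g b V) {π : β → α} (hπ : MeasurePreserving π κ' κ) :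
    BiasedOracle κ' S t (fun i z w => h i z (π w)) g b V where
  measurable i hi := (ho.measurable i hi).comp
    (measurable_fst.prodMk (hπ.measurable.comp measurable_snd))
  measurable_target := ho.measurable_target
  memLp i hi z hz := (ho.memLp i hi z hz).comp_measurePreserving hπ
  second_moment i hi z hz := by
    have hm : Measurable (h i z) := (ho.measurable i hi).comp measurable_prodMk_left
    have := ho.second_moment i hi z hz
    rwa [← hπ.map_eq, integral_map hπ.measurable.aemeasurable
      (hm.norm.pow_const 2).aestronglyMeasurable] at this
  bias i hi z hz := by
    have hm : Measurable (h i z) := (ho.measurable i hi).comp measurable_prodMk_left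
    have := ho.bias i hi z hz
    rwa [← hπ.map_eq, integral_map hπ.measurable.aemeasurable hm.aestronglyMeasurable] at this

lemma exists_norm_sub_eq {d : ℕ} (hd : 1 ≤ d) {S : Set (E d)} {u : E d} {δ : ℝ} (hδ : 0 ≤ δ)
    (h : Metric.closedBall u δ ⊆ S) : ∃ x ∈ S, ‖x - u‖ = δ := by
  refine ⟨u + EuclideanSpace.single ⟨0, hd⟩ δ, h ?_, ?_⟩
  · simp [abs_of_nonneg hδ]
  · simp [abs_of_nonneg hδ]

lemma nonneg_of_norm_le {V : Type*} [SeminormedAddCommGroup V] {a : V} {L r δ : ℝ} (hδ : 0 < δ)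
    (hr : r = δ) (h : ‖a‖ ≤ L * r) : 0 ≤ L :=
  nonneg_of_mul_nonneg_left ((norm_nonneg a).trans h) (hr ▸ hδ)

lemma Setting.domain (h : Setting c σ X Y P F T) : Domain c X Y :=
  ⟨h.compact_x, h.compact_y, h.convex_x, h.convex_y, h.diam_x, h.diam_y⟩

/-- The constraint sets contain balls around the saddle points. -/
lemma Setting.ball_subset (h : Setting c σ X Y P F T) (hδX : 0 < c.deltaX) (hδY : 0 < c.deltaY)
    {t : ℕ} (ht : t ∈ Icc 1 T) {u : E dX} {v : E dY} (huv : IsArgMinMax X Y (averaged P F t) u v) :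
    Metric.closedBall u c.deltaX ⊆ X ∧ Metric.closedBall v c.deltaY ⊆ Y := by
  obtain ⟨-, -, h1, h2⟩ := h.border t ht u v huv
  exact ⟨closedBall_subset_of_le_infDist h.compact_x.isClosed hδX huv.mem_x h1,
    closedBall_subset_of_le_infDist h.compact_y.isClosed hδY huv.mem_y h2⟩

/-- The Lipschitz constants and diameters are nonnegative. -/
lemma Setting.admissible [IsProbabilityMeasure P] (hmuX : 0 < c.muX) (hmuY : 0 < c.muY)
    (hδX : 0 < c.deltaX)
    (hδY : 0 < c.deltaY) (hC0 : 0 ≤ c.C0) (hdX : 1 ≤ dX) (hdY : 1 ≤ dY) (hT : 1 ≤ T)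
    (h : Setting c σ X Y P F T) (hA : X ⊆ A) (hB : Y ⊆ B)
    (hg : ∀ t ∈ Icc 1 T, LipschitzGradient c.LGX c.LGY X A Y B P (F t)) {u : E dX} {v : E dY}
    (huv : IsArgMinMax X Y (averaged P F T) u v) : c.Admissible := by
  obtain ⟨hbx, hby⟩ := h.ball_subset hδX hδY (mem_Icc.2 ⟨hT, le_rfl⟩) huv
  obtain ⟨x, hx, hxu⟩ := exists_norm_sub_eq hdX hδX.le hbx
  obtain ⟨y, hy, hyv⟩ := exists_norm_sub_eq hdY hδY.le hby
  have hu := huv.mem_x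
  have hv := huv.mem_y
  have m1 : 1 ∈ Icc 1 T := mem_Icc.2 ⟨le_rfl, hT⟩
  obtain ⟨ξ₁, hl₁, hl₂⟩ := (h.lipschitz 1 m1).exists
  obtain ⟨ξ₂, hc₁, hc₂⟩ := (h.cross 1 m1).exists
  obtain ⟨ξ₃, hg₁, hg₂⟩ := (hg 1 m1).exists
  refine ⟨hmuX, hmuY, hδX, hδY, hC0, ?_, ?_, ?_, ?_, ?_, ?_, ?_, ?_⟩
  · exact nonneg_of_norm_le (V := ℝ) hδX hxu (hl₁ x hx u hu v hv)
  · exact nonneg_of_norm_le (V := ℝ) hδY hyv (hl₂ u hu y hy v hv)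
  · exact nonneg_of_norm_le hδX hxu (hg₁ x (hA hx) u (hA hu) v hv)
  · exact nonneg_of_norm_le hδY hyv (hg₂ u hu y (hB hy) v (hB hv))
  · exact nonneg_of_norm_le hδY hyv (hc₁ u hu y hy v hv)
  · exact nonneg_of_norm_le hδX hxu (hc₂ x hx u hu v hv)
  · exact (norm_nonneg _).trans (h.diam_x x hx u hu)
  · exact (norm_nonneg _).trans (h.diam_y y hy v hv)

/-- The saddle points of the averaged functions. -/
lemma Setting.exists_leader [IsProbabilityMeasure P] (hc : c.Admissible)
    (h : Setting c σ X Y P F T) (hA : X ⊆ A) (hB : Y ⊆ B)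
    (hg : ∀ t ∈ Icc 1 T, LipschitzGradient c.LGX c.LGY X A Y B P (F t)) {u : E dX} {v : E dY}
    (huv : IsArgMinMax X Y (averaged P F T) u v) :
    ∃ u' v', Leader c X Y (fun i => mean P (F i)) (fun i => meanGradX P (F i))
      (fun i => meanGradY P (F i)) T u' v' ∧ u' T = u ∧ v' T = v := by
  have hs : ∀ t ∈ Icc 1 T, SmoothSaddle c X Y (mean P (F t)) (meanGradX P (F t))
      (meanGradY P (F t)) := fun t ht =>
    smoothSaddle_mean h.convex_x h.convex_y hA hB (h.strong t ht) (h.lipschitz t ht)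
      (h.cross t ht) (h.oracle t ht) (hg t ht)
  have hav : ∀ t ∈ Icc 1 T, SmoothSaddle c X Y (averaged P F t)
      (avg (fun i => meanGradX P (F i)) t) (avg (fun i => meanGradY P (F i)) t) := fun t ht =>
    SmoothSaddle.average (mem_Icc.1 ht).1 h.convex_x h.convex_y fun i hi =>
      hs i (mem_Icc.2 ⟨(mem_Icc.1 hi).1, (mem_Icc.1 hi).2.trans (mem_Icc.1 ht).2⟩)
  have hex : ∀ t, ∃ p : E dX × E dY, (t ∈ Icc 1 T → IsArgMinMax X Y (averaged P F t) p.1 p.2) ∧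
      (t = T → p = (u, v)) := by
    intro t
    by_cases htT : t = T
    · exact ⟨(u, v), fun _ => htT ▸ huv, fun _ => rfl⟩
    by_cases ht : t ∈ Icc 1 T
    · obtain ⟨u', v', h'⟩ := exists_isArgMinMax hc h.domain (hav t ht) ⟨u, huv.mem_x⟩
        ⟨v, huv.mem_y⟩
      exact ⟨(u', v'), fun _ => h', fun e => absurd e htT⟩
    · exact ⟨(u, v), fun h' => absurd h' ht, fun _ => rfl⟩
  choose p hp hpT using hex
  refine ⟨fun t => (p t).1, fun t => (p t).2, ⟨hc, h.domain, hs, fun t ht =>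
    (hp t ht).isSaddle hc h.domain (hav t ht), fun t ht =>
      (h.ball_subset hc.deltaX hc.deltaY ht (hp t ht)).1, fun t ht =>
      (h.ball_subset hc.deltaX hc.deltaY ht (hp t ht)).2⟩, ?_, ?_⟩
  · simp [hpT T rfl]
  · simp [hpT T rfl]

lemma Setting.gradX_le (hc : c.Admissible) (h : Setting c σ X Y P F T)
    (hX : (interior X).Nonempty) {t : ℕ} (ht : t ∈ Icc 1 T) :
    ∀ᵐ ξ ∂P, ∀ x ∈ X, ∀ y ∈ Y, ‖gradX (F t) x y ξ‖ ≤ c.LX :=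
  (h.lipschitz t ht).mono fun ξ hξ _ hx y hy => norm_gradient_le hc.LX
    ((h.strong t ht).contDiff_x y ξ) h.convex_x hX (fun x₁ h₁ x₂ h₂ => hξ.1 x₁ h₁ x₂ h₂ y hy) hx

lemma Setting.gradY_le (hc : c.Admissible) (h : Setting c σ X Y P F T)
    (hY : (interior Y).Nonempty) {t : ℕ} (ht : t ∈ Icc 1 T) :
    ∀ᵐ ξ ∂P, ∀ x ∈ X, ∀ y ∈ Y, ‖gradY (F t) x y ξ‖ ≤ c.LY :=
  (h.lipschitz t ht).mono fun ξ hξ x hx _ hy => norm_gradient_le hc.LY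
    ((h.strong t ht).contDiff_y x ξ) h.convex_y hY (fun y₁ h₁ y₂ h₂ => hξ.2 x hx y₁ h₁ y₂ h₂) hy

lemma Setting.measurable_gradX (h : Setting c σ X Y P F T) {t : ℕ} (ht : t ∈ Icc 1 T) :
    Measurable fun p : (E dX × E dY) × Ξ => gradX (F t) p.1.1 p.1.2 p.2 :=
  OnlineSaddle.measurable_gradX (h.oracle t ht).measurable (h.strong t ht).contDiff_x

lemma Setting.measurable_gradY (h : Setting c σ X Y P F T) {t : ℕ} (ht : t ∈ Icc 1 T) :
    Measurable fun p : (E dX × E dY) × Ξ => gradY (F t) p.1.1 p.1.2 p.2 :=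
  OnlineSaddle.measurable_gradY (h.oracle t ht).measurable (h.strong t ht).contDiff_y

lemma Setting.measurable_meanGradX [IsProbabilityMeasure P] (h : Setting c σ X Y P F T) {t : ℕ}
    (ht : t ∈ Icc 1 T) : Measurable fun z : E dX × E dY => meanGradX P (F t) z.1 z.2 :=
  ((h.measurable_gradX ht).stronglyMeasurable.integral_prod_right' (ν := P)).measurable

lemma Setting.measurable_meanGradY [IsProbabilityMeasure P] (h : Setting c σ X Y P F T) {t : ℕ}
    (ht : t ∈ Icc 1 T) : Measurable fun z : E dX × E dY => meanGradY P (F t) z.1 z.2 :=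
  ((h.measurable_gradY ht).stronglyMeasurable.integral_prod_right' (ν := P)).measurable

lemma memLp_two_and_integral_sq_le [IsProbabilityMeasure P] {d : ℕ} {g : Ξ → E d} {L : ℝ}
    (hg : Measurable g) (h : ∀ᵐ ξ ∂P, ‖g ξ‖ ≤ L) : MemLp g 2 P ∧ ∫ ξ, ‖g ξ‖ ^ 2 ∂P ≤ L ^ 2 := by
  have hm : MemLp g 2 P := MemLp.of_bound hg.aestronglyMeasurable L h
  refine ⟨hm, ?_⟩
  refine (integral_mono_ae hm.integrable_norm_pow' (integrable_const (L ^ 2)) ?_).trans_eq (by simp)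
  filter_upwards [h] with ξ hξ
  exact pow_le_pow_left₀ (norm_nonneg _) hξ 2

/-- The first-order oracle in `x` is unbiased. -/
lemma Setting.oracle_foX [IsProbabilityMeasure P] (hc : c.Admissible) (h : Setting c σ X Y P F T)
    (hX : (interior X).Nonempty) {t : ℕ} (ht : t ≤ T) :
    BiasedOracle P (X ×ˢ Y) t (fun i z ξ => gradX (F i) z.1 z.2 ξ)
      (fun i => meanGradX P (F i)) 0 (c.LX ^ 2) := by
  have hm : ∀ i ∈ Icc 1 t, i ∈ Icc 1 T := fun i hi =>
    mem_Icc.2 ⟨(mem_Icc.1 hi).1, (mem_Icc.1 hi).2.trans ht⟩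
  have hb : ∀ i ∈ Icc 1 t, ∀ z ∈ X ×ˢ Y, MemLp (fun ξ => gradX (F i) z.1 z.2 ξ) 2 P ∧
      ∫ ξ, ‖gradX (F i) z.1 z.2 ξ‖ ^ 2 ∂P ≤ c.LX ^ 2 := fun i hi z hz =>
    memLp_two_and_integral_sq_le ((h.measurable_gradX (hm i hi)).comp measurable_prodMk_left)
      ((h.gradX_le hc hX (hm i hi)).mono fun ξ hξ => hξ z.1 hz.1 z.2 hz.2)
  exact ⟨fun i hi => h.measurable_gradX (hm i hi), fun i hi => h.measurable_meanGradX (hm i hi),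
    fun i hi z hz => (hb i hi z hz).1, fun i hi z hz => (hb i hi z hz).2,
    fun i hi z hz => by simp [meanGradX]⟩

/-- The first-order oracle in `y` is unbiased. -/
lemma Setting.oracle_foY [IsProbabilityMeasure P] (hc : c.Admissible) (h : Setting c σ X Y P F T)
    (hY : (interior Y).Nonempty) {t : ℕ} (ht : t ≤ T) :
    BiasedOracle P (X ×ˢ Y) t (fun i z ξ => gradY (F i) z.1 z.2 ξ)
      (fun i => meanGradY P (F i)) 0 (c.LY ^ 2) := by
  have hm : ∀ i ∈ Icc 1 t, i ∈ Icc 1 T := fun i hi =>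
    mem_Icc.2 ⟨(mem_Icc.1 hi).1, (mem_Icc.1 hi).2.trans ht⟩
  have hb : ∀ i ∈ Icc 1 t, ∀ z ∈ X ×ˢ Y, MemLp (fun ξ => gradY (F i) z.1 z.2 ξ) 2 P ∧
      ∫ ξ, ‖gradY (F i) z.1 z.2 ξ‖ ^ 2 ∂P ≤ c.LY ^ 2 := fun i hi z hz =>
    memLp_two_and_integral_sq_le ((h.measurable_gradY (hm i hi)).comp measurable_prodMk_left)
      ((h.gradY_le hc hY (hm i hi)).mono fun ξ hξ => hξ z.1 hz.1 z.2 hz.2)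
  exact ⟨fun i hi => h.measurable_gradY (hm i hi), fun i hi => h.measurable_meanGradY (hm i hi),
    fun i hi z hz => (hb i hi z hz).1, fun i hi z hz => (hb i hi z hz).2,
    fun i hi z hz => by simp [meanGradY]⟩

/-- The zeroth-order oracle in `x`. -/
lemma Setting.oracle_zoX [IsProbabilityMeasure P] (hc : c.Admissible) (h : Setting c σ X Y P F T)
    (hX : (interior X).Nonempty)
    (hg : ∀ t ∈ Icc 1 T, LipschitzGradient c.LGX c.LGY X Set.univ Y Set.univ P (F t)) {t : ℕ}
    (ht1 : 1 ≤ t) (ht : t ≤ T) :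
    BiasedOracle (P.prod (stdGaussian (E dX))) (X ×ˢ Y) t
      (fun i z w => twoPoint (fun x ξ => F i x z.2 ξ) (smoothing dX t) z.1 w)
      (fun i => meanGradX P (F i))
      (c.LGX * smoothing dX t * ((1 + normalMoment 4) * (dX * Real.sqrt dX)))
      (2 * dX * c.LX ^ 2 * normalMoment 4
        + 2 * c.LGX ^ 2 * smoothing dX t ^ 2 * (dX ^ 3 * normalMoment 6)) := by
  have hm : ∀ i ∈ Icc 1 t, i ∈ Icc 1 T := fun i hi =>
    mem_Icc.2 ⟨(mem_Icc.1 hi).1, (mem_Icc.1 hi).2.trans ht⟩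
  have key : ∀ i ∈ Icc 1 t, ∀ z ∈ X ×ˢ Y, _ := fun i hi z hz =>
    twoPoint_moments (P := P) (φ := fun x ξ => F i x z.2 ξ) (x := z.1) (L := c.LX)
      (smoothing_pos dX t ht1) hc.LGX
      ((h.oracle i (hm i hi)).measurable.comp
        (by fun_prop : Measurable fun p : E dX × Ξ => (p.1, z.2, p.2)))
      (fun ξ => ((h.strong i (hm i hi)).contDiff_x z.2 ξ).differentiable one_ne_zero)
      ((hg i (hm i hi)).mono fun ξ hξ x₁ x₂ =>
        hξ.1 x₁ (Set.mem_univ _) x₂ (Set.mem_univ _) z.2 hz.2)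
      ((h.gradX_le hc hX (hm i hi)).mono fun ξ hξ => hξ z.1 hz.1 z.2 hz.2)
  refine ⟨fun i hi => ?_, fun i hi => h.measurable_meanGradX (hm i hi),
    fun i hi z hz => (key i hi z hz).1, fun i hi z hz => (key i hi z hz).2.1,
    fun i hi z hz => (key i hi z hz).2.2⟩
  have hF := (h.oracle i (hm i hi)).measurable
  have h1 : Measurable fun p : (E dX × E dY) × (Ξ × E dX) =>
      (p.1.1 + smoothing dX t • p.2.2, p.1.2, p.2.1) := by fun_prop
  have h2 : Measurable fun p : (E dX × E dY) × (Ξ × E dX) => (p.1.1, p.1.2, p.2.1) := by fun_prop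
  exact (((hF.comp h1).sub (hF.comp h2)).div_const (smoothing dX t)).smul
    (measurable_snd.comp measurable_snd)

/-- The zeroth-order oracle in `y`. -/
lemma Setting.oracle_zoY [IsProbabilityMeasure P] (hc : c.Admissible) (h : Setting c σ X Y P F T)
    (hY : (interior Y).Nonempty)
    (hg : ∀ t ∈ Icc 1 T, LipschitzGradient c.LGX c.LGY X Set.univ Y Set.univ P (F t)) {t : ℕ}
    (ht1 : 1 ≤ t) (ht : t ≤ T) :
    BiasedOracle (P.prod (stdGaussian (E dY))) (X ×ˢ Y) t
      (fun i z w => twoPoint (fun y ξ => F i z.1 y ξ) (smoothing dY t) z.2 w)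
      (fun i => meanGradY P (F i))
      (c.LGY * smoothing dY t * ((1 + normalMoment 4) * (dY * Real.sqrt dY)))
      (2 * dY * c.LY ^ 2 * normalMoment 4
        + 2 * c.LGY ^ 2 * smoothing dY t ^ 2 * (dY ^ 3 * normalMoment 6)) := by
  have hm : ∀ i ∈ Icc 1 t, i ∈ Icc 1 T := fun i hi =>
    mem_Icc.2 ⟨(mem_Icc.1 hi).1, (mem_Icc.1 hi).2.trans ht⟩
  have key : ∀ i ∈ Icc 1 t, ∀ z ∈ X ×ˢ Y, _ := fun i hi z hz =>
    twoPoint_moments (P := P) (φ := fun y ξ => F i z.1 y ξ) (x := z.2) (L := c.LY)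
      (smoothing_pos dY t ht1) hc.LGY
      ((h.oracle i (hm i hi)).measurable.comp
        (by fun_prop : Measurable fun p : E dY × Ξ => (z.1, p.1, p.2)))
      (fun ξ => ((h.strong i (hm i hi)).contDiff_y z.1 ξ).differentiable one_ne_zero)
      ((hg i (hm i hi)).mono fun ξ hξ y₁ y₂ =>
        hξ.2 z.1 hz.1 y₁ (Set.mem_univ _) y₂ (Set.mem_univ _))
      ((h.gradY_le hc hY (hm i hi)).mono fun ξ hξ => hξ z.1 hz.1 z.2 hz.2)
  refine ⟨fun i hi => ?_, fun i hi => h.measurable_meanGradY (hm i hi),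
    fun i hi z hz => (key i hi z hz).1, fun i hi z hz => (key i hi z hz).2.1,
    fun i hi z hz => (key i hi z hz).2.2⟩
  have hF := (h.oracle i (hm i hi)).measurable
  have h1 : Measurable fun p : (E dX × E dY) × (Ξ × E dY) =>
      (p.1.1, p.1.2 + smoothing dY t • p.2.2, p.2.1) := by fun_prop
  have h2 : Measurable fun p : (E dX × E dY) × (Ξ × E dY) => (p.1.1, p.1.2, p.2.1) := by fun_prop
  exact (((hF.comp h1).sub (hF.comp h2)).div_const (smoothing dY t)).smul
    (measurable_snd.comp measurable_snd)

/-- The mean error of the first-order estimator is `O(1/√t)`. -/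
lemma fo_error_le {L K : ℝ} (hL : 0 ≤ L) (hLK : L ≤ K) {t : ℕ} (ht : 1 ≤ t) :
    0 + Real.sqrt (L ^ 2 / (t * t)) ≤ K / Real.sqrt t := by
  have ht1 : (1 : ℝ) ≤ t := by exact_mod_cast ht
  have ht0 : (0 : ℝ) < t := by linarith
  have hst : Real.sqrt t ≤ t := Real.sqrt_le_iff.2 ⟨ht0.le, by nlinarith⟩
  rw [zero_add, Real.sqrt_div (sq_nonneg L), Real.sqrt_sq hL, Real.sqrt_mul_self ht0.le]
  exact div_le_div₀ (hL.trans hLK) hLK (Real.sqrt_pos.2 ht0) hst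

section Counting

lemma card_batch (t m : ℕ) : (batch t m).card = t * m := by simp [batch]

lemma sum_Icc_le_mul {g : ℕ → ℕ} {T M : ℕ} (h : ∀ t ∈ Icc 1 T, g t ≤ M) :
    ∑ t ∈ Icc 1 T, g t ≤ T * M := by
  simpa using Finset.sum_le_card_nsmul _ _ _ h

lemma zoBatchSize_add_le {dX dY T t : ℕ} (hdX : 1 ≤ dX) (hdY : 1 ≤ dY) (ht : t ∈ Icc 1 T) :
    zoBatchSize dX t + zoBatchSize dY t ≤ 12 * (dX + dY) * T := by
  have h1 : zoBatchSize dX t + zoBatchSize dY t = 2 * (dX + dY + 10) * t := by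
    unfold zoBatchSize; ring
  rw [h1]
  exact Nat.mul_le_mul (by omega) (mem_Icc.1 ht).2

lemma zoCalls_le {dX dY : ℕ} (hdX : 1 ≤ dX) (hdY : 1 ≤ dY) (T : ℕ) :
    zoCalls dX dY T ≤ 12 * (dX + dY) * T ^ 2 :=
  (sum_Icc_le_mul fun t ht => zoBatchSize_add_le hdX hdY ht).trans_eq (by ring)

lemma card_zoEvaluations (dX dY t : ℕ) :
    (zoEvaluations dX dY t).card = 2 * t * (zoBatchSize dX t + zoBatchSize dY t) := by
  simp only [zoEvaluations, card_disjSum, card_product, card_batch, card_univ, Fintype.card_bool]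
  ring

lemma zoCallsAll_le {dX dY : ℕ} (hdX : 1 ≤ dX) (hdY : 1 ≤ dY) (T : ℕ) :
    zoCallsAll dX dY T ≤ 24 * (dX + dY) * T ^ 3 := by
  refine (sum_Icc_le_mul (M := 2 * T * (12 * (dX + dY) * T)) fun t ht => ?_).trans_eq (by ring)
  rw [card_zoEvaluations]
  exact Nat.mul_le_mul (Nat.mul_le_mul le_rfl (mem_Icc.1 ht).2) (zoBatchSize_add_le hdX hdY ht)

lemma card_filter_functionIndex_le (dX dY t k : ℕ) :
    #{e ∈ zoEvaluations dX dY t | functionIndex e = k} ≤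
      2 * (zoBatchSize dX t + zoBatchSize dY t) := by
  have hsub : {e ∈ zoEvaluations dX dY t | functionIndex e = k} ⊆
      ((univ : Finset Bool) ×ˢ ({k} ×ˢ Icc 1 (zoBatchSize dX t))).disjSum
        ((univ : Finset Bool) ×ˢ ({k} ×ˢ Icc 1 (zoBatchSize dY t))) := by
    intro e he
    rw [mem_filter, zoEvaluations] at he
    obtain ⟨h1, h2⟩ := he
    rcases e with e | e <;>
    · simp only [inl_mem_disjSum, inr_mem_disjSum, mem_product, batch, functionIndex,
        Sum.elim_inl, Sum.elim_inr, mem_singleton] at h1 h2 ⊢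
      exact ⟨h1.1, h2, h1.2.2⟩
  refine (card_le_card hsub).trans_eq ?_
  simp
  ring

lemma zoCallsOf_le {dX dY : ℕ} (hdX : 1 ≤ dX) (hdY : 1 ≤ dY) (T k : ℕ) :
    zoCallsOf dX dY T k ≤ 24 * (dX + dY) * T ^ 2 := by
  refine (sum_Icc_le_mul (M := 2 * (12 * (dX + dY) * T)) fun t ht => ?_).trans_eq (by ring)
  exact (card_filter_functionIndex_le dX dY t k).trans
    (Nat.mul_le_mul le_rfl (zoBatchSize_add_le hdX hdY ht))

end Counting

end

end OnlineSaddle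

end

theorem mainTheorem3 (c : OnlineSaddle.Constants)
    (hmuX : 0 < c.muX) (hmuY : 0 < c.muY) (hdX : 0 < c.deltaX) (hdY : 0 < c.deltaY)
    (hC0 : 0 ≤ c.C0) :
    ∃ K : ℝ, 0 < K ∧
      ∀ (dX dY : ℕ), 1 ≤ dX → 1 ≤ dY →
      ∀ (X : Set (OnlineSaddle.E dX)) (Y : Set (OnlineSaddle.E dY))
        (Ξ : Type*) [MeasurableSpace Ξ] (P : Measure Ξ) [IsProbabilityMeasure P]
        (F : ℕ → OnlineSaddle.E dX → OnlineSaddle.E dY → Ξ → ℝ)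
        (σ : ℝ) (T : ℕ), 0 ≤ σ → 1 ≤ T →
        OnlineSaddle.Setting c σ X Y P F T →
      ∀ (lmo : ℕ → OnlineSaddle.E dX × OnlineSaddle.E dY →
          OnlineSaddle.E dX × OnlineSaddle.E dY),
        (∀ t, OnlineSaddle.IsLMO X Y (lmo t)) →
      ∀ z₁ ∈ X ×ˢ Y,
      ∀ (u : OnlineSaddle.E dX) (v : OnlineSaddle.E dY),
        OnlineSaddle.IsArgMinMax X Y (OnlineSaddle.averaged P F T) u v →
      ∀ (Ω : Type*) [MeasurableSpace Ω] (Q : Measure Ω) [IsProbabilityMeasure Q],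
        -- (a) stochastic zeroth-order oracle
        ((∀ t ∈ Finset.Icc 1 T,
            OnlineSaddle.LipschitzGradient c.LGX c.LGY X Set.univ Y Set.univ P (F t)) →
          (∀ (S : OnlineSaddle.ZOSample dX dY Ξ Ω), S.IsSampling P Q →
            ∀ z : ℕ → Ω → OnlineSaddle.E dX × OnlineSaddle.E dY,
            z = OnlineSaddle.fwIterate OnlineSaddle.stepSize lmo
              (OnlineSaddle.zoEstimator F S
                (OnlineSaddle.zoBatchSize dX) (OnlineSaddle.zoBatchSize dY)
                (OnlineSaddle.smoothing dX) (OnlineSaddle.smoothing dY)) z₁ →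
            Integrable (OnlineSaddle.gap P F z T u v) Q ∧
            OnlineSaddle.regret P Q F z T u v ≤ K * ((1 + σ) * (T : ℝ) ^ (3 / 4 : ℝ))) ∧
          (OnlineSaddle.zoCalls dX dY T : ℝ) ≤ K * (((dX : ℝ) + dY) * (T : ℝ) ^ 2) ∧
          (∀ k, (OnlineSaddle.zoCallsOf dX dY T k : ℝ) ≤ K * (((dX : ℝ) + dY) * (T : ℝ) ^ 2)) ∧
          (OnlineSaddle.zoCallsAll dX dY T : ℝ) ≤ K * (((dX : ℝ) + dY) * (T : ℝ) ^ 3)) ∧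
        -- (b) stochastic first-order oracle
        ((∀ t ∈ Finset.Icc 1 T,
            OnlineSaddle.LipschitzGradient c.LGX c.LGY X X Y Y P (F t)) →
          ∀ ξ : ℕ → ℕ → ℕ → Ω → Ξ, OnlineSaddle.IsIID ξ P Q →
            ∀ z : ℕ → Ω → OnlineSaddle.E dX × OnlineSaddle.E dY,
            z = OnlineSaddle.fwIterate OnlineSaddle.stepSize lmo
              (OnlineSaddle.foEstimator F ξ (fun t => t)) z₁ →
            Integrable (OnlineSaddle.gap P F z T u v) Q ∧
            OnlineSaddle.regret P Q F z T u v ≤ K * ((1 + σ) * (T : ℝ) ^ (3 / 4 : ℝ))) := by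
  by_cases hadm : c.Admissible
  swap
  · refine ⟨1, one_pos, ?_⟩
    intro dX dY hdX' hdY' X Y Ξ _ P _ F σ T hσ hT h lmo hl z₁ hz₁ u v huv Ω _ Q _
    exact ⟨fun hg => absurd (h.admissible hmuX hmuY hdX hdY hC0 hdX' hdY' hT (Set.subset_univ X)
        (Set.subset_univ Y) hg huv) hadm,
      fun hg => absurd (h.admissible hmuX hmuY hdX hdY hC0 hdX' hdY' hT subset_rfl subset_rfl hg
        huv) hadm⟩
  have hza := add_nonneg (OnlineSaddle.zoErrorConst_nonneg (L := c.LX) hadm.LGX)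
    (OnlineSaddle.zoErrorConst_nonneg (L := c.LY) hadm.LGY)
  have hzb := add_nonneg hadm.LX hadm.LY
  set Ka := c.regretBound (OnlineSaddle.zoErrorConst c.LX c.LGX
    + OnlineSaddle.zoErrorConst c.LY c.LGY) with hKa
  set Kb := c.regretBound (c.LX + c.LY) with hKb
  have hKa0 : 0 ≤ Ka := hadm.regretBound_nonneg _
  have hKb0 : 0 ≤ Kb := hadm.regretBound_nonneg _
  refine ⟨Ka + Kb + 24, by positivity, ?_⟩
  intro dX dY hdX' hdY' X Y Ξ _ P _ F σ T hσ hT h lmo hl z₁ hz₁ u v huv Ω _ Q _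
  have hXi : (interior X).Nonempty := ⟨u, (h.border T (Finset.mem_Icc.2 ⟨hT, le_rfl⟩) u v huv).1⟩
  have hYi : (interior Y).Nonempty := ⟨v, (h.border T (Finset.mem_Icc.2 ⟨hT, le_rfl⟩) u v huv).2.1⟩
  have hmean : ∀ i ∈ Finset.Icc 1 T, Measurable fun z : OnlineSaddle.E dX × OnlineSaddle.E dY =>
      OnlineSaddle.mean P (F i) z.1 z.2 := fun i hi =>
    OnlineSaddle.measurable_mean (h.oracle i hi).measurable
  have hfin : ∀ {r K : ℝ}, 0 ≤ K → K ≤ Ka + Kb + 24 → r ≤ K * (T : ℝ) ^ (3 / 4 : ℝ) →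
      r ≤ (Ka + Kb + 24) * ((1 + σ) * (T : ℝ) ^ (3 / 4 : ℝ)) := by
    intro r K hK0 hK hr
    refine hr.trans (mul_le_mul hK ?_ (by positivity) (by positivity))
    exact le_mul_of_one_le_left (by positivity) (by linarith)
  have hcount : ∀ {n k : ℕ}, n ≤ 24 * (dX + dY) * T ^ k →
      (n : ℝ) ≤ (Ka + Kb + 24) * (((dX : ℝ) + dY) * (T : ℝ) ^ k) := by
    intro n k hn
    have h1 : (n : ℝ) ≤ 24 * (((dX : ℝ) + dY) * (T : ℝ) ^ k) := by
      rw [← mul_assoc]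
      exact_mod_cast hn
    exact h1.trans (mul_le_mul_of_nonneg_right (by linarith) (by positivity))
  refine ⟨fun hg => ⟨?_, ?_, ?_, ?_⟩, fun hg => ?_⟩
  · intro S hS z hz
    obtain ⟨u', v', hL, rfl, rfl⟩ := h.exists_leader hadm (Set.subset_univ X) (Set.subset_univ Y)
      hg huv
    obtain ⟨h1, h2⟩ := hL.regret_le hmean hl hz₁ hS hza
      (fun t ht => (h.oracle_zoX hadm hXi hg (Finset.mem_Icc.1 ht).1 (Finset.mem_Icc.1 ht).2).comp
        measurePreserving_fst)
      (fun t ht => (h.oracle_zoY hadm hYi hg (Finset.mem_Icc.1 ht).1 (Finset.mem_Icc.1 ht).2).comp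
        measurePreserving_snd)
      (mX := OnlineSaddle.zoBatchSize dX) (mY := OnlineSaddle.zoBatchSize dY)
      (fun t ht => Nat.mul_pos (by omega) (Finset.mem_Icc.1 ht).1)
      (fun t ht => Nat.mul_pos (by omega) (Finset.mem_Icc.1 ht).1)
      (fun t ht => (OnlineSaddle.zo_error_le hadm.LGX dX t (Finset.mem_Icc.1 ht).1).trans
        (div_le_div_of_nonneg_right (le_add_of_nonneg_right
          (OnlineSaddle.zoErrorConst_nonneg hadm.LGY)) (Real.sqrt_nonneg _)))
      (fun t ht => (OnlineSaddle.zo_error_le hadm.LGY dY t (Finset.mem_Icc.1 ht).1).trans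
        (div_le_div_of_nonneg_right (le_add_of_nonneg_left
          (OnlineSaddle.zoErrorConst_nonneg hadm.LGX)) (Real.sqrt_nonneg _)))
      hz
    exact ⟨h1, hfin hKa0 (by linarith) h2⟩
  · exact hcount ((OnlineSaddle.zoCalls_le hdX' hdY' T).trans
      (Nat.mul_le_mul (Nat.mul_le_mul (by norm_num) le_rfl) le_rfl))
  · exact fun k => hcount (OnlineSaddle.zoCallsOf_le hdX' hdY' T k)
  · exact hcount (OnlineSaddle.zoCallsAll_le hdX' hdY' T)
  · intro ξ hξ z hz
    obtain ⟨u', v', hL, rfl, rfl⟩ := h.exists_leader hadm subset_rfl subset_rfl hg huv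
    obtain ⟨h1, h2⟩ := hL.regret_le hmean hl hz₁ hξ hzb
      (fun t ht => h.oracle_foX hadm hXi (Finset.mem_Icc.1 ht).2)
      (fun t ht => h.oracle_foY hadm hYi (Finset.mem_Icc.1 ht).2)
      (mX := fun t => t) (mY := fun t => t)
      (fun t ht => (Finset.mem_Icc.1 ht).1) (fun t ht => (Finset.mem_Icc.1 ht).1)
      (fun t ht => OnlineSaddle.fo_error_le hadm.LX (le_add_of_nonneg_right hadm.LY)
        (Finset.mem_Icc.1 ht).1)
      (fun t ht => OnlineSaddle.fo_error_le hadm.LY (le_add_of_nonneg_left hadm.LX)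
        (Finset.mem_Icc.1 ht).1)
      hz
    exact ⟨h1, hfin hKb0 (by linarith) h2⟩
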